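/- Let $\boldsymbol{T}=(\boldsymbol{R}\cup\{-\infty\},\max,+)$ be the tropical semifield. A graph means a finite connected nonempty undirected multigraph, loops allowed; the valence of a vertex is its number of incident edges (loops counted twice), a leaf end is a vertex of valence one, and a leaf edge is an edge incident to a leaf end. An edge-weighted graph $(G,l)$ is a graph $G$ with a function $l:E(G)\to\boldsymbol{R}_{>0}\cup\{\infty\}$ that takes the value $\infty$ on leaf edges only. A tropical curve $\Gamma$ is the underlying topological space of an edge-weighted graph $(G,l)$, in which each edge $e$ is identified with the interval $[0,l(e)]$ (the one point compactification of $[0,\infty)$ if $l(e)=\infty$, a leaf end of $e$ being identified with $\infty$), together with the resulting path distance (points at infinity, i.e. points identified with $\infty$, have infinite distance from all other points). Every $(G,l)$ giving the same space with the same distance is called a model for $\Gamma$. A rational function on $\Gamma$ is either the constant function $-\infty$ or a continuous function $f:\Gamma\to\boldsymbol{R}\cup\{\pm\infty\}$ that is piecewise affine with integer slopes and finitely many pieces and takes the values $\pm\infty$ at points at infinity only. The set $\operatorname{Rat}(\Gamma)$ of rational functions is a commutative semiring with $f\oplus g=\max\{f,g\}$ and $f\odot g=f+g$ (pointwise at the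 points that are not at infinity, extended continuously to the points at infinity), and a $\boldsymbol{T}$-algebra through the constant functions. Let $\operatorname{Aut}_{\mathrm{semiring}}(\operatorname{Rat}(\Gamma))$ be the group of its semiring automorphisms and $\operatorname{Aut}_{\boldsymbol{T}}(\operatorname{Rat}(\Gamma))$ the subgroup of its $\boldsymbol{T}$-algebra automorphisms. For every tropical curve $\Gamma$, the following are equivalent: (1) there exists a model $(G,l)$ for $\Gamma$ such that $l(e)=\infty$ for every edge $e$ of $G$ (for a one-point curve, whose only model has no edges, this holds vacuously); (2) $\operatorname{Aut}_{\boldsymbol{T}}(\operatorname{Rat}(\Gamma))$ is a proper subgroup of $\operatorname{Aut}_{\mathrm{semiring}}(\operatorname{Rat}(\Gamma))$. -/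

import Mathlib

open Set Filter Topology
open scoped ENNReal

/-! ### The tropical semifield `𝕋 = (ℝ ∪ {-∞}, max, +)` -/

/-- The underlying set `ℝ ∪ {-∞}` of the tropical semifield (max-plus convention). -/
@[ext]
structure TropicalSemifield : Type where
  /-- the underlying element of `ℝ ∪ {-∞}` -/
  val : WithBot ℝ

namespace TropicalSemifield

/-- Tropical addition is `max`. -/
noncomputable instance : Add TropicalSemifield := ⟨fun a b => ⟨max a.val b.val⟩⟩

/-- Tropical multiplication is the usual `+`, with `a + (-∞) = (-∞) + a = -∞`. -/
noncomputable instance : Mul TropicalSemifield := ⟨fun a b => ⟨a.val + b.val⟩⟩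

instance : Zero TropicalSemifield := ⟨⟨⊥⟩⟩

noncomputable instance : One TropicalSemifield := ⟨⟨((0 : ℝ) : WithBot ℝ)⟩⟩

@[simp] theorem val_add (a b : TropicalSemifield) : (a + b).val = max a.val b.val := rfl

@[simp] theorem val_mul (a b : TropicalSemifield) : (a * b).val = a.val + b.val := rfl

@[simp] theorem val_zero : (0 : TropicalSemifield).val = ⊥ := rfl

@[simp] theorem val_one : (1 : TropicalSemifield).val = 0 := rfl

theorem left_distrib_aux (a b c : WithBot ℝ) : a + max b c = max (a + b) (a + c) :=
  (monotone_const.add monotone_id : Monotone fun x : WithBot ℝ => a + x).map_max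

noncomputable instance : CommSemiring TropicalSemifield where
  add_assoc a b c := by ext1; simp [max_assoc]
  zero_add a := by ext1; simp
  add_zero a := by ext1; simp
  add_comm a b := by ext1; simp [max_comm]
  left_distrib a b c := by ext1; simp [left_distrib_aux]
  right_distrib a b c := by
    ext1
    simp only [val_mul, val_add]
    rw [add_comm, left_distrib_aux, add_comm c.val, add_comm c.val]
  zero_mul a := by ext1; simp
  mul_zero a := by ext1; simp
  mul_assoc a b c := by ext1; simp [add_assoc]
  one_mul a := by ext1; simp
  mul_one a := by ext1; simp
  mul_comm a b := by ext1; simp [add_comm]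
  nsmul := nsmulRec

/-- The inclusion `ℝ ∪ {-∞} ⊆ ℝ ∪ {±∞}`. -/
noncomputable def toEReal (a : TropicalSemifield) : EReal :=
  WithBot.recBotCoe ⊥ (fun r : ℝ => (r : EReal)) a.val

theorem eq_zero_or_coe (a : TropicalSemifield) : a = 0 ∨ ∃ r : ℝ, a = ⟨(r : WithBot ℝ)⟩ := by
  obtain ⟨a⟩ := a
  induction a with
  | bot => exact Or.inl rfl
  | coe r => exact Or.inr ⟨r, rfl⟩

@[simp] theorem toEReal_zero : toEReal 0 = ⊥ := rfl

@[simp] theorem toEReal_coe (r : ℝ) : toEReal ⟨(r : WithBot ℝ)⟩ = r := rfl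

@[simp] theorem toEReal_one : toEReal 1 = 0 := rfl

theorem toEReal_add (a b : TropicalSemifield) : toEReal (a + b) = max (toEReal a) (toEReal b) := by
  rcases eq_zero_or_coe a with rfl | ⟨r, rfl⟩
  · simp
  rcases eq_zero_or_coe b with rfl | ⟨s, rfl⟩
  · simp
  · have h : (⟨(r : WithBot ℝ)⟩ + ⟨(s : WithBot ℝ)⟩ : TropicalSemifield) =
        ⟨((max r s : ℝ) : WithBot ℝ)⟩ := by
      ext1; simp
    rw [h, toEReal_coe, toEReal_coe, toEReal_coe]
    exact EReal.coe_strictMono.monotone.map_max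

theorem toEReal_mul (a b : TropicalSemifield) : toEReal (a * b) = toEReal a + toEReal b := by
  rcases eq_zero_or_coe a with rfl | ⟨r, rfl⟩
  · simp
  rcases eq_zero_or_coe b with rfl | ⟨s, rfl⟩
  · simp
  · exact EReal.coe_add r s

end TropicalSemifield

/-! ### Edge-weighted graphs -/

/-- The valence of a vertex of a (multi)graph: the number of incident edges, loops counted twice. -/
noncomputable def Graph.valence {V E : Type*} (G : Graph V E) (v : V) : ℕ :=
  {e | G.Inc e v}.ncard + {e | G.IsLoopAt e v}.ncard

/-- An edge-weighted graph `(G, l)`: a finite connected nonempty multigraph (loops allowed) with a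
length function with values in `(0, ∞]` which may take the value `∞` on leaf edges only. -/
structure EdgeWeightedGraph (V E : Type*) where
  /-- the graph `G` -/
  graph : Graph V E
  finite_vertexSet : graph.vertexSet.Finite
  finite_edgeSet : graph.edgeSet.Finite
  nonempty_vertexSet : graph.vertexSet.Nonempty
  connected : ∀ v ∈ graph.vertexSet, ∀ w ∈ graph.vertexSet, Relation.ReflTransGen graph.Adj v w
  /-- the length function `l` -/
  length : graph.edgeSet → ℝ≥0∞
  length_pos : ∀ e, 0 < length e
  leaf_of_length_eq_top : ∀ e, length e = ∞ → ∃ v, graph.Inc e v ∧ graph.valence v = 1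

/-! ### Tropical curves -/

/-- A presentation of the topological space `X` as the underlying space of an edge-weighted graph,
whose vertices are points of `X`, together with an identification of each edge `e` with the closed
interval `[0, l(e)]`. The interval `[0, ∞]` carries the topology of `ℝ≥0∞`, which is the one point
compactification of `[0, ∞)`. -/
structure GraphPresentation (X : Type*) [TopologicalSpace X] where
  /-- the type that the edges are taken from -/
  E : Type
  /-- the edge-weighted graph `(G, l)` -/
  G : EdgeWeightedGraph X E
  /-- the identification of an edge with `[0, l(e)]` -/
  edge : (e : G.graph.edgeSet) → Set.Iic (G.length e) → X
  /-- the ends of the interval are the ends of the edge -/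
  isLink : ∀ e : G.graph.edgeSet, G.graph.IsLink e (edge e ⊥) (edge e ⊤)
  /-- if `l(e) = ∞`, then `∞` is identified with a leaf end of `e` -/
  valence_edge_top : ∀ e, G.length e = ∞ → G.graph.valence (edge e ⊤) = 1
  /-- interior points of edges are not vertices -/
  interior_notMem : ∀ e t, t ≠ ⊥ → t ≠ ⊤ → edge e t ∉ G.graph.vertexSet
  /-- interior points of edges are pairwise distinct -/
  interior_injective : ∀ e s e' s', s ≠ ⊥ → s ≠ ⊤ → s' ≠ ⊥ → s' ≠ ⊤ → edge e s = edge e' s' →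
    (⟨e, s⟩ : Σ e, Set.Iic (G.length e)) = ⟨e', s'⟩
  /-- every point is a vertex or an interior point of an edge -/
  exists_of_notMem : ∀ x ∉ G.graph.vertexSet, ∃ e t, t ≠ ⊥ ∧ t ≠ ⊤ ∧ edge e t = x
  /-- the topology of `X` is the one obtained by gluing the edges along the vertices -/
  isOpen_iff : ∀ U : Set X, IsOpen U ↔ ∀ e, IsOpen (edge e ⁻¹' U)

namespace GraphPresentation

variable {X : Type*} [TopologicalSpace X] (M : GraphPresentation X)

/-- `M.PathLength x y L`: there is a path from `x` to `y` of total length `L` that is the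
concatenation of finitely many segments, each contained in one edge. -/
inductive PathLength : X → X → ℝ≥0∞ → Prop
  | refl (x : X) : PathLength x x 0
  | step (e : M.G.graph.edgeSet) (s t : Set.Iic (M.G.length e)) {y : X} {L : ℝ≥0∞}
      (h : PathLength (M.edge e t) y L) :
      PathLength (M.edge e s) y (edist (s : ℝ≥0∞) (t : ℝ≥0∞) + L)

/-- The distance of two points: the infimum of the lengths of paths between them. -/
noncomputable def dist (x y : X) : ℝ≥0∞ := sInf {L | M.PathLength x y L}

end GraphPresentation

/-- A model for `X`, where `X` is a topological space with an extended distance: an edge-weighted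
graph with identifications of its edges with intervals, such that the underlying topological space
is `X` and the path distance is the distance of `X`. (A point at infinity is at infinite distance
from all other points without being isolated, so the distance does not induce the topology.) -/
structure TropicalModel (X : Type*) [TopologicalSpace X] [EDist X] extends
    GraphPresentation X where
  edist_eq : ∀ x y, edist x y = toGraphPresentation.dist x y

/-- A tropical curve: a topological space with an extended distance which has a model. -/
class TropicalCurve (X : Type*) [TopologicalSpace X] [EDist X] : Prop where
  exists_model : Nonempty (TropicalModel X)

/-- The set of all points at infinity, that is the points identified with `∞` on some edge. -/
def pointsAtInfinity (X : Type*) [TopologicalSpace X] [EDist X] : Set X :=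
  {x | ∃ (M : TropicalModel X) (e : M.G.graph.edgeSet), M.G.length e = ∞ ∧ M.edge e ⊤ = x}

namespace GraphPresentation

variable {X : Type*} [TopologicalSpace X] (M : GraphPresentation X)

theorem edge_bot_mem (e : M.G.graph.edgeSet) : M.edge e ⊥ ∈ M.G.graph.vertexSet :=
  (M.isLink e).left_mem

theorem edge_top_mem (e : M.G.graph.edgeSet) : M.edge e ⊤ ∈ M.G.graph.vertexSet :=
  (M.isLink e).right_mem

theorem continuous_edge (e : M.G.graph.edgeSet) : Continuous (M.edge e) :=
  continuous_def.2 fun U hU => (M.isOpen_iff U).1 hU e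

theorem edge_eq_top {e e' : M.G.graph.edgeSet} {t : Set.Iic (M.G.length e')}
    (he : M.G.length e = ∞) (h : M.edge e' t = M.edge e ⊤) :
    (⟨e', t⟩ : Σ e, Set.Iic (M.G.length e)) = ⟨e, ⊤⟩ := by
  have hval := M.valence_edge_top e he
  set v := M.edge e ⊤ with hv
  have hinc : M.G.graph.Inc e v := (M.isLink e).inc_right
  have hinc' : M.G.graph.Inc e' v := by
    by_cases h0 : t = ⊥
    · subst h0; rw [← h]; exact (M.isLink e').inc_left
    by_cases h1 : t = ⊤
    · subst h1; rw [← h]; exact (M.isLink e').inc_right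
    · exact absurd (h ▸ M.edge_top_mem e) (M.interior_notMem e' t h0 h1)
  have hf1 : {e | M.G.graph.Inc e v}.Finite :=
    M.G.finite_edgeSet.subset fun e he => he.edge_mem
  have hf2 : {e | M.G.graph.IsLoopAt e v}.Finite :=
    M.G.finite_edgeSet.subset fun e he => he.edge_mem
  unfold Graph.valence at hval
  have h1 : 0 < {e | M.G.graph.Inc e v}.ncard := (Set.ncard_pos hf1).2 ⟨_, hinc⟩
  have hee : e' = e :=
    Subtype.ext ((Set.ncard_le_one hf1).1 (by omega) _ hinc' _ hinc)
  subst hee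
  have hloop : {e | M.G.graph.IsLoopAt e v} = ∅ := (Set.ncard_eq_zero hf2).1 (by omega)
  have h2 : t = ⊤ := by
    by_contra h1
    by_cases h0 : t = ⊥
    · subst h0
      have hl := M.isLink e'
      rw [h] at hl
      have : (e' : M.E) ∈ {e | M.G.graph.IsLoopAt e v} := hl
      rw [hloop] at this
      exact this
    · exact M.interior_notMem e' t h0 h1 (h ▸ M.edge_top_mem e')
  rw [h2]

theorem edge_eq_of_ne_bot {e e' : M.G.graph.edgeSet} {t : Set.Iic (M.G.length e')}
    {s : Set.Iic (M.G.length e)} (he : M.G.length e = ∞) (hs : s ≠ ⊥)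
    (h : M.edge e' t = M.edge e s) : (⟨e', t⟩ : Σ e, Set.Iic (M.G.length e)) = ⟨e, s⟩ := by
  by_cases hs' : s = ⊤
  · subst hs'; exact M.edge_eq_top he h
  · refine M.interior_injective e' t e s ?_ ?_ hs hs' h
    · rintro rfl; exact M.interior_notMem e s hs hs' (h ▸ M.edge_bot_mem e')
    · rintro rfl; exact M.interior_notMem e s hs hs' (h ▸ M.edge_top_mem e')

theorem bot_ne_top (e : M.G.graph.edgeSet) : (⊥ : Set.Iic (M.G.length e)) ≠ ⊤ := by
  intro h
  have : (0 : ℝ≥0∞) = M.G.length e := congrArg Subtype.val h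
  exact (M.G.length_pos e).ne this

theorem nhds_edge_top_le {e : M.G.graph.edgeSet} (he : M.G.length e = ∞) :
    𝓝 (M.edge e ⊤) ≤ map (M.edge e) (𝓝 ⊤) := by
  intro S hS
  rw [mem_map, mem_nhds_iff] at hS
  obtain ⟨O, hOS, hO, htop⟩ := hS
  have hO' : IsOpen (O \ {⊥}) := hO.sdiff isClosed_singleton
  have hopen : IsOpen (M.edge e '' (O \ {⊥})) := by
    rw [M.isOpen_iff]
    intro e'
    by_cases hee : e' = e
    · subst hee
      convert hO'
      ext t
      constructor
      · rintro ⟨s, hs, hst⟩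
        have := M.edge_eq_of_ne_bot he hs.2 hst.symm
        simp only [Sigma.mk.injEq, heq_eq_eq, true_and] at this
        rwa [this]
      · exact fun ht => ⟨t, ht, rfl⟩
    · convert isOpen_empty
      ext t
      simp only [mem_preimage, mem_image, mem_empty_iff_false, iff_false]
      rintro ⟨s, hs, hst⟩
      exact hee (congrArg Sigma.fst (M.edge_eq_of_ne_bot he hs.2 hst.symm))
  refine mem_nhds_iff.2 ⟨_, ?_, hopen, ⟨⊤, ⟨htop, (M.bot_ne_top e).symm⟩, rfl⟩⟩
  rintro _ ⟨t, ht, rfl⟩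
  exact hOS ht.1

theorem pathLength_eq_top {x y : X} {L : ℝ≥0∞} (h : M.PathLength x y L) (hxy : y ≠ x)
    {e : M.G.graph.edgeSet} (he : M.G.length e = ∞) (hx : M.edge e ⊤ = x) : L = ∞ := by
  induction h with
  | refl x => exact absurd rfl hxy
  | step e' s t h ih =>
    have hs := M.edge_eq_top he hx.symm
    obtain rfl : e' = e := congrArg Sigma.fst hs
    simp only [Sigma.mk.injEq, heq_eq_eq, true_and] at hs
    subst hs
    by_cases ht : t = ⊤
    · subst ht
      rw [ih hxy rfl, add_top]
    · have hst : edist (((⊤ : Set.Iic (M.G.length e')) : ℝ≥0∞)) (t : ℝ≥0∞) = ∞ := by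
        rw [ENNReal.edist_eq_top_iff]
        exact ⟨fun h => ht (Subtype.ext h.symm), Or.inl he⟩
      rw [hst, top_add]

end GraphPresentation

namespace TropicalModel

variable {X : Type*} [TopologicalSpace X] [EDist X] (M : TropicalModel X)

theorem edist_edge_top {e : M.G.graph.edgeSet} (he : M.G.length e = ∞) {y : X}
    (hy : y ≠ M.edge e ⊤) : edist (M.edge e ⊤) y = ∞ := by
  rw [M.edist_eq]
  exact sInf_eq_top.2 fun L hL => M.pathLength_eq_top hL hy he rfl

theorem exists_interior (e : M.G.graph.edgeSet) (t : Set.Iic (M.G.length e)) :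
    ∃ s : Set.Iic (M.G.length e), (s : ℝ≥0∞) ≠ ∞ ∧ M.edge e s ≠ M.edge e t := by
  obtain ⟨a, ha0, ha⟩ := exists_between (M.G.length_pos e)
  obtain ⟨b, hab, hb⟩ := exists_between ha
  have key : ∀ s : Set.Iic (M.G.length e), 0 < (s : ℝ≥0∞) → (s : ℝ≥0∞) < M.G.length e →
      s ≠ t → (s : ℝ≥0∞) ≠ ∞ ∧ M.edge e s ≠ M.edge e t := by
    intro s hs0 hs1 hst
    have h0 : s ≠ ⊥ := by rintro rfl; exact hs0.ne' rfl
    have h1 : s ≠ ⊤ := by rintro rfl; exact hs1.ne rfl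
    refine ⟨(hs1.trans_le le_top).ne, fun h => ?_⟩
    by_cases ht0 : t = ⊥
    · subst ht0; exact M.interior_notMem e s h0 h1 (h ▸ M.edge_bot_mem e)
    by_cases ht1 : t = ⊤
    · subst ht1; exact M.interior_notMem e s h0 h1 (h ▸ M.edge_top_mem e)
    have := M.interior_injective e s e t h0 h1 ht0 ht1 h
    simp only [Sigma.mk.injEq, heq_eq_eq, true_and] at this
    exact hst this
  by_cases h : (⟨a, ha.le⟩ : Set.Iic (M.G.length e)) = t
  · refine ⟨⟨b, hb.le⟩, key _ (ha0.trans hab) hb fun h' => ?_⟩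
    exact hab.ne (congrArg Subtype.val (h.trans h'.symm))
  · exact ⟨⟨a, ha.le⟩, key _ ha0 ha h⟩

theorem coe_eq_top_of_mem {e : M.G.graph.edgeSet} {t : Set.Iic (M.G.length e)}
    (h : M.edge e t ∈ pointsAtInfinity X) : (t : ℝ≥0∞) = ∞ := by
  obtain ⟨M', e', he', hx⟩ := h
  by_contra ht
  obtain ⟨s, hs, hst⟩ := M.exists_interior e t
  have h1 := M'.edist_edge_top he' (hx ▸ hst)
  rw [hx, M.edist_eq] at h1
  have h2 : M.dist (M.edge e t) (M.edge e s) ≤ edist (t : ℝ≥0∞) (s : ℝ≥0∞) + 0 :=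
    sInf_le (GraphPresentation.PathLength.step e t s (.refl _))
  erw [h1, add_zero, top_le_iff, ENNReal.edist_eq_top_iff] at h2
  exact h2.2.elim ht hs

theorem eq_top_of_mem {e : M.G.graph.edgeSet} {t : Set.Iic (M.G.length e)}
    (h : M.edge e t ∈ pointsAtInfinity X) : M.G.length e = ∞ ∧ t = ⊤ := by
  have h1 := M.coe_eq_top_of_mem h
  have h2 : M.G.length e = ∞ := top_le_iff.1 (h1 ▸ t.2)
  exact ⟨h2, Subtype.ext (h1.trans h2.symm)⟩

theorem exists_edge_of_ne {x y : X} (hxy : x ≠ y) : ∃ e t, M.edge e t = x := by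
  by_cases hx : x ∈ M.G.graph.vertexSet
  · have key : ∀ z ∈ M.G.graph.vertexSet, x ≠ z → ∃ e t, M.edge e t = x := by
      intro z hz hxz
      rcases (M.G.connected x hx z hz).cases_head with h | ⟨w, ⟨e, he⟩, -⟩
      · exact absurd h hxz
      · have hl := M.isLink ⟨e, he.edge_mem⟩
        rcases he.left_eq_or_eq hl with h | h
        · exact ⟨_, _, h.symm⟩
        · exact ⟨_, _, h.symm⟩
    by_cases hy : y ∈ M.G.graph.vertexSet
    · exact key y hy hxy
    · obtain ⟨e, t, -, -, -⟩ := M.exists_of_notMem y hy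
      by_cases h : x = M.edge e ⊥
      · exact ⟨e, ⊥, h.symm⟩
      · exact key _ (M.edge_bot_mem e) h
  · obtain ⟨e, t, -, -, h⟩ := M.exists_of_notMem x hx
    exact ⟨e, t, h⟩

theorem exists_edge_top {x : X} (hx : x ∈ pointsAtInfinity X) :
    ∃ e, M.G.length e = ∞ ∧ M.edge e ⊤ = x := by
  obtain ⟨M', e', he', rfl⟩ := id hx
  obtain ⟨s, -, hs⟩ := M'.exists_interior e' ⊤
  obtain ⟨e, t, ht⟩ := M.exists_edge_of_ne hs.symm
  obtain ⟨h1, rfl⟩ := M.eq_top_of_mem (ht.symm ▸ hx)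
  exact ⟨e, h1, ht⟩

theorem edge_notMem {e : M.G.graph.edgeSet} {t : Set.Iic (M.G.length e)}
    (ht : (t : ℝ≥0∞) ≠ ∞) : M.edge e t ∉ pointsAtInfinity X :=
  fun h => ht (M.coe_eq_top_of_mem h)

end TropicalModel

theorem dense_compl_pointsAtInfinity (X : Type*) [TopologicalSpace X] [EDist X] :
    Dense (pointsAtInfinity X)ᶜ := by
  intro x
  by_cases hx : x ∈ pointsAtInfinity X
  · obtain ⟨M, e, he, rfl⟩ := hx
    let u : ℕ → Set.Iic (M.G.length e) := fun n => ⟨n, mem_Iic.2 (he ▸ le_top)⟩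
    have hu : Tendsto u atTop (𝓝 ⊤) := by
      rw [tendsto_subtype_rng]
      change Tendsto (fun n : ℕ => (n : ℝ≥0∞)) atTop (𝓝 (M.G.length e))
      rw [he]
      exact ENNReal.tendsto_nat_nhds_top
    refine mem_closure_of_tendsto (((M.continuous_edge e).tendsto ⊤).comp hu) ?_
    exact Eventually.of_forall fun n => M.edge_notMem (ENNReal.natCast_ne_top n)
  · exact subset_closure hx

/-! ### Rational functions -/

/-- A function on `[0, L]` is piecewise affine with integer slopes and finitely many pieces: `[0, L]`
(without `∞`) is covered by finitely many intervals on each of which `u` is affine with an integer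
slope. (This is used for continuous `u` only, so `u ∞` needs no mention.) -/
def IsPiecewiseAffine {L : ℝ≥0∞} (u : Set.Iic L → EReal) : Prop :=
  ∃ (ι : Type) (_ : Finite ι) (I : ι → Set ℝ) (m : ι → ℤ) (c : ι → ℝ),
    (∀ i, (I i).OrdConnected) ∧
    (∀ t : Set.Iic L, (t : ℝ≥0∞) ≠ ∞ → ∃ i, (t : ℝ≥0∞).toReal ∈ I i) ∧
    ∀ i, ∀ t : Set.Iic L, (t : ℝ≥0∞) ≠ ∞ → (t : ℝ≥0∞).toReal ∈ I i →
      u t = ((m i * (t : ℝ≥0∞).toReal + c i : ℝ) : EReal)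

namespace IsPiecewiseAffine

variable {L : ℝ≥0∞} {u v w : Set.Iic L → EReal}

theorem const (a : ℝ) (h : ∀ t : Set.Iic L, (t : ℝ≥0∞) ≠ ∞ → w t = a) : IsPiecewiseAffine w :=
  ⟨Unit, inferInstance, fun _ => univ, fun _ => 0, fun _ => a, fun _ => ordConnected_univ,
    fun _ _ => ⟨(), mem_univ _⟩, fun _ t ht _ => by simp [h t ht]⟩

theorem add (hu : IsPiecewiseAffine u) (hv : IsPiecewiseAffine v)
    (h : ∀ t : Set.Iic L, (t : ℝ≥0∞) ≠ ∞ → w t = u t + v t) : IsPiecewiseAffine w := by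
  obtain ⟨ι, _, I, m, c, h1, h2, h3⟩ := hu
  obtain ⟨κ, _, J, n, d, k1, k2, k3⟩ := hv
  refine ⟨ι × κ, inferInstance, fun p => I p.1 ∩ J p.2, fun p => m p.1 + n p.2,
    fun p => c p.1 + d p.2, fun p => (h1 _).inter (k1 _), fun t ht => ?_, fun p t ht hp => ?_⟩
  · obtain ⟨i, hi⟩ := h2 t ht
    obtain ⟨j, hj⟩ := k2 t ht
    exact ⟨(i, j), hi, hj⟩
  · rw [h t ht, h3 _ t ht hp.1, k3 _ t ht hp.2, ← EReal.coe_add]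
    congr 1
    push_cast
    ring

theorem ordConnected_halfLine (a b : ℝ) : {x : ℝ | a * x + b ≤ 0}.OrdConnected := by
  have h : Convex ℝ {x : ℝ | a * x ≤ -b} :=
    convex_halfSpace_le (f := fun x : ℝ => a * x) (IsLinearMap.mk (mul_add a)
      (fun c x => by simp only [smul_eq_mul]; ring)) (-b)
  have e : {x : ℝ | a * x + b ≤ 0} = {x : ℝ | a * x ≤ -b} := by
    ext x
    simp only [mem_ofPred_eq]
    constructor <;> intro h <;> linarith
  rw [e]
  exact h.ordConnected

theorem max (hu : IsPiecewiseAffine u) (hv : IsPiecewiseAffine v)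
    (h : ∀ t : Set.Iic L, (t : ℝ≥0∞) ≠ ∞ → w t = Max.max (u t) (v t)) :
    IsPiecewiseAffine w := by
  obtain ⟨ι, _, I, m, c, h1, h2, h3⟩ := hu
  obtain ⟨κ, _, J, n, d, k1, k2, k3⟩ := hv
  let H : ι × κ → Bool → Set ℝ := fun p b =>
    if b then {x | ((m p.1 - n p.2 : ℝ)) * x + (c p.1 - d p.2) ≤ 0}
    else {x | ((n p.2 - m p.1 : ℝ)) * x + (d p.2 - c p.1) ≤ 0}
  refine ⟨(ι × κ) × Bool, inferInstance, fun q => I q.1.1 ∩ J q.1.2 ∩ H q.1 q.2,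
    fun q => if q.2 then n q.1.2 else m q.1.1, fun q => if q.2 then d q.1.2 else c q.1.1,
    ?_, fun t ht => ?_, ?_⟩
  · rintro ⟨p, b⟩
    refine ((h1 _).inter (k1 _)).inter ?_
    cases b <;> exact ordConnected_halfLine _ _
  · obtain ⟨i, hi⟩ := h2 t ht
    obtain ⟨j, hj⟩ := k2 t ht
    rcases le_total ((m i - n j : ℝ) * (t : ℝ≥0∞).toReal + (c i - d j)) 0 with h | h
    · exact ⟨((i, j), true), ⟨hi, hj⟩, by simpa [H] using h⟩
    · refine ⟨((i, j), false), ⟨hi, hj⟩, ?_⟩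
      simp only [H, Bool.false_eq_true, if_false, mem_ofPred_eq]
      linarith
  · rintro ⟨p, b⟩ t ht ⟨⟨hp, hq⟩, hb⟩
    rw [h t ht, h3 _ t ht hp, k3 _ t ht hq]
    cases b
    · simp only [H, Bool.false_eq_true, if_false, mem_ofPred_eq] at hb ⊢
      exact max_eq_left (EReal.coe_le_coe_iff.2 (by linarith))
    · simp only [H, if_true, mem_ofPred_eq] at hb ⊢
      exact max_eq_right (EReal.coe_le_coe_iff.2 (by linarith))

/-- A piecewise affine function with finitely many pieces has a limit at `∞`. -/
theorem exists_tendsto (hu : IsPiecewiseAffine u) (hL : L = ∞) :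
    ∃ y, Tendsto u (𝓝[≠] ⊤) (𝓝 y) := by
  subst hL
  obtain ⟨ι, _, I, m, c, h1, h2, h3⟩ := hu
  obtain ⟨i, hi⟩ : ∃ i, ¬ BddAbove (I i) := by
    by_contra! hb
    choose b hb using hb
    obtain ⟨B, hB⟩ := (finite_range b).bddAbove
    obtain ⟨i, hi⟩ := h2 ⟨ENNReal.ofReal (|B| + 1), mem_Iic.2 le_top⟩ ENNReal.ofReal_ne_top
    have h0 := (hb i hi).trans (hB (mem_range_self i))
    simp only at h0
    rw [ENNReal.toReal_ofReal (by positivity)] at h0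
    linarith [le_abs_self B]
  obtain ⟨a, ha⟩ : (I i).Nonempty := by
    rw [nonempty_iff_ne_empty]
    intro h
    exact hi (h ▸ bddAbove_empty)
  have hIi : Ici a ⊆ I i := by
    intro x hx
    obtain ⟨b, hb, hxb⟩ := not_bddAbove_iff.1 hi x
    exact (h1 i).out ha hb ⟨hx, hxb.le⟩
  have hreal : Tendsto (fun t : Set.Iic (∞ : ℝ≥0∞) => (t : ℝ≥0∞).toReal) (𝓝[≠] ⊤) atTop := by
    rw [tendsto_atTop]
    intro b
    have hopen : ∀ᶠ t : Set.Iic (∞ : ℝ≥0∞) in 𝓝 ⊤, ENNReal.ofReal b < (t : ℝ≥0∞) :=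
      continuous_subtype_val.continuousAt.eventually (lt_mem_nhds ENNReal.ofReal_lt_top)
    filter_upwards [mem_nhdsWithin_of_mem_nhds hopen, self_mem_nhdsWithin] with t ht ht'
    have h4 : (t : ℝ≥0∞) ≠ ∞ := fun h => ht' (Subtype.ext h)
    exact (ENNReal.ofReal_le_iff_le_toReal h4).1 ht.le
  have hev : (fun t : Set.Iic (∞ : ℝ≥0∞) =>
      ((m i * (t : ℝ≥0∞).toReal + c i : ℝ) : EReal)) =ᶠ[𝓝[≠] ⊤] u := by
    filter_upwards [hreal.eventually_ge_atTop a, self_mem_nhdsWithin] with t ht ht'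
    have h4 : (t : ℝ≥0∞) ≠ ∞ := fun h => ht' (Subtype.ext h)
    exact (h3 i t h4 (hIi ht)).symm
  suffices h : ∃ y, Tendsto (fun x : ℝ => ((m i * x + c i : ℝ) : EReal)) atTop (𝓝 y) by
    obtain ⟨y, hy⟩ := h
    exact ⟨y, (hy.comp hreal).congr' hev⟩
  rcases lt_trichotomy (m i : ℝ) 0 with h | h | h
  · exact ⟨⊥, EReal.tendsto_coe_atBot.comp
      (tendsto_atBot_add_const_right _ _ (tendsto_id.const_mul_atTop_of_neg h))⟩
  · exact ⟨(c i : ℝ), by simp [h]⟩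
  · exact ⟨⊤, EReal.tendsto_coe_atTop.comp
      (tendsto_atTop_add_const_right _ _ (tendsto_id.const_mul_atTop h))⟩

end IsPiecewiseAffine

/-- A rational function on `X` is the constant function `-∞` or a continuous function to
`ℝ ∪ {±∞}` that takes the values `±∞` at points at infinity only and is piecewise affine with
integer slopes and finitely many pieces. (The last condition does not depend on the model.) -/
def IsRationalFunction {X : Type*} [TopologicalSpace X] [EDist X] (f : X → EReal) : Prop :=
  (f = fun _ => ⊥) ∨
    (Continuous f ∧ (∀ x ∉ pointsAtInfinity X, f x ≠ ⊥ ∧ f x ≠ ⊤) ∧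
      ∀ (M : TropicalModel X) (e : M.G.graph.edgeSet), IsPiecewiseAffine (f ∘ M.edge e))

namespace IsRationalFunction

variable {X : Type*} [TopologicalSpace X] [EDist X] {f g : X → EReal}

theorem continuous (hf : IsRationalFunction f) : Continuous f := by
  rcases hf with rfl | hf
  · exact continuous_const
  · exact hf.1

theorem const (a : TropicalSemifield) : IsRationalFunction fun _ : X => a.toEReal := by
  rcases a.eq_zero_or_coe with rfl | ⟨r, rfl⟩
  · exact Or.inl rfl
  · refine Or.inr ⟨continuous_const, fun x _ => ⟨EReal.coe_ne_bot r, EReal.coe_ne_top r⟩,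
      fun M e => .const r fun t _ => rfl⟩

theorem max (hf : IsRationalFunction f) (hg : IsRationalFunction g) :
    IsRationalFunction fun x => Max.max (f x) (g x) := by
  rcases id hf with rfl | ⟨f1, f2, f3⟩
  · simpa using hg
  rcases id hg with rfl | ⟨g1, g2, g3⟩
  · simpa using hf
  refine Or.inr ⟨f1.max g1, fun x hx => ?_, fun M e => (f3 M e).max (g3 M e) fun t _ => rfl⟩
  change Max.max (f x) (g x) ≠ ⊥ ∧ Max.max (f x) (g x) ≠ ⊤
  rcases max_choice (f x) (g x) with h | h <;> rw [h]
  · exact f2 x hx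
  · exact g2 x hx

/-- The sum of two rational functions, considered away from the points at infinity, has a limit at
every point. -/
theorem exists_tendsto_add (hf : IsRationalFunction f) (hg : IsRationalFunction g) (x : X) :
    ∃ y, Tendsto (fun x => f x + g x) (𝓝[(pointsAtInfinity X)ᶜ] x) (𝓝 y) := by
  rcases hf with rfl | ⟨f1, f2, f3⟩
  · exact ⟨⊥, by simp [tendsto_const_nhds]⟩
  rcases hg with rfl | ⟨g1, g2, g3⟩
  · exact ⟨⊥, by simp [tendsto_const_nhds]⟩
  by_cases hx : x ∈ pointsAtInfinity X
  · obtain ⟨M, e, he, rfl⟩ := id hx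
    have hpa : IsPiecewiseAffine ((fun x => f x + g x) ∘ M.edge e) :=
      (f3 M e).add (g3 M e) fun t _ => rfl
    obtain ⟨y, hy⟩ := hpa.exists_tendsto he
    refine ⟨y, Tendsto.mono_left (tendsto_map'_iff.2 hy) ?_⟩
    calc 𝓝[(pointsAtInfinity X)ᶜ] (M.edge e ⊤)
        ≤ map (M.edge e) (𝓝 ⊤) ⊓ 𝓟 (pointsAtInfinity X)ᶜ :=
          inf_le_inf_right _ (M.nhds_edge_top_le he)
      _ = map (M.edge e) (𝓝 ⊤ ⊓ 𝓟 (M.edge e ⁻¹' (pointsAtInfinity X)ᶜ)) :=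
          (map_inf_principal_preimage).symm
      _ ≤ map (M.edge e) (𝓝[≠] ⊤) := by
          refine map_mono (inf_le_inf_left _ (principal_mono.2 ?_))
          rintro t ht rfl
          exact ht hx
  · refine ⟨f x + g x, Tendsto.mono_left ?_ nhdsWithin_le_nhds⟩
    have h := EReal.continuousAt_add (p := (f x, g x)) (Or.inl (f2 x hx).2) (Or.inl (f2 x hx).1)
    exact h.tendsto.comp (f1.continuousAt.prodMk_nhds g1.continuousAt)

theorem continuous_mul (hf : IsRationalFunction f) (hg : IsRationalFunction g) :
    Continuous (extendFrom (pointsAtInfinity X)ᶜ fun x => f x + g x) :=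
  continuous_extendFrom (dense_compl_pointsAtInfinity X) (exists_tendsto_add hf hg)

theorem mul_apply (hf : IsRationalFunction f) (hg : IsRationalFunction g) {x : X}
    (hx : x ∉ pointsAtInfinity X) :
    extendFrom (pointsAtInfinity X)ᶜ (fun x => f x + g x) x = f x + g x := by
  refine extendFrom_extends (fun x hx => ?_) x hx
  obtain ⟨y, hy⟩ := exists_tendsto_add hf hg x
  have h := tendsto_pure_left.1 (hy.mono_left (pure_le_nhdsWithin hx))
  have : y = f x + g x := by
    by_contra hne
    exact h _ (isOpen_compl_singleton.mem_nhds hne) rfl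
  rw [this] at hy
  exact hy

theorem mul (hf : IsRationalFunction f) (hg : IsRationalFunction g) :
    IsRationalFunction (extendFrom (pointsAtInfinity X)ᶜ fun x => f x + g x) := by
  have hbot : ∀ h : X → EReal, Continuous h → (∀ x ∉ pointsAtInfinity X, h x = ⊥) →
      IsRationalFunction h := fun h h1 h2 => Or.inl <|
    h1.ext_on (dense_compl_pointsAtInfinity X) continuous_const fun x hx => h2 x hx
  have hc := continuous_mul hf hg
  rcases id hf with rfl | ⟨f1, f2, f3⟩
  · exact hbot _ hc fun x hx => by rw [mul_apply hf hg hx, EReal.bot_add]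
  rcases id hg with rfl | ⟨g1, g2, g3⟩
  · exact hbot _ hc fun x hx => by rw [mul_apply hf hg hx, EReal.add_bot]
  refine Or.inr ⟨hc, fun x hx => ?_, fun M e => ?_⟩
  · rw [mul_apply hf hg hx]
    refine ⟨?_, EReal.add_ne_top (f2 x hx).2 (g2 x hx).2⟩
    rw [Ne, EReal.add_eq_bot_iff, not_or]
    exact ⟨(f2 x hx).1, (g2 x hx).1⟩
  · exact (f3 M e).add (g3 M e) fun t ht => mul_apply hf hg (M.edge_notMem ht)

end IsRationalFunction

/-- `Rat(Γ)`, the set of all rational functions on `Γ`. -/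
structure RatFun (X : Type*) [TopologicalSpace X] [EDist X] where
  /-- the function -/
  toFun : X → EReal
  isRational : IsRationalFunction toFun

namespace RatFun

variable {X : Type*} [TopologicalSpace X] [EDist X]

instance : CoeFun (RatFun X) fun _ => X → EReal := ⟨toFun⟩

/-- Rational functions that agree at all finite points are equal. -/
theorem ext_finite {f g : RatFun X} (h : ∀ x ∉ pointsAtInfinity X, f x = g x) : f = g := by
  obtain ⟨f, hf⟩ := f
  obtain ⟨g, hg⟩ := g
  obtain rfl : f = g :=
    hf.continuous.ext_on (dense_compl_pointsAtInfinity X) hg.continuous fun x hx => h x hx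
  rfl

/-- The inclusion of the tropical semifield as constant functions. -/
noncomputable def const (X : Type*) [TopologicalSpace X] [EDist X] (a : TropicalSemifield) :
    RatFun X := ⟨fun _ => a.toEReal, .const a⟩

/-- `f ⊕ g`, the pointwise maximum (which is continuous on the whole of `X`). -/
noncomputable instance : Add (RatFun X) :=
  ⟨fun f g => ⟨fun x => max (f x) (g x), f.isRational.max g.isRational⟩⟩

/-- `f ⊙ g`, the pointwise sum at finite points, extended to the points at infinity by
continuity. -/
noncomputable instance : Mul (RatFun X) :=
  ⟨fun f g => ⟨extendFrom (pointsAtInfinity X)ᶜ fun x => f x + g x, f.isRational.mul g.isRational⟩⟩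

noncomputable instance : Zero (RatFun X) := ⟨const X 0⟩

noncomputable instance : One (RatFun X) := ⟨const X 1⟩

theorem add_apply (f g : RatFun X) (x : X) : (f + g) x = max (f x) (g x) := rfl

theorem mul_apply (f g : RatFun X) {x : X} (hx : x ∉ pointsAtInfinity X) :
    (f * g) x = f x + g x :=
  IsRationalFunction.mul_apply f.isRational g.isRational hx

theorem const_apply (a : TropicalSemifield) (x : X) : const X a x = a.toEReal := rfl

theorem zero_apply (x : X) : (0 : RatFun X) x = ⊥ := rfl

theorem one_apply (x : X) : (1 : RatFun X) x = 0 := rfl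

theorem add_max (a b c : EReal) : a + max b c = max (a + b) (a + c) :=
  (monotone_const.add monotone_id : Monotone fun x : EReal => a + x).map_max

/-- `Rat(Γ)` is a semiring with `⊕` and `⊙`. -/
noncomputable instance : CommSemiring (RatFun X) where
  add_assoc f g h := ext_finite fun x hx => by simp only [add_apply, max_assoc]
  zero_add f := ext_finite fun x hx => by simp [add_apply, zero_apply]
  add_zero f := ext_finite fun x hx => by simp [add_apply, zero_apply]
  add_comm f g := ext_finite fun x hx => by simp only [add_apply, max_comm]
  left_distrib f g h := ext_finite fun x hx => by
    simp only [add_apply, mul_apply _ _ hx, add_max]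
  right_distrib f g h := ext_finite fun x hx => by
    simp only [add_apply, mul_apply _ _ hx]
    rw [add_comm, add_max, add_comm (h x), add_comm (h x)]
  zero_mul f := ext_finite fun x hx => by simp [mul_apply _ _ hx, zero_apply]
  mul_zero f := ext_finite fun x hx => by simp [mul_apply _ _ hx, zero_apply]
  mul_assoc f g h := ext_finite fun x hx => by simp only [mul_apply _ _ hx, add_assoc]
  one_mul f := ext_finite fun x hx => by simp [mul_apply _ _ hx, one_apply]
  mul_one f := ext_finite fun x hx => by simp [mul_apply _ _ hx, one_apply]
  mul_comm f g := ext_finite fun x hx => by simp only [mul_apply _ _ hx, add_comm]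
  nsmul := nsmulRec

/-- The inclusion of the tropical semifield is a semiring homomorphism. -/
noncomputable def constHom (X : Type*) [TopologicalSpace X] [EDist X] :
    TropicalSemifield →+* RatFun X where
  toFun := const X
  map_zero' := rfl
  map_one' := rfl
  map_add' a b := ext_finite fun x _ => TropicalSemifield.toEReal_add a b
  map_mul' a b := ext_finite fun x hx => by
    rw [mul_apply _ _ hx]
    exact TropicalSemifield.toEReal_mul a b

/-- `Rat(Γ)` is an algebra over the tropical semifield. -/
noncomputable instance : Algebra TropicalSemifield (RatFun X) := (constHom X).toAlgebra

end RatFun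

/-- The subgroup of the group of semiring automorphisms of a `T`-algebra `S` that consists of the
`T`-algebra automorphisms. -/
def algebraAutSubgroup (T S : Type*) [CommSemiring T] [CommSemiring S] [Algebra T S] :
    Subgroup (RingAut S) where
  carrier := {ψ | ∃ φ : S ≃ₐ[T] S, φ.toRingEquiv = ψ}
  one_mem' := ⟨AlgEquiv.refl, rfl⟩
  mul_mem' := by
    rintro _ _ ⟨φ, rfl⟩ ⟨φ', rfl⟩
    exact ⟨φ'.trans φ, rfl⟩
  inv_mem' := by
    rintro _ ⟨φ, rfl⟩
    exact ⟨φ.symm, rfl⟩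

/-! The semiring alone recognises the constants. Slopes are integers, so a rational function other
than `-∞` that has an `n`-th root for every `n ≥ 1` has slope zero everywhere. A semiring
automorphism `ψ` therefore maps real constants to real constants. On them it is additive and
monotone, hence multiplication by some `r > 0` (`exists_scale`), and it is `T`-linear exactly when
`r = 1`.

Up to the factor `r`, such a `ψ` is composition with a bijection `φ` of the finite points: a
compactness argument shows that evaluating `ψ f` at `x` is `r` times evaluating `f` at some finite
point (`exists_point`). The function `dist x` pulled back along `φ⁻¹` and divided by `r` is again
rational, vanishes only at `φ x`, and so leaves `φ x` with integer slopes that are at least one.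
This bounds distances locally. Integration along edges makes the bound global, and the inverse of
`ψ` gives the opposite bound, so `φ` is a homothety with factor `r⁻¹` (`mul_dist_eq`).

If `r ≠ 1`, then `φ` or its inverse expands all distances by a factor `k > 1` and has a fixed point
`p` by Banach's theorem. Far from `p` the curve consists of the finitely many unbounded edges. A
high power of the homothety moves any configuration of points other than `p` out there, so the whole
curve is a union of rays from `p` (`exists_rays_of_expanding`). With the points at infinity added,
these rays are the edges of a model (`exists_star_model`).

Conversely, a connected graph all of whose edges are infinite is a star, since every edge ends in a
leaf at infinity. Its dilation `h` with factor `k` yields the automorphism `f ↦ k f ∘ h⁻¹`: the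
factor in front restores the integrality of the slopes, and the constant `1` goes to `k`. -/

/-! ### The distance on `[0, ∞]` -/

namespace ENNReal

theorem edist_self' (a : ℝ≥0∞) : edist a a = 0 := WeakPseudoEMetricSpace.edist_self a

theorem edist_comm' (a b : ℝ≥0∞) : edist a b = edist b a := WeakPseudoEMetricSpace.edist_comm a b

theorem edist_triangle' (a b c : ℝ≥0∞) : edist a c ≤ edist a b + edist b c :=
  WeakPseudoEMetricSpace.edist_triangle a b c

/-- Subtraction is truncated and `∞ - ∞ = 0`, so at least one summand vanishes and the formula also
covers infinite values. It reduces positivity and scaling of distances to facts about subtraction.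
-/
theorem edist_eq_sub_add_sub (a b : ℝ≥0∞) : edist a b = (a - b) + (b - a) := by
  by_cases h : a = b
  · subst h; simp [edist_self']
  by_cases h' : a = ∞ ∨ b = ∞
  · rw [(edist_eq_top_iff a b).2 ⟨h, h'⟩]
    rcases h' with rfl | rfl
    · rw [ENNReal.top_sub (fun h' => h h'.symm), top_add]
    · rw [ENNReal.top_sub h, add_top]
  · rw [not_or] at h'
    lift a to NNReal using h'.1
    lift b to NNReal using h'.2
    change edist a b = _
    rw [edist_nndist, ← coe_sub, ← coe_sub, ← coe_add, NNReal.nndist_eq]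
    rcases le_total a b with hab | hab <;> simp [tsub_eq_zero_of_le hab]

@[simp]
theorem edist_zero_right' (a : ℝ≥0∞) : edist a 0 = a := by simp [edist_eq_sub_add_sub]

end ENNReal

/-! ### Paths and the path distance -/

namespace GraphPresentation

variable {X : Type*} [TopologicalSpace X] (M : GraphPresentation X)

/-- Only one of the two parameters has to be interior: the ends of an edge are vertices, and
interior points are not. -/
theorem edge_eq_of_interior {e e' : M.G.graph.edgeSet} {t : Set.Iic (M.G.length e)}
    {s : Set.Iic (M.G.length e')} (h0 : t ≠ ⊥) (h1 : t ≠ ⊤) (h : M.edge e' s = M.edge e t) :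
    (⟨e', s⟩ : Σ e, Set.Iic (M.G.length e)) = ⟨e, t⟩ := by
  refine M.interior_injective e' s e t ?_ ?_ h0 h1 h
  · rintro rfl
    exact M.interior_notMem e t h0 h1 (h ▸ M.edge_bot_mem e')
  · rintro rfl
    exact M.interior_notMem e t h0 h1 (h ▸ M.edge_top_mem e')

/-- An interior point occurs once, and a vertex occurs only at the two ends. Finiteness makes minima
over the parameters of a point attained. -/
theorem finite_preimage (e : M.G.graph.edgeSet) (y : X) : {s | M.edge e s = y}.Finite := by
  by_cases h : ∃ t, t ≠ ⊥ ∧ t ≠ ⊤ ∧ M.edge e t = y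
  · obtain ⟨t, h0, h1, rfl⟩ := h
    refine (finite_singleton t).subset fun s hs => ?_
    have := M.edge_eq_of_interior h0 h1 hs
    simpa using this
  · push Not at h
    refine (Set.toFinite {⊥, ⊤}).subset fun s hs => ?_
    by_contra hn
    simp only [mem_insert_iff, mem_singleton_iff, not_or] at hn
    exact h s hn.1 hn.2 hs

instance finite_edges : Finite M.G.graph.edgeSet := M.G.finite_edgeSet

variable {M}

theorem PathLength.trans {x y z : X} {L L' : ℝ≥0∞} (h : M.PathLength x y L)
    (h' : M.PathLength y z L') : M.PathLength x z (L + L') := by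
  induction h with
  | refl x => simpa using h'
  | step e s t h ih =>
    rw [add_assoc]
    exact .step e s t (ih h')

theorem PathLength.single (e : M.G.graph.edgeSet) (s t : Set.Iic (M.G.length e)) :
    M.PathLength (M.edge e s) (M.edge e t) (edist (s : ℝ≥0∞) (t : ℝ≥0∞)) := by
  simpa using PathLength.step e s t (.refl _)

theorem PathLength.symm {x y : X} {L : ℝ≥0∞} (h : M.PathLength x y L) : M.PathLength y x L := by
  induction h with
  | refl x => exact .refl x
  | step e s t h ih =>
    rw [add_comm, ENNReal.edist_comm']
    exact ih.trans (.single e t s)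

variable (M)

theorem dist_le_of_pathLength {x y : X} {L : ℝ≥0∞} (h : M.PathLength x y L) : M.dist x y ≤ L :=
  sInf_le h

theorem dist_self (x : X) : M.dist x x = 0 :=
  le_antisymm (M.dist_le_of_pathLength (.refl x)) bot_le

theorem dist_comm (x y : X) : M.dist x y = M.dist y x :=
  le_antisymm (le_sInf fun _ h => sInf_le (PathLength.symm h))
    (le_sInf fun _ h => sInf_le (PathLength.symm h))

theorem dist_triangle (x y z : X) : M.dist x z ≤ M.dist x y + M.dist y z := by
  conv_rhs => rw [dist, dist, ENNReal.sInf_add]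
  refine le_iInf₂ fun L hL => ?_
  rw [ENNReal.add_sInf]
  exact le_iInf₂ fun L' hL' => sInf_le (hL.trans hL')

theorem dist_edge_le (e : M.G.graph.edgeSet) (s t : Set.Iic (M.G.length e)) :
    M.dist (M.edge e s) (M.edge e t) ≤ edist (s : ℝ≥0∞) (t : ℝ≥0∞) :=
  sInf_le (.single e s t)

/-- A path starting on an edge stays on this edge or leaves it through one of its ends. -/
theorem pathLength_exit {x y : X} {L : ℝ≥0∞} (h : M.PathLength x y L) :
    ∀ (e : M.G.graph.edgeSet) (t : Set.Iic (M.G.length e)), M.edge e t = x →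
      (∃ s : Set.Iic (M.G.length e), M.edge e s = y ∧ edist (t : ℝ≥0∞) (s : ℝ≥0∞) ≤ L) ∨
      (t : ℝ≥0∞) + M.dist (M.edge e ⊥) y ≤ L ∨
      edist (t : ℝ≥0∞) (M.G.length e) + M.dist (M.edge e ⊤) y ≤ L := by
  induction h with
  | refl x => exact fun e t ht => Or.inl ⟨t, ht, (ENNReal.edist_self' _).le⟩
  | @step e' s' t' y L h ih =>
    intro e t ht
    by_cases h0 : t = ⊥
    · subst h0
      refine Or.inr (Or.inl ?_)
      rw [ht]
      change (0 : ℝ≥0∞) + _ ≤ _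
      rw [zero_add]
      exact M.dist_le_of_pathLength (.step e' s' t' h)
    by_cases h1 : t = ⊤
    · subst h1
      refine Or.inr (Or.inr ?_)
      rw [ht]
      change edist (M.G.length e) (M.G.length e) + _ ≤ _
      rw [ENNReal.edist_self', zero_add]
      exact M.dist_le_of_pathLength (.step e' s' t' h)
    have := M.edge_eq_of_interior h0 h1 ht.symm
    obtain rfl : e' = e := congrArg Sigma.fst this
    simp only [Sigma.mk.injEq, heq_eq_eq, true_and] at this
    subst this
    rcases ih e' t' rfl with ⟨s, hs, hL⟩ | hL | hL
    · exact Or.inl ⟨s, hs, (ENNReal.edist_triangle' _ (t' : ℝ≥0∞) _).trans (by gcongr)⟩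
    · refine Or.inr (Or.inl ?_)
      refine le_trans ?_ (add_le_add_right hL _)
      rw [← add_assoc]
      gcongr
      have := ENNReal.edist_triangle' (s' : ℝ≥0∞) (t' : ℝ≥0∞) 0
      simpa using this
    · refine Or.inr (Or.inr ?_)
      refine le_trans ?_ (add_le_add_right hL _)
      rw [← add_assoc]
      gcongr
      exact ENNReal.edist_triangle' _ _ _

/-- The alternatives of `pathLength_exit` may vary with the path. Once a nearest parameter of `y` is
fixed, each path is at least as long as one of three fixed numbers, so the infimum is at least the
smallest of them. -/
theorem dist_exit (e : M.G.graph.edgeSet) (t : Set.Iic (M.G.length e)) (y : X) :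
    (∃ s : Set.Iic (M.G.length e), M.edge e s = y ∧
        edist (t : ℝ≥0∞) (s : ℝ≥0∞) ≤ M.dist (M.edge e t) y) ∨
      (t : ℝ≥0∞) + M.dist (M.edge e ⊥) y ≤ M.dist (M.edge e t) y ∨
      edist (t : ℝ≥0∞) (M.G.length e) + M.dist (M.edge e ⊤) y ≤ M.dist (M.edge e t) y := by
  have key : (∃ s : Set.Iic (M.G.length e), M.edge e s = y ∧ ∀ L, M.PathLength (M.edge e t) y L →
        edist (t : ℝ≥0∞) (s : ℝ≥0∞) ≤ L ∨
      (t : ℝ≥0∞) + M.dist (M.edge e ⊥) y ≤ L ∨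
      edist (t : ℝ≥0∞) (M.G.length e) + M.dist (M.edge e ⊤) y ≤ L) ∨
      ∀ L, M.PathLength (M.edge e t) y L → (t : ℝ≥0∞) + M.dist (M.edge e ⊥) y ≤ L ∨
      edist (t : ℝ≥0∞) (M.G.length e) + M.dist (M.edge e ⊤) y ≤ L := by
    by_cases h : ∃ s, M.edge e s = y
    · obtain ⟨s, hs, hmin⟩ := exists_min_image {s | M.edge e s = y}
        (fun s => edist (t : ℝ≥0∞) (s : ℝ≥0∞)) (M.finite_preimage e y) h
      refine Or.inl ⟨s, hs, fun L hL => ?_⟩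
      rcases M.pathLength_exit hL e t rfl with ⟨s', hs', h⟩ | h
      · exact Or.inl ((hmin s' hs').trans h)
      · exact Or.inr h
    · refine Or.inr fun L hL => ?_
      rcases M.pathLength_exit hL e t rfl with ⟨s', hs', _⟩ | h'
      · exact absurd ⟨s', hs'⟩ h
      · exact h'
  rcases key with ⟨s, hs, key⟩ | key
  · have : min (edist (t : ℝ≥0∞) (s : ℝ≥0∞)) (min ((t : ℝ≥0∞) + M.dist (M.edge e ⊥) y)
        (edist (t : ℝ≥0∞) (M.G.length e) + M.dist (M.edge e ⊤) y)) ≤ M.dist (M.edge e t) y :=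
      le_sInf fun L hL => by simpa [min_le_iff] using key L hL
    rw [min_le_iff, min_le_iff] at this
    exact this.imp_left fun h => ⟨s, hs, h⟩
  · have : min ((t : ℝ≥0∞) + M.dist (M.edge e ⊥) y)
        (edist (t : ℝ≥0∞) (M.G.length e) + M.dist (M.edge e ⊤) y) ≤ M.dist (M.edge e t) y :=
      le_sInf fun L hL => by simpa [min_le_iff] using key L hL
    rw [min_le_iff] at this
    exact Or.inr this

theorem exists_le_length : ∃ m : ℝ≥0∞, 0 < m ∧ ∀ e, m ≤ M.G.length e := by
  rcases isEmpty_or_nonempty M.G.graph.edgeSet with h | h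
  · exact ⟨1, one_pos, fun e => h.elim e⟩
  · obtain ⟨e, he⟩ := Finite.exists_min M.G.length
    exact ⟨_, M.G.length_pos e, he⟩

/-- On the way to a vertex a path has to run to an end of its first edge. If that end is not the
target, a whole edge still has to be crossed, which costs at least `m`. This is the source of the
positivity of distances. -/
theorem pathLength_vertex {m : ℝ≥0∞} (hm : ∀ e, m ≤ M.G.length e) {x y : X} {L : ℝ≥0∞}
    (h : M.PathLength x y L) (hy : y ∈ M.G.graph.vertexSet) :
    ∀ (e : M.G.graph.edgeSet) (t : Set.Iic (M.G.length e)), M.edge e t = x →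
      (M.edge e ⊥ = y ∧ (t : ℝ≥0∞) ≤ L) ∨
      (M.edge e ⊤ = y ∧ edist (t : ℝ≥0∞) (M.G.length e) ≤ L) ∨ m ≤ L := by
  have key : ∀ (e : M.G.graph.edgeSet) (t : Set.Iic (M.G.length e)) (L : ℝ≥0∞),
      M.edge e t = y → (M.edge e ⊥ = y ∧ (t : ℝ≥0∞) ≤ L) ∨
      (M.edge e ⊤ = y ∧ edist (t : ℝ≥0∞) (M.G.length e) ≤ L) ∨ m ≤ L := by
    intro e t L ht
    by_cases h0 : t = ⊥
    · subst h0; exact Or.inl ⟨ht, bot_le⟩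
    by_cases h1 : t = ⊤
    · subst h1; exact Or.inr (Or.inl ⟨ht, by
        change edist (M.G.length e) (M.G.length e) ≤ L
        rw [ENNReal.edist_self']; exact bot_le⟩)
    exact absurd (ht ▸ hy) (M.interior_notMem e t h0 h1)
  induction h with
  | refl x => exact fun e t ht => key e t 0 ht
  | @step e' s' t' y L h ih =>
    have h3 : (M.edge e' ⊥ = y ∧ (s' : ℝ≥0∞) ≤ edist (s' : ℝ≥0∞) (t' : ℝ≥0∞) + L) ∨
      (M.edge e' ⊤ = y ∧ edist (s' : ℝ≥0∞) (M.G.length e') ≤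
        edist (s' : ℝ≥0∞) (t' : ℝ≥0∞) + L) ∨ m ≤ edist (s' : ℝ≥0∞) (t' : ℝ≥0∞) + L := by
      rcases ih hy key e' t' rfl with ⟨h1, h2⟩ | ⟨h1, h2⟩ | h1
      · refine Or.inl ⟨h1, le_trans ?_ (add_le_add_right h2 _)⟩
        simpa using ENNReal.edist_triangle' (s' : ℝ≥0∞) (t' : ℝ≥0∞) 0
      · exact Or.inr (Or.inl ⟨h1, (ENNReal.edist_triangle' _ _ _).trans (add_le_add_right h2 _)⟩)
      · exact Or.inr (Or.inr (h1.trans le_add_self))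
    intro e t ht
    by_cases hi : t ≠ ⊥ ∧ t ≠ ⊤
    · have := M.edge_eq_of_interior hi.1 hi.2 ht.symm
      obtain rfl : e' = e := congrArg Sigma.fst this
      simp only [Sigma.mk.injEq, heq_eq_eq, true_and] at this
      subst this
      exact h3
    · have hx : M.edge e' s' ∈ M.G.graph.vertexSet := by
        rw [← ht]
        by_cases h0 : t = ⊥
        · subst h0; exact M.edge_bot_mem e
        · have : t = ⊤ := by tauto
          subst this; exact M.edge_top_mem e
      by_cases hxy : M.edge e' s' = y
      · exact key e t _ (ht.trans hxy)
      -- Here the path starts at a vertex other than `y`, that is, at an end of `e'`. The target is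
      -- then either the opposite end of `e'`, a full edge away, or out of reach at cost less than
      -- `m`.
      refine Or.inr (Or.inr ?_)
      have hs : s' = ⊥ ∨ s' = ⊤ := by
        by_contra hn
        rw [not_or] at hn
        exact M.interior_notMem e' s' hn.1 hn.2 hx
      rcases h3 with ⟨h1, h2⟩ | ⟨h1, h2⟩ | h3
      · rcases hs with rfl | rfl
        · exact absurd h1 hxy
        · exact (hm e').trans h2
      · rcases hs with rfl | rfl
        · refine (hm e').trans (le_trans ?_ h2)
          change _ ≤ edist (0 : ℝ≥0∞) _
          rw [ENNReal.edist_comm']; simp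
        · exact absurd h1 hxy
      · exact h3

end GraphPresentation

/-! ### Positivity and finiteness of the distance -/

namespace TropicalModel

variable {X : Type*} [TopologicalSpace X] [EDist X]

theorem edist_self (M : TropicalModel X) (x : X) : edist x x = 0 := by rw [M.edist_eq, M.dist_self]

theorem edist_comm (M : TropicalModel X) (x y : X) : edist x y = edist y x := by
  rw [M.edist_eq, M.edist_eq, M.dist_comm]

theorem edist_triangle (M : TropicalModel X) (x y z : X) : edist x z ≤ edist x y + edist y z := by
  simp only [M.edist_eq]
  exact M.dist_triangle x y z

theorem edist_edge_le (M : TropicalModel X) (e : M.G.graph.edgeSet) (s t : Set.Iic (M.G.length e)) :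
    edist (M.edge e s) (M.edge e t) ≤ edist (s : ℝ≥0∞) (t : ℝ≥0∞) := by
  rw [M.edist_eq]
  exact M.dist_edge_le e s t

theorem edist_exit (M : TropicalModel X) (e : M.G.graph.edgeSet) (t : Set.Iic (M.G.length e)) (y :
    X) :
    (∃ s : Set.Iic (M.G.length e), M.edge e s = y ∧
        edist (t : ℝ≥0∞) (s : ℝ≥0∞) ≤ edist (M.edge e t) y) ∨
      (t : ℝ≥0∞) + edist (M.edge e ⊥) y ≤ edist (M.edge e t) y ∨
      edist (t : ℝ≥0∞) (M.G.length e) + edist (M.edge e ⊤) y ≤ edist (M.edge e t) y := by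
  simp only [M.edist_eq]
  exact M.dist_exit e t y

theorem edist_pos_of_mem (M : TropicalModel X) {x y : X} (hxy : x ≠ y) (hy :
    y ∈ M.G.graph.vertexSet) :
    0 < edist x y := by
  obtain ⟨m, hm0, hm⟩ := M.exists_le_length
  obtain ⟨e, t, rfl⟩ := M.exists_edge_of_ne hxy
  suffices h : ∃ c, 0 < c ∧ ∀ L, M.PathLength (M.edge e t) y L → c ≤ L by
    obtain ⟨c, hc, h⟩ := h
    rw [M.edist_eq]
    exact hc.trans_le (le_sInf h)
  by_cases h0 : t = ⊥
  · subst h0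
    refine ⟨m, hm0, fun L hL => ?_⟩
    rcases M.pathLength_vertex hm hL hy e ⊥ rfl with h | h | h
    · exact absurd h.1 hxy
    · refine (hm e).trans (le_trans ?_ h.2)
      rw [ENNReal.edist_comm']
      exact (ENNReal.edist_zero_right' _).ge
    · exact h
  by_cases h1 : t = ⊤
  · subst h1
    refine ⟨m, hm0, fun L hL => ?_⟩
    rcases M.pathLength_vertex hm hL hy e ⊤ rfl with h | h | h
    · exact (hm e).trans h.2
    · exact absurd h.1 hxy
    · exact h
  -- The bound for an interior point: its distances along the edge to both ends, and the least edge
  -- length.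
  refine ⟨min (t : ℝ≥0∞) (min (edist (t : ℝ≥0∞) (M.G.length e)) m), ?_, fun L hL => ?_⟩
  · refine lt_min (bot_lt_iff_ne_bot.2 fun h => h0 (Subtype.ext h)) (lt_min ?_ hm0)
    rw [ENNReal.edist_eq_sub_add_sub]
    have h2 : (t : ℝ≥0∞) < M.G.length e := lt_of_le_of_ne t.2 fun h => h1 (Subtype.ext h)
    exact (tsub_pos_of_lt h2).trans_le le_add_self
  · rcases M.pathLength_vertex hm hL hy e t rfl with h | h | h
    · exact (min_le_left _ _).trans h.2
    · exact (min_le_right _ _).trans ((min_le_left _ _).trans h.2)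
    · exact (min_le_right _ _).trans ((min_le_right _ _).trans h)

theorem edist_pos (M : TropicalModel X) {x y : X} (hxy : x ≠ y) : 0 < edist x y := by
  by_cases hy : y ∈ M.G.graph.vertexSet
  · exact M.edist_pos_of_mem hxy hy
  by_cases hx : x ∈ M.G.graph.vertexSet
  · rw [M.edist_comm]
    exact M.edist_pos_of_mem hxy.symm hx
  obtain ⟨e, t, h0, h1, rfl⟩ := M.exists_of_notMem x hx
  have hlt : (t : ℝ≥0∞) < M.G.length e := lt_of_le_of_ne t.2 fun h => h1 (Subtype.ext h)
  rcases M.edist_exit e t y with ⟨s, hs, h⟩ | h | h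
  · refine lt_of_lt_of_le ?_ h
    rw [ENNReal.edist_eq_sub_add_sub, pos_iff_ne_zero]
    intro h
    rw [add_eq_zero, tsub_eq_zero_iff_le, tsub_eq_zero_iff_le] at h
    have : t = s := Subtype.ext (le_antisymm h.1 h.2)
    subst this
    exact hxy hs
  · exact (bot_lt_iff_ne_bot.2 fun h => h0 (Subtype.ext h)).trans_le (le_self_add.trans h)
  · refine lt_of_lt_of_le ?_ (le_self_add.trans h)
    rw [ENNReal.edist_eq_sub_add_sub]
    exact (tsub_pos_of_lt hlt).trans_le le_add_self

theorem edge_bot_notMem (M : TropicalModel X) (e : M.G.graph.edgeSet) :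
    M.edge e ⊥ ∉ pointsAtInfinity X :=
  M.edge_notMem ENNReal.zero_ne_top

theorem edge_top_mem_pointsAtInfinity (M : TropicalModel X) {e : M.G.graph.edgeSet} (he :
    M.G.length e = ∞) :
    M.edge e ⊤ ∈ pointsAtInfinity X := ⟨M, e, he, rfl⟩

theorem edge_top_eq (M : TropicalModel X) {e e' : M.G.graph.edgeSet} (he : M.G.length e = ∞)
    (h : M.edge e' ⊤ = M.edge e ⊤) : e' = e :=
  congrArg Sigma.fst (M.edge_eq_top he h)

theorem edge_bot_ne_top (M : TropicalModel X) {e e' : M.G.graph.edgeSet} (he : M.G.length e = ∞) :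
    M.edge e' ⊥ ≠ M.edge e ⊤ := by
  intro h
  have := M.edge_eq_top he h
  obtain rfl : e' = e := congrArg Sigma.fst this
  simp only [Sigma.mk.injEq, heq_eq_eq, true_and] at this
  exact M.bot_ne_top e' this

theorem exists_finite_vertex (M : TropicalModel X) :
    ∃ v ∈ M.G.graph.vertexSet, v ∉ pointsAtInfinity X := by
  obtain ⟨v, hv⟩ := M.G.nonempty_vertexSet
  by_cases h : v ∈ pointsAtInfinity X
  · obtain ⟨e, he, rfl⟩ := M.exists_edge_top h
    exact ⟨_, M.edge_bot_mem e, M.edge_bot_notMem e⟩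
  · exact ⟨v, hv, h⟩

theorem edist_bot_top_le (M : TropicalModel X) (e : M.G.graph.edgeSet) :
    edist (M.edge e ⊥) (M.edge e ⊤) ≤ M.G.length e := by
  refine (M.edist_edge_le e ⊥ ⊤).trans ?_
  rw [ENNReal.edist_comm']
  exact (ENNReal.edist_zero_right' _).le

/-- A walk may visit a leaf at infinity, where distances are infinite. It can only return along the
edge by which it came, so the second clause carries the finite distance to the other end of that
edge through the induction. -/
theorem edist_ne_top_of_reachable (M : TropicalModel X) {w v : X} (hw : w ∉ pointsAtInfinity X)
    (h : Relation.ReflTransGen M.G.graph.Adj w v) :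
    (v ∉ pointsAtInfinity X → edist w v ≠ ∞) ∧
      ∀ e, M.G.length e = ∞ → M.edge e ⊤ = v → edist w (M.edge e ⊥) ≠ ∞ := by
  induction h with
  | refl =>
    refine ⟨fun _ => by rw [M.edist_self]; exact ENNReal.zero_ne_top, ?_⟩
    rintro e he rfl
    exact absurd (M.edge_top_mem_pointsAtInfinity he) hw
  | @tail v v' hv hadj ih =>
    obtain ⟨e', he'⟩ := hadj
    obtain ⟨e, rfl⟩ : ∃ e : M.G.graph.edgeSet, (e : M.E) = e' := ⟨⟨e', he'.edge_mem⟩, rfl⟩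
    rcases (M.isLink e).eq_and_eq_or_eq_and_eq he' with ⟨rfl, rfl⟩ | ⟨rfl, rfl⟩
    · have h1 := ih.1 (M.edge_bot_notMem e)
      refine ⟨fun h => ?_, fun e₂ h2 h3 => ?_⟩
      · have hl : M.G.length e ≠ ∞ := fun hl => h (M.edge_top_mem_pointsAtInfinity hl)
        refine ne_top_of_le_ne_top (ENNReal.add_ne_top.2 ⟨h1, hl⟩)
          ((M.edist_triangle _ (M.edge e ⊥) _).trans ?_)
        gcongr
        exact M.edist_bot_top_le e
      · obtain rfl := M.edge_top_eq h2 h3.symm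
        exact h1
    · refine ⟨fun _ => ?_, fun e₂ h2 h3 => absurd h3.symm (M.edge_bot_ne_top h2)⟩
      by_cases hl : M.G.length e = ∞
      · exact ih.2 e hl rfl
      · have h1 := ih.1 fun h => hl (M.eq_top_of_mem h).1
        refine ne_top_of_le_ne_top (ENNReal.add_ne_top.2 ⟨h1, hl⟩)
          ((M.edist_triangle _ (M.edge e ⊤) _).trans ?_)
        gcongr
        rw [M.edist_comm]
        exact M.edist_bot_top_le e

theorem edist_ne_top (M : TropicalModel X) {x y : X} (hx : x ∉ pointsAtInfinity X) (hy :
    y ∉ pointsAtInfinity X) :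
    edist x y ≠ ∞ := by
  obtain ⟨w, hw, hw'⟩ := M.exists_finite_vertex
  have key : ∀ z ∉ pointsAtInfinity X, edist w z ≠ ∞ := by
    intro z hz
    by_cases hzv : z ∈ M.G.graph.vertexSet
    · exact (M.edist_ne_top_of_reachable hw' (M.G.connected w hw z hzv)).1 hz
    · obtain ⟨e, t, -, h1, rfl⟩ := M.exists_of_notMem z hzv
      have ht : (t : ℝ≥0∞) ≠ ∞ := fun h => h1 (Subtype.ext (le_antisymm t.2 (h ▸ le_top)))
      have h2 := (M.edist_ne_top_of_reachable hw' (M.G.connected w hw _ (M.edge_bot_mem e))).1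
        (M.edge_bot_notMem e)
      refine ne_top_of_le_ne_top (ENNReal.add_ne_top.2 ⟨h2, ht⟩)
          ((M.edist_triangle _ (M.edge e ⊥) _).trans ?_)
      gcongr
      rw [M.edist_comm]
      exact (M.edist_edge_le e t ⊥).trans (ENNReal.edist_zero_right' _).le
  refine ne_top_of_le_ne_top (ENNReal.add_ne_top.2 ⟨key x hx, key y hy⟩)
    ((M.edist_triangle x w y).trans ?_)
  rw [M.edist_comm x w]

theorem edist_eq_top (M : TropicalModel X) {x y : X} (hx : x ∈ pointsAtInfinity X) (hxy : y ≠ x) :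
    edist x y = ∞ := by
  obtain ⟨e, he, rfl⟩ := M.exists_edge_top hx
  exact M.edist_edge_top he hxy

end TropicalModel

/-! ### The metric space of finite points -/

/-- The points of a tropical curve that are not at infinity. -/
@[ext]
structure FinitePoint (X : Type*) [TopologicalSpace X] [EDist X] : Type _ where
  /-- the underlying point -/
  val : X
  notMem : val ∉ pointsAtInfinity X

namespace FinitePoint

variable {X : Type*} [TopologicalSpace X] [EDist X]

instance : CoeOut (FinitePoint X) X := ⟨FinitePoint.val⟩

noncomputable instance [TropicalCurve X] : MetricSpace (FinitePoint X) where
  dist x y := (edist (x : X) (y : X)).toReal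
  dist_self x := by
    obtain ⟨M⟩ := TropicalCurve.exists_model (X := X)
    simp [M.edist_self]
  dist_comm x y := by
    obtain ⟨M⟩ := TropicalCurve.exists_model (X := X)
    rw [M.edist_comm]
  dist_triangle x y z := by
    obtain ⟨M⟩ := TropicalCurve.exists_model (X := X)
    rw [← ENNReal.toReal_add (M.edist_ne_top x.2 y.2) (M.edist_ne_top y.2 z.2)]
    exact ENNReal.toReal_mono
      (ENNReal.add_ne_top.2 ⟨M.edist_ne_top x.2 y.2, M.edist_ne_top y.2 z.2⟩)
      (M.edist_triangle _ _ _)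
  eq_of_dist_eq_zero {x y} h := by
    obtain ⟨M⟩ := TropicalCurve.exists_model (X := X)
    by_contra hxy
    have h1 := (M.edist_pos fun h => hxy (FinitePoint.ext h)).ne'
    exact (ENNReal.toReal_ne_zero.2 ⟨h1, M.edist_ne_top x.2 y.2⟩) h

variable [TropicalCurve X]

theorem dist_def (x y : FinitePoint X) : dist x y = (edist (x : X) (y : X)).toReal := rfl

theorem edist_coe (x y : FinitePoint X) : edist (x : X) (y : X) = ENNReal.ofReal (dist x y) := by
  obtain ⟨M⟩ := TropicalCurve.exists_model (X := X)
  rw [dist_def, ENNReal.ofReal_toReal (M.edist_ne_top x.2 y.2)]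

end FinitePoint

/-! ### Real parameters on edges -/

namespace TropicalModel

variable {X : Type*} [TopologicalSpace X] [EDist X] (M : TropicalModel X)

/-- The point with real parameter `u` on an edge; parameters outside the interval of the edge are
moved to the nearest end. -/
noncomputable def pt (e : M.G.graph.edgeSet) (u : ℝ) : FinitePoint X :=
  ⟨M.edge e ⟨min (ENNReal.ofReal u) (M.G.length e), mem_Iic.2 (min_le_right _ _)⟩,
    M.edge_notMem (ne_top_of_le_ne_top ENNReal.ofReal_ne_top (min_le_left _ _))⟩

/-- The finite parameters of an edge. -/
def dom (e : M.G.graph.edgeSet) : Set ℝ := {u | 0 ≤ u ∧ ENNReal.ofReal u ≤ M.G.length e}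

variable {M}

theorem ofReal_mem {e : M.G.graph.edgeSet} {u : ℝ} (hu : u ∈ M.dom e) :
    ENNReal.ofReal u ∈ Set.Iic (M.G.length e) := hu.2

theorem coe_pt {e : M.G.graph.edgeSet} {u : ℝ} (hu : u ∈ M.dom e) :
    (M.pt e u : X) = M.edge e ⟨ENNReal.ofReal u, ofReal_mem hu⟩ := by
  exact congrArg (M.edge e) (Subtype.ext (min_eq_left hu.2))

theorem edge_eq_pt (e : M.G.graph.edgeSet) (t : Set.Iic (M.G.length e)) (ht : (t : ℝ≥0∞) ≠ ∞) :
    M.edge e t = M.pt e (t : ℝ≥0∞).toReal := by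
  refine congrArg (M.edge e) (Subtype.ext ?_)
  change (t : ℝ≥0∞) = min (ENNReal.ofReal (t : ℝ≥0∞).toReal) (M.G.length e)
  rw [ENNReal.ofReal_toReal ht, min_eq_left t.2]

theorem toReal_mem_dom (e : M.G.graph.edgeSet) (t : Set.Iic (M.G.length e)) (ht : (t : ℝ≥0∞) ≠ ∞) :
    (t : ℝ≥0∞).toReal ∈ M.dom e :=
  ⟨ENNReal.toReal_nonneg, by rw [ENNReal.ofReal_toReal ht]; exact t.2⟩

variable (M)

theorem zero_mem_dom (e : M.G.graph.edgeSet) : (0 : ℝ) ∈ M.dom e := ⟨le_rfl, by simp⟩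

theorem length_mem_dom (e : M.G.graph.edgeSet) (he : M.G.length e ≠ ∞) :
    (M.G.length e).toReal ∈ M.dom e := M.toReal_mem_dom e ⊤ he

theorem mem_dom_of_top {e : M.G.graph.edgeSet} (he : M.G.length e = ∞) {u : ℝ} (hu : 0 ≤ u) :
    u ∈ M.dom e := ⟨hu, by simp [he]⟩

theorem coe_pt_zero (e : M.G.graph.edgeSet) : (M.pt e 0 : X) = M.edge e ⊥ := by
  rw [coe_pt (M.zero_mem_dom e)]
  congr 1
  exact Subtype.ext ENNReal.ofReal_zero

theorem coe_pt_length (e : M.G.graph.edgeSet) (he : M.G.length e ≠ ∞) :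
    (M.pt e (M.G.length e).toReal : X) = M.edge e ⊤ :=
  (M.edge_eq_pt e ⊤ he).symm

theorem le_length {e : M.G.graph.edgeSet} {u : ℝ} (hu : u ∈ M.dom e) (he : M.G.length e ≠ ∞) :
    u ≤ (M.G.length e).toReal := (ENNReal.ofReal_le_iff_le_toReal he).1 hu.2

variable {M}

theorem mem_dom_of_le {e : M.G.graph.edgeSet} {u v : ℝ} (hv : v ∈ M.dom e) (h0 : 0 ≤ u)
    (h : u ≤ v) : u ∈ M.dom e := ⟨h0, (ENNReal.ofReal_le_ofReal h).trans hv.2⟩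

theorem ofReal_edist {u v : ℝ} (hu : 0 ≤ u) (hv : 0 ≤ v) :
    edist (ENNReal.ofReal u) (ENNReal.ofReal v) = ENNReal.ofReal |u - v| := by
  rw [ENNReal.edist_eq_sub_add_sub, ← ENNReal.ofReal_sub _ hv, ← ENNReal.ofReal_sub _ hu]
  rcases le_total u v with h | h
  · rw [ENNReal.ofReal_of_nonpos (sub_nonpos.2 h), zero_add, abs_sub_comm,
      abs_of_nonneg (sub_nonneg.2 h)]
  · rw [ENNReal.ofReal_of_nonpos (sub_nonpos.2 h : v - u ≤ 0), add_zero,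
      abs_of_nonneg (sub_nonneg.2 h)]

variable (M)

theorem exists_pt_of_ne {x y : FinitePoint X} (h : x ≠ y) : ∃ e, ∃ u ∈ M.dom e, M.pt e u = x := by
  obtain ⟨e, t, ht⟩ := M.exists_edge_of_ne fun h' => h (FinitePoint.ext h')
  have ht' : (t : ℝ≥0∞) ≠ ∞ := fun h' => x.2 (ht ▸ by
    have := top_le_iff.1 (h' ▸ t.2 : ∞ ≤ M.G.length e)
    exact ⟨M, e, this, congrArg _ (Subtype.ext (this.trans h'.symm))⟩)
  exact ⟨e, _, M.toReal_mem_dom e t ht', FinitePoint.ext ((M.edge_eq_pt e t ht').symm.trans ht)⟩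

/-- An interior point of an edge has no other parameter. -/
theorem pt_injective_of_interior {e e' : M.G.graph.edgeSet} {u v : ℝ} (hu : u ∈ M.dom e)
    (h0 : u ≠ 0) (h1 : ENNReal.ofReal u ≠ M.G.length e) (hv : v ∈ M.dom e')
    (h : M.pt e' v = M.pt e u) : e' = e ∧ v = u := by
  have h3 : M.edge e' ⟨ENNReal.ofReal v, ofReal_mem hv⟩ =
      M.edge e ⟨ENNReal.ofReal u, ofReal_mem hu⟩ := by
    rw [← coe_pt hv, ← coe_pt hu, h]
  have h2 := M.edge_eq_of_interior (fun h => ?_) (fun h => h1 (congrArg Subtype.val h)) h3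
  · obtain rfl : e' = e := congrArg Sigma.fst h2
    simp only [Sigma.mk.injEq, heq_eq_eq, true_and, Subtype.mk.injEq] at h2
    exact ⟨rfl, (ENNReal.ofReal_eq_ofReal_iff hv.1 hu.1).1 h2⟩
  · have : ENNReal.ofReal u = 0 := congrArg Subtype.val h
    rw [ENNReal.ofReal_eq_zero] at this
    exact h0 (le_antisymm this hu.1)

/-- A point with a positive parameter on an unbounded edge has no other parameter. -/
theorem pt_injective_of_top {e e' : M.G.graph.edgeSet} (he : M.G.length e = ∞) {u v : ℝ}
    (hu : 0 < u) (hv : v ∈ M.dom e') (h : M.pt e' v = M.pt e u) : e' = e ∧ v = u := by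
  exact M.pt_injective_of_interior (M.mem_dom_of_top he hu.le) hu.ne'
    (he ▸ ENNReal.ofReal_ne_top) hv h

theorem finite_preimage_pt (e : M.G.graph.edgeSet) (y : FinitePoint X) :
    {u ∈ M.dom e | M.pt e u = y}.Finite := by
  refine ((M.finite_preimage e (y : X)).image fun s : Set.Iic (M.G.length e) => (s : ℝ≥0∞).toReal).subset ?_
  rintro u ⟨hu, rfl⟩
  exact ⟨⟨_, ofReal_mem hu⟩, (coe_pt hu).symm, ENNReal.toReal_ofReal hu.1⟩

variable [TropicalCurve X]

theorem dist_pt_le (e : M.G.graph.edgeSet) (u v : ℝ) : dist (M.pt e u) (M.pt e v) ≤ |u - v| := by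
  rw [FinitePoint.dist_def]
  refine ENNReal.toReal_le_of_le_ofReal (abs_nonneg _) ((M.edist_edge_le e _ _).trans ?_)
  wlog h : u ≤ v generalizing u v
  · rw [ENNReal.edist_comm', abs_sub_comm]
    exact this v u (le_of_not_ge h)
  have hmono : min (ENNReal.ofReal u) (M.G.length e) ≤ min (ENNReal.ofReal v) (M.G.length e) :=
    min_le_min_right _ (ENNReal.ofReal_le_ofReal h)
  simp only
  rw [ENNReal.edist_eq_sub_add_sub, tsub_eq_zero_of_le hmono, zero_add, tsub_le_iff_right,
    abs_sub_comm, abs_of_nonneg (sub_nonneg.2 h)]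
  rcases le_total (ENNReal.ofReal u) (M.G.length e) with h1 | h1
  · rw [min_eq_left h1]
    refine (min_le_left _ _).trans (le_trans ?_ ENNReal.ofReal_add_le)
    simp
  · rw [min_eq_right h1]
    exact (min_le_right _ _).trans le_add_self

theorem lipschitzWith_pt (e : M.G.graph.edgeSet) : LipschitzWith 1 (M.pt e) :=
  LipschitzWith.of_dist_le_mul fun u v => by
    simpa [Real.dist_eq] using M.dist_pt_le e u v

theorem continuous_pt (e : M.G.graph.edgeSet) : Continuous (M.pt e) :=
  (M.lipschitzWith_pt e).continuous

/-- A shortest path from a point of an edge stays on this edge or leaves it through an end. -/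
theorem dist_pt_exit {e : M.G.graph.edgeSet} {u : ℝ} (hu : u ∈ M.dom e) (y : FinitePoint X) :
    (∃ s ∈ M.dom e, M.pt e s = y ∧ |u - s| ≤ dist (M.pt e u) y) ∨
      u + dist (M.pt e 0) y ≤ dist (M.pt e u) y ∨
      (M.G.length e ≠ ∞ ∧ (M.G.length e).toReal - u + dist (M.pt e (M.G.length e).toReal) y ≤
        dist (M.pt e u) y) := by
  have h := M.edist_exit e ⟨ENNReal.ofReal u, ofReal_mem hu⟩ y
  rw [← coe_pt hu, FinitePoint.edist_coe, ← M.coe_pt_zero, FinitePoint.edist_coe] at h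
  rcases h with ⟨s, hs, h⟩ | h | h
  · left
    have hs' : (s : ℝ≥0∞) ≠ ∞ := fun h' => y.2 (hs ▸ by
      have := top_le_iff.1 (h' ▸ s.2 : ∞ ≤ M.G.length e)
      exact ⟨M, e, this, congrArg _ (Subtype.ext (this.trans h'.symm))⟩)
    refine ⟨_, M.toReal_mem_dom e s hs', FinitePoint.ext ((M.edge_eq_pt e s hs').symm.trans hs), ?_⟩
    rw [← ENNReal.ofReal_le_ofReal_iff dist_nonneg,
      ← ofReal_edist hu.1 ENNReal.toReal_nonneg, ENNReal.ofReal_toReal hs']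
    exact h
  · right; left
    rwa [← ENNReal.ofReal_add hu.1 dist_nonneg, ENNReal.ofReal_le_ofReal_iff dist_nonneg] at h
  · right; right
    simp only at h
    by_cases he : M.G.length e = ∞
    · rw [(ENNReal.edist_eq_top_iff _ _).2 ⟨fun h' => ENNReal.ofReal_ne_top (h'.trans he),
        Or.inr he⟩, top_add, top_le_iff] at h
      exact absurd h ENNReal.ofReal_ne_top
    · refine ⟨he, ?_⟩
      rw [← M.coe_pt_length e he, FinitePoint.edist_coe] at h
      nth_rewrite 1 [← ENNReal.ofReal_toReal he] at h
      rw [ofReal_edist hu.1 ENNReal.toReal_nonneg, ← ENNReal.ofReal_add (abs_nonneg _) dist_nonneg,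
        ENNReal.ofReal_le_ofReal_iff dist_nonneg] at h
      have := neg_le_abs (u - (M.G.length e).toReal)
      linarith

end TropicalModel

/-! ### Distance functions are rational -/

namespace IsPiecewiseAffine

variable {L : ℝ≥0∞} {u v w : Set.Iic L → EReal}

theorem affine (m : ℤ) (c : ℝ) (h : ∀ t : Set.Iic L, (t : ℝ≥0∞) ≠ ∞ →
    w t = ((m * (t : ℝ≥0∞).toReal + c : ℝ) : EReal)) : IsPiecewiseAffine w :=
  ⟨Unit, inferInstance, fun _ => univ, fun _ => m, fun _ => c, fun _ => ordConnected_univ,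
    fun _ _ => ⟨(), mem_univ _⟩, fun _ t ht _ => h t ht⟩

theorem neg (hu : IsPiecewiseAffine u) (h : ∀ t : Set.Iic L, (t : ℝ≥0∞) ≠ ∞ → w t = -u t) :
    IsPiecewiseAffine w := by
  obtain ⟨ι, _, I, m, c, h1, h2, h3⟩ := hu
  refine ⟨ι, inferInstance, I, fun i => -m i, fun i => -c i, h1, h2, fun i t ht hi => ?_⟩
  rw [h t ht, h3 i t ht hi, ← EReal.coe_neg]
  congr 1
  push_cast
  ring

theorem min (hu : IsPiecewiseAffine u) (hv : IsPiecewiseAffine v)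
    (h : ∀ t : Set.Iic L, (t : ℝ≥0∞) ≠ ∞ → w t = Min.min (u t) (v t)) :
    IsPiecewiseAffine w := by
  have hu' : IsPiecewiseAffine fun t => -u t := hu.neg fun _ _ => rfl
  have hv' : IsPiecewiseAffine fun t => -v t := hv.neg fun _ _ => rfl
  have h' : IsPiecewiseAffine fun t => Max.max (-u t) (-v t) := hu'.max hv' fun _ _ => rfl
  refine h'.neg fun t ht => ?_
  rw [h t ht, EReal.neg_strictAnti.antitone.map_max, neg_neg, neg_neg]

theorem congr (hu : IsPiecewiseAffine u) (h : ∀ t : Set.Iic L, (t : ℝ≥0∞) ≠ ∞ → w t = u t) :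
    IsPiecewiseAffine w := by
  obtain ⟨ι, _, I, m, c, h1, h2, h3⟩ := hu
  exact ⟨ι, inferInstance, I, m, c, h1, h2, fun i t ht hi => (h t ht).trans (h3 i t ht hi)⟩

end IsPiecewiseAffine

namespace TropicalModel

variable {X : Type*} [TopologicalSpace X] [EDist X] (M : TropicalModel X)

theorem exists_tail (e : M.G.graph.edgeSet) (z : FinitePoint X) :
    ∃ u₀, 0 ≤ u₀ ∧ ∀ s ∈ M.dom e, M.pt e s = z → s ≤ u₀ := by
  obtain ⟨B, hB⟩ := (M.finite_preimage_pt e z).bddAbove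
  exact ⟨max B 0, le_max_right _ _, fun s hs h => (hB ⟨hs, h⟩).trans (le_max_left _ _)⟩

variable [TropicalCurve X]

/-- Beyond all occurrences of `z`, the distance from `z` is affine on an unbounded edge. -/
theorem dist_tail {e : M.G.graph.edgeSet} (he : M.G.length e = ∞) {z : FinitePoint X} {u₀ u : ℝ}
    (h0 : 0 ≤ u₀) (h : ∀ s ∈ M.dom e, M.pt e s = z → s ≤ u₀) (hu : u₀ ≤ u) :
    dist (M.pt e u) z = u - u₀ + dist (M.pt e u₀) z := by
  apply le_antisymm
  · refine (dist_triangle _ (M.pt e u₀) _).trans ?_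
    have := M.dist_pt_le e u u₀
    rw [abs_of_nonneg (sub_nonneg.2 hu)] at this
    linarith
  · rcases M.dist_pt_exit (M.mem_dom_of_top he (h0.trans hu)) z with ⟨s, hs, rfl, h1⟩ | h1 | h1
    · have h2 := h s hs rfl
      have h3 := M.dist_pt_le e u₀ s
      rw [abs_of_nonneg (sub_nonneg.2 h2)] at h3
      have := le_abs_self (u - s)
      linarith
    · have h3 := M.dist_pt_le e u₀ 0
      rw [sub_zero, abs_of_nonneg h0] at h3
      have := dist_triangle (M.pt e u₀) (M.pt e 0) z
      linarith
    · exact absurd he h1.1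

theorem edist_edge (z : FinitePoint X) (e : M.G.graph.edgeSet) (t : Set.Iic (M.G.length e))
    (ht : (t : ℝ≥0∞) ≠ ∞) :
    edist (z : X) (M.edge e t) = ENNReal.ofReal (dist z (M.pt e (t : ℝ≥0∞).toReal)) := by
  rw [M.edge_eq_pt e t ht, FinitePoint.edist_coe]

/-- At finite parameters the parametrisation of an edge is 1-Lipschitz. At the end of an unbounded
edge the affine growth of `dist_tail` forces the distance to tend to `∞`. -/
theorem continuous_edist (z : FinitePoint X) : Continuous fun x : X => edist (z : X) x := by
  obtain ⟨M⟩ := TropicalCurve.exists_model (X := X)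
  refine continuous_def.2 fun U hU => (M.isOpen_iff _).2 fun e => ?_
  rw [← preimage_comp]
  refine hU.preimage (continuous_iff_continuousAt.2 fun t => ?_)
  by_cases ht : (t : ℝ≥0∞) = ∞
  · have he : M.G.length e = ∞ := top_le_iff.1 (ht ▸ t.2)
    have ht' : t = ⊤ := Subtype.ext (ht.trans he.symm)
    subst ht'
    obtain ⟨u₀, h0, h⟩ := M.exists_tail e z
    have hlim : edist (z : X) (M.edge e ⊤) = ∞ := by
      rw [M.edist_comm]
      refine M.edist_edge_top he fun h => z.2 ?_
      rw [h]
      exact M.edge_top_mem_pointsAtInfinity he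
    change Tendsto _ _ (𝓝 (edist (z : X) (M.edge e ⊤)))
    rw [hlim, ENNReal.tendsto_nhds_top_iff_nat]
    intro n
    have hopen : ∀ᶠ t : Set.Iic (M.G.length e) in 𝓝 ⊤, ENNReal.ofReal (n + 1 + u₀) < (t : ℝ≥0∞) :=
      continuous_subtype_val.continuousAt.eventually (lt_mem_nhds (ht ▸ ENNReal.ofReal_lt_top))
    filter_upwards [hopen] with t h2
    by_cases h3 : (t : ℝ≥0∞) = ∞
    · have : t = ⊤ := Subtype.ext (h3.trans he.symm)
      subst this
      simp [hlim]
    · simp only [Function.comp_apply]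
      rw [M.edist_edge z e t h3, _root_.dist_comm]
      have h4 : n + 1 + u₀ < (t : ℝ≥0∞).toReal := (ENNReal.ofReal_lt_iff_lt_toReal
        (by positivity) h3).1 h2
      have hn : (0 : ℝ) ≤ n := n.cast_nonneg
      rw [M.dist_tail he h0 h (by linarith)]
      rw [ENNReal.natCast_lt_ofReal]
      have := dist_nonneg (x := M.pt e u₀) (y := z)
      linarith
  · have h1 : ContinuousAt (fun t : Set.Iic (M.G.length e) =>
        ENNReal.ofReal (dist z (M.pt e (t : ℝ≥0∞).toReal))) t := by
      refine ENNReal.continuous_ofReal.continuousAt.comp ?_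
      have h2 : ContinuousAt (fun t : Set.Iic (M.G.length e) => (t : ℝ≥0∞).toReal) t :=
        (ENNReal.continuousAt_toReal ht).comp continuous_subtype_val.continuousAt
      exact (continuous_const.dist (M.continuous_pt e)).continuousAt.comp h2
    refine h1.congr ?_
    have hopen : ∀ᶠ t : Set.Iic (M.G.length e) in 𝓝 t, (t : ℝ≥0∞) ≠ ∞ :=
      continuous_subtype_val.continuousAt.eventually (isOpen_ne.mem_nhds ht)
    filter_upwards [hopen] with t ht
    exact (M.edist_edge z e t ht).symm

/-- A shortest path from a point of the edge to `z` leaves through an end or stays on the edge. The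
distance is thus a minimum of functions of slope `±1` and possibly one absolute value. -/
theorem isPiecewiseAffine_edist (z : FinitePoint X) (e : M.G.graph.edgeSet) :
    IsPiecewiseAffine ((fun x : X => ((edist (z : X) x : ℝ≥0∞) : EReal)) ∘ M.edge e) := by
  have hval : ∀ t : Set.Iic (M.G.length e), (t : ℝ≥0∞) ≠ ∞ →
      ((fun x : X => ((edist (z : X) x : ℝ≥0∞) : EReal)) ∘ M.edge e) t =
        ((dist (M.pt e (t : ℝ≥0∞).toReal) z : ℝ) : EReal) := by
    intro t ht
    simp only [Function.comp_apply]
    rw [M.edist_edge z e t ht, EReal.coe_ennreal_ofReal, max_eq_left dist_nonneg,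
      _root_.dist_comm]
  -- the distance through the ends of the edge
  obtain ⟨g, hg, hg1, hg2⟩ : ∃ g : ℝ → ℝ,
      IsPiecewiseAffine (fun t : Set.Iic (M.G.length e) => ((g (t : ℝ≥0∞).toReal : ℝ) : EReal)) ∧
      (∀ u ∈ M.dom e, dist (M.pt e u) z ≤ g u) ∧
      ∀ u ∈ M.dom e, g u ≤ u + dist (M.pt e 0) z ∧ (M.G.length e ≠ ∞ → g u ≤
        (M.G.length e).toReal - u + dist (M.pt e (M.G.length e).toReal) z) := by
    have ha : IsPiecewiseAffine (fun t : Set.Iic (M.G.length e) =>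
        (((t : ℝ≥0∞).toReal + dist (M.pt e 0) z : ℝ) : EReal)) :=
      .affine 1 (dist (M.pt e 0) z) fun t ht => by simp
    have ha' : ∀ u ∈ M.dom e, dist (M.pt e u) z ≤ u + dist (M.pt e 0) z := by
      intro u hu
      have := M.dist_pt_le e u 0
      rw [sub_zero, abs_of_nonneg hu.1] at this
      linarith [dist_triangle (M.pt e u) (M.pt e 0) z]
    by_cases he : M.G.length e = ∞
    · exact ⟨fun u => u + dist (M.pt e 0) z, ha, ha', fun u hu => ⟨le_rfl, fun h => absurd he h⟩⟩
    · have hb : IsPiecewiseAffine (fun t : Set.Iic (M.G.length e) =>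
          (((M.G.length e).toReal - (t : ℝ≥0∞).toReal +
            dist (M.pt e (M.G.length e).toReal) z : ℝ) : EReal)) :=
        .affine (-1) ((M.G.length e).toReal + dist (M.pt e (M.G.length e).toReal) z)
          fun t ht => by congr 1; push_cast; ring
      refine ⟨fun u => min (u + dist (M.pt e 0) z) ((M.G.length e).toReal - u +
            dist (M.pt e (M.G.length e).toReal) z), ha.min hb fun t ht =>
            EReal.coe_strictMono.monotone.map_min, fun u hu => le_min (ha' u hu) ?_,
            fun u hu => ⟨min_le_left _ _, fun _ => min_le_right _ _⟩⟩
      have := M.dist_pt_le e u (M.G.length e).toReal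
      rw [abs_sub_comm, abs_of_nonneg (sub_nonneg.2 (M.le_length hu he))] at this
      linarith [dist_triangle (M.pt e u) (M.pt e (M.G.length e).toReal) z]
  -- Only when `z` is interior to this edge does the direct route along it compete with `g`.
  -- Otherwise a direct route ends at an end of the edge, which `g` already takes into account.
  by_cases hz : ∃ s ∈ M.dom e, s ≠ 0 ∧ ENNReal.ofReal s ≠ M.G.length e ∧ M.pt e s = z
  · obtain ⟨s, hs, hs0, hs1, rfl⟩ := hz
    have hc : IsPiecewiseAffine (fun t : Set.Iic (M.G.length e) =>
        ((|(t : ℝ≥0∞).toReal - s| : ℝ) : EReal)) := by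
      have h1 : IsPiecewiseAffine (fun t : Set.Iic (M.G.length e) =>
        (((t : ℝ≥0∞).toReal - s : ℝ) : EReal)) :=
        .affine 1 (-s) fun t ht => by congr 1; push_cast; ring
      have h2 : IsPiecewiseAffine (fun t : Set.Iic (M.G.length e) =>
        ((-((t : ℝ≥0∞).toReal - s) : ℝ) : EReal)) := h1.neg fun t ht => EReal.coe_neg _
      exact h1.max h2 fun t ht => EReal.coe_strictMono.monotone.map_max
    refine hc.min hg fun t ht => ?_
    have hd := M.toReal_mem_dom e t ht
    rw [hval t ht, ← EReal.coe_strictMono.monotone.map_min]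
    refine congrArg _ (le_antisymm (le_min (M.dist_pt_le e _ _) (hg1 _ hd)) ?_)
    rcases M.dist_pt_exit hd (M.pt e s) with ⟨s', hs', h1, h2⟩ | h1 | h1
    · rw [(M.pt_injective_of_interior hs hs0 hs1 hs' h1).2] at h2
      exact (min_le_left _ _).trans h2
    · exact (min_le_right _ _).trans ((hg2 _ hd).1.trans h1)
    · exact (min_le_right _ _).trans (((hg2 _ hd).2 h1.1).trans h1.2)
  · refine hg.congr fun t ht => ?_
    have hd := M.toReal_mem_dom e t ht
    rw [hval t ht]
    refine congrArg _ (le_antisymm (hg1 _ hd) ?_)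
    rcases M.dist_pt_exit hd z with ⟨s', hs', h1, h2⟩ | h1 | h1
    · by_cases h0 : s' = 0
      · subst h0
        refine (hg2 _ hd).1.trans ?_
        rw [sub_zero] at h2
        rw [h1] at *
        simpa using (le_abs_self _).trans h2
      · have h3 : ENNReal.ofReal s' = M.G.length e := by
          by_contra h3
          exact hz ⟨s', hs', h0, h3, h1⟩
        have he : M.G.length e ≠ ∞ := h3 ▸ ENNReal.ofReal_ne_top
        have h4 : (M.G.length e).toReal = s' := by rw [← h3, ENNReal.toReal_ofReal hs'.1]
        refine ((hg2 _ hd).2 he).trans ?_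
        rw [h4, h1, _root_.dist_self, add_zero]
        rw [abs_sub_comm] at h2
        exact (le_abs_self _).trans h2
    · exact (hg2 _ hd).1.trans h1
    · exact ((hg2 _ hd).2 h1.1).trans h1.2

end TropicalModel

namespace RatFun

variable {X : Type*} [TopologicalSpace X] [EDist X] [TropicalCurve X]

/-- The distance from a finite point as a rational function. -/
noncomputable def distFrom (z : FinitePoint X) : RatFun X where
  toFun x := ((edist (z : X) x : ℝ≥0∞) : EReal)
  isRational := by
    refine Or.inr ⟨continuous_coe_ennreal_ereal.comp (TropicalModel.continuous_edist z),
      fun x hx => ⟨EReal.coe_ennreal_ne_bot _, ?_⟩, fun M e => M.isPiecewiseAffine_edist z e⟩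
    obtain ⟨M⟩ := TropicalCurve.exists_model (X := X)
    rw [Ne, EReal.coe_ennreal_eq_top_iff]
    exact M.edist_ne_top z.2 hx

theorem distFrom_apply (z x : FinitePoint X) : distFrom z (x : X) = ((dist z x : ℝ) : EReal) := by
  change ((edist (z : X) (x : X) : ℝ≥0∞) : EReal) = _
  rw [FinitePoint.edist_coe, EReal.coe_ennreal_ofReal, max_eq_left dist_nonneg]

theorem distFrom_apply_top (z : FinitePoint X) {x : X} (hx : x ∈ pointsAtInfinity X) :
    distFrom z x = ⊤ := by
  obtain ⟨M⟩ := TropicalCurve.exists_model (X := X)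
  change ((edist (z : X) x : ℝ≥0∞) : EReal) = _
  rw [M.edist_comm, M.edist_eq_top hx (fun h => z.2 (by rw [h]; exact hx)), EReal.coe_ennreal_top]

end RatFun

/-! ### One-sided germs, monotone additive functions, maximality of the distance -/

/-- A piecewise affine function that is continuous at `0` is affine to the right of `0`. -/
theorem exists_affine_germ {ι : Type*} [Finite ι] {J : ι → Set ℝ} {m c : ι → ℝ} {h : ℝ → ℝ} {δ : ℝ}
    (hδ : 0 < δ) (hJ : ∀ i, (J i).OrdConnected) (hcov : ∀ w ∈ Ioc 0 δ, ∃ i, w ∈ J i)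
    (hh : ∀ i, ∀ w ∈ Ioc 0 δ, w ∈ J i → h w = m i * w + c i)
    (hc : Tendsto h (𝓝[>] 0) (𝓝 (h 0))) :
    ∃ i, ∃ ε, 0 < ε ∧ ε ≤ δ ∧ ∀ w ∈ Icc 0 ε, h w = h 0 + m i * w := by
  -- There are finitely many pieces, so one of them meets every right neighbourhood of `0`. Being
  -- order connected, it contains an interval starting there.
  obtain ⟨i, hi⟩ : ∃ i, ∃ᶠ w in 𝓝[>] (0 : ℝ), w ∈ J i := by
    by_contra! hn
    have h1 := eventually_all.2 hn
    obtain ⟨w, hw, hw'⟩ := (h1.and (Ioc_mem_nhdsGT hδ)).exists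
    obtain ⟨i, hi⟩ := hcov w hw'
    exact hw i hi
  obtain ⟨b, hb, hb0, hbδ⟩ := (hi.and_eventually (Ioc_mem_nhdsGT hδ)).exists
  have hsub : Ioc 0 b ⊆ J i := by
    intro w hw
    obtain ⟨a, ha, ha0, haw⟩ := (hi.and_eventually (Ioc_mem_nhdsGT hw.1)).exists
    exact (hJ i).out ha hb ⟨haw, hw.2⟩
  have hval : ∀ w ∈ Ioc 0 b, h w = m i * w + c i := fun w hw =>
    hh i w ⟨hw.1, hw.2.trans hbδ⟩ (hsub hw)
  have h0 : h 0 = c i := by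
    have h1 : Tendsto (fun w => m i * w + c i) (𝓝[>] 0) (𝓝 (m i * 0 + c i)) := by
      have : Continuous fun w : ℝ => m i * w + c i := by fun_prop
      exact (this.tendsto 0).mono_left nhdsWithin_le_nhds
    have h2 : Tendsto h (𝓝[>] 0) (𝓝 (m i * 0 + c i)) := by
      refine h1.congr' ?_
      filter_upwards [Ioc_mem_nhdsGT hb0] with w hw
      exact (hval w hw).symm
    rw [tendsto_nhds_unique hc h2]
    ring
  refine ⟨i, b, hb0, hbδ, fun w hw => ?_⟩
  rcases hw.1.eq_or_lt with rfl | hw0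
  · simp
  · rw [hval w ⟨hw0, hw.2⟩, h0, add_comm]

/-- A monotone additive function is linear. -/
theorem eq_mul_of_monotone_add {ρ : ℝ → ℝ} (hadd : ∀ a b, ρ (a + b) = ρ a + ρ b)
    (hmono : Monotone ρ) (c : ℝ) : ρ c = ρ 1 * c := by
  let A : ℝ →+ ℝ := AddMonoidHom.mk' ρ hadd
  have hq : ∀ q : ℚ, ρ q = ρ 1 * q := by
    intro q
    have := map_rat_smul A q (1 : ℝ)
    simp only [Rat.smul_def, mul_one] at this
    change ρ q = q * ρ 1 at this
    rw [this, mul_comm]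
  have h1 : 0 ≤ ρ 1 := by
    have := hmono (zero_le_one (α := ℝ))
    rwa [show ρ 0 = 0 from map_zero A] at this
  apply le_antisymm
  · by_contra! hlt
    have h1' : 0 < ρ 1 + 1 := by linarith
    -- A rational number so close to `c` that `ρ 1 * q` stays below `ρ c`, against monotonicity. The
    -- denominator is `ρ 1 + 1` because `ρ 1` may be zero.
    obtain ⟨q, hq1, hq2⟩ := exists_rat_btwn (show c < c + (ρ c - ρ 1 * c) / (ρ 1 + 1) by
      have : 0 < (ρ c - ρ 1 * c) / (ρ 1 + 1) := div_pos (by linarith) h1'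
      linarith)
    have h2 := hmono hq1.le
    rw [hq] at h2
    have h3 : (q - c) * (ρ 1 + 1) < ρ c - ρ 1 * c := by
      rw [← lt_div_iff₀ h1']; linarith
    nlinarith
  · by_contra! hlt
    have h1' : 0 < ρ 1 + 1 := by linarith
    obtain ⟨q, hq1, hq2⟩ := exists_rat_btwn (show c - (ρ 1 * c - ρ c) / (ρ 1 + 1) < c by
      have : 0 < (ρ 1 * c - ρ c) / (ρ 1 + 1) := div_pos (by linarith) h1'
      linarith)
    have h2 := hmono hq2.le
    rw [hq] at h2
    have h3 : (c - q) * (ρ 1 + 1) < ρ 1 * c - ρ c := by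
      rw [← lt_div_iff₀ h1']; linarith
    nlinarith

namespace TropicalModel

variable {X : Type*} [TopologicalSpace X] [EDist X] (M : TropicalModel X)

theorem continuous_coe_pt (e : M.G.graph.edgeSet) : Continuous fun u => (M.pt e u : X) := by
  refine (M.continuous_edge e).comp (Continuous.subtype_mk ?_ _)
  exact ENNReal.continuous_ofReal.min continuous_const

/-- The distance is the largest pseudometric that is at most the length on the edges. -/
theorem le_dist_of_edge [TropicalCurve X] {D : FinitePoint X → FinitePoint X → ℝ}
    (h0 : ∀ x, D x x ≤ 0)
    (htri : ∀ x y z, D x z ≤ D x y + D y z)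
    (he : ∀ e, ∀ u ∈ M.dom e, ∀ v ∈ M.dom e, D (M.pt e u) (M.pt e v) ≤ |u - v|)
    (x y : FinitePoint X) : D x y ≤ dist x y := by
  -- The triangle inequality adds up the edge estimates along a path of finite length; no step of
  -- such a path touches a point at infinity.
  have key : ∀ {x y : X} {L : ℝ≥0∞}, M.PathLength x y L → ∀ (hx : x ∉ pointsAtInfinity X)
      (hy : y ∉ pointsAtInfinity X), L ≠ ∞ → D ⟨x, hx⟩ ⟨y, hy⟩ ≤ L.toReal := by
    intro x y L h
    induction h with
    | refl x => exact fun hx _ _ => by simpa using h0 ⟨x, hx⟩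
    | step e s t h ih =>
      intro hx hy hL
      rw [ENNReal.add_ne_top] at hL
      have hs : (s : ℝ≥0∞) ≠ ∞ := fun h' => by
        have hl := top_le_iff.1 (h' ▸ s.2 : ∞ ≤ M.G.length e)
        exact hx ⟨M, e, hl, congrArg _ (Subtype.ext (hl.trans h'.symm))⟩
      have ht : (t : ℝ≥0∞) ≠ ∞ := fun h' => hL.1 ((ENNReal.edist_eq_top_iff _ _).2
        ⟨fun h => hs (h.trans h'), Or.inr h'⟩)
      have h1 := ih (M.edge_notMem ht) hy hL.2
      have h2 := he e _ (M.toReal_mem_dom e s hs) _ (M.toReal_mem_dom e t ht)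
      have h3 : M.pt e (s : ℝ≥0∞).toReal = ⟨M.edge e s, hx⟩ :=
        FinitePoint.ext (M.edge_eq_pt e s hs).symm
      have h4 : M.pt e (t : ℝ≥0∞).toReal = ⟨M.edge e t, M.edge_notMem ht⟩ :=
        FinitePoint.ext (M.edge_eq_pt e t ht).symm
      rw [h3, h4] at h2
      have h5 : edist (s : ℝ≥0∞) (t : ℝ≥0∞) =
          ENNReal.ofReal |(s : ℝ≥0∞).toReal - (t : ℝ≥0∞).toReal| := by
        rw [← ofReal_edist ENNReal.toReal_nonneg ENNReal.toReal_nonneg, ENNReal.ofReal_toReal hs,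
          ENNReal.ofReal_toReal ht]
      rw [ENNReal.toReal_add hL.1 hL.2, h5, ENNReal.toReal_ofReal (abs_nonneg _)]
      exact (htri _ _ _).trans (add_le_add h2 h1)
  have h6 : ENNReal.ofReal (D x y) ≤ ENNReal.ofReal (dist x y) := by
    rw [← FinitePoint.edist_coe, M.edist_eq]
    refine le_sInf fun L hL => ?_
    by_cases hL' : L = ∞
    · exact hL' ▸ le_top
    · exact (ENNReal.ofReal_le_iff_le_toReal hL').2 (key hL x.2 y.2 hL')
  exact (ENNReal.ofReal_le_ofReal_iff dist_nonneg).1 h6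

end TropicalModel

instance FinitePoint.instNonempty {X : Type*} [TopologicalSpace X] [EDist X] [TropicalCurve X] :
    Nonempty (FinitePoint X) := by
  obtain ⟨M⟩ := TropicalCurve.exists_model (X := X)
  obtain ⟨v, -, hv⟩ := M.exists_finite_vertex
  exact ⟨⟨v, hv⟩⟩

/-! ### Real values of rational functions and the constants -/

namespace RatFun

variable {X : Type*} [TopologicalSpace X] [EDist X]

/-- The real value of a rational function at a finite point. -/
noncomputable def eval (f : RatFun X) (x : FinitePoint X) : ℝ := (f x).toReal

theorem isRational_of_ne_zero {f : RatFun X} (hf : f ≠ 0) :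
    (∀ x ∉ pointsAtInfinity X, f x ≠ ⊥ ∧ f x ≠ ⊤) ∧
      ∀ (M : TropicalModel X) (e : M.G.graph.edgeSet), IsPiecewiseAffine (f ∘ M.edge e) := by
  rcases f.isRational with h | h
  · exact absurd (ext_finite fun x _ => congrFun h x) hf
  · exact h.2

theorem continuous_toFun (f : RatFun X) : Continuous f := f.isRational.continuous

theorem coe_eval {f : RatFun X} (hf : f ≠ 0) (x : FinitePoint X) : (f.eval x : EReal) = f x :=
  EReal.coe_toReal ((isRational_of_ne_zero hf).1 x x.2).2 ((isRational_of_ne_zero hf).1 x x.2).1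

theorem eval_eq {f : RatFun X} {x : FinitePoint X} {c : ℝ} (h : f x = c) : f.eval x = c := by
  rw [eval, h, EReal.toReal_coe]

/-- The functions have to be nonzero: `toReal` sends `⊥` to `0`, so the semiring elements `0` and
`1` have the same real values. -/
theorem ext_eval {f g : RatFun X} (hf : f ≠ 0) (hg : g ≠ 0) (h : ∀ x, f.eval x = g.eval x) :
    f = g :=
  ext_finite fun x hx => by
    have := h ⟨x, hx⟩
    exact (coe_eval hf ⟨x, hx⟩).symm.trans ((congrArg _ this).trans (coe_eval hg ⟨x, hx⟩))

theorem eval_add {f g : RatFun X} (hf : f ≠ 0) (hg : g ≠ 0) (x : FinitePoint X) :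
    (f + g).eval x = max (f.eval x) (g.eval x) := by
  apply eval_eq
  rw [add_apply, ← coe_eval hf, ← coe_eval hg]
  exact (EReal.coe_strictMono.monotone.map_max).symm

theorem eval_mul {f g : RatFun X} (hf : f ≠ 0) (hg : g ≠ 0) (x : FinitePoint X) :
    (f * g).eval x = f.eval x + g.eval x := by
  apply eval_eq
  rw [mul_apply _ _ x.2, ← coe_eval hf, ← coe_eval hg, EReal.coe_add]

theorem eval_one (x : FinitePoint X) : (1 : RatFun X).eval x = 0 := by
  apply eval_eq
  rw [one_apply, EReal.coe_zero]

theorem ne_zero_of_apply {f : RatFun X} {x : X} (h : f x ≠ ⊥) : f ≠ 0 := by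
  rintro rfl
  exact h (zero_apply x)

theorem continuous_eval_pt {f : RatFun X} (hf : f ≠ 0) (M : TropicalModel X)
    (e : M.G.graph.edgeSet) : Continuous fun u => f.eval (M.pt e u) := by
  refine continuous_iff_continuousAt.2 fun u => ?_
  have h1 := (isRational_of_ne_zero hf).1 _ (M.pt e u).2
  exact (EReal.tendsto_toReal h1.2 h1.1).comp
    (f.continuous_toFun.comp (M.continuous_coe_pt e)).continuousAt

/-- At a point of an edge a rational function is affine with integer slope in either direction. -/
theorem exists_germ {f : RatFun X} (hf : f ≠ 0) (M : TropicalModel X) (e : M.G.graph.edgeSet)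
    {v σ δ : ℝ} (hσ : σ = 1 ∨ σ = -1) (hδ : 0 < δ)
    (hdom : ∀ w ∈ Icc 0 δ, v + σ * w ∈ M.dom e) :
    ∃ m : ℤ, ∃ ε, 0 < ε ∧ ε ≤ δ ∧ ∀ w ∈ Icc 0 ε,
      f.eval (M.pt e (v + σ * w)) = f.eval (M.pt e v) + m * w := by
  obtain ⟨ι, _, I, m, c, h1, h2, h3⟩ := (isRational_of_ne_zero hf).2 M e
  obtain ⟨k, hk⟩ : ∃ k : ℤ, σ = k := by
    rcases hσ with rfl | rfl
    · exact ⟨1, by simp⟩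
    · exact ⟨-1, by simp⟩
  have key := exists_affine_germ (J := fun i => {w | v + σ * w ∈ I i})
    (m := fun i => m i * k) (c := fun i => m i * v + c i)
    (h := fun w => f.eval (M.pt e (v + σ * w))) hδ
  have hord : ∀ i, {w | v + σ * w ∈ I i}.OrdConnected := by
    intro i
    have := (h1 i).out
    refine ⟨fun a ha b hb w hw => ?_⟩
    rcases hσ with rfl | rfl
    · exact this ha hb ⟨by linarith [hw.1], by linarith [hw.2]⟩
    · exact this hb ha ⟨by linarith [hw.2], by linarith [hw.1]⟩
  have hcov : ∀ w ∈ Ioc 0 δ, ∃ i, w ∈ {w | v + σ * w ∈ I i} := by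
    intro w hw
    have hd := hdom w ⟨hw.1.le, hw.2⟩
    obtain ⟨i, hi⟩ := h2 ⟨_, TropicalModel.ofReal_mem hd⟩ ENNReal.ofReal_ne_top
    refine ⟨i, ?_⟩
    simpa only [mem_ofPred_eq, ENNReal.toReal_ofReal hd.1] using hi
  have haff : ∀ i, ∀ w ∈ Ioc 0 δ, w ∈ {w | v + σ * w ∈ I i} →
      f.eval (M.pt e (v + σ * w)) = m i * k * w + (m i * v + c i) := by
    intro i w hw hi
    have hd := hdom w ⟨hw.1.le, hw.2⟩
    have h4 := h3 i ⟨_, TropicalModel.ofReal_mem hd⟩ ENNReal.ofReal_ne_top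
      (by simpa only [mem_ofPred_eq, ENNReal.toReal_ofReal hd.1] using hi)
    simp only [Function.comp_apply, ENNReal.toReal_ofReal hd.1, ← TropicalModel.coe_pt hd] at h4
    rw [eval_eq h4, hk]
    ring
  have hcont : Continuous fun w => f.eval (M.pt e (v + σ * w)) :=
    (continuous_eval_pt hf M e).comp (by fun_prop)
  obtain ⟨i, ε, hε, hεδ, h⟩ := key hord hcov haff
    ((hcont.tendsto 0).mono_left nhdsWithin_le_nhds)
  refine ⟨m i * k, ε, hε, hεδ, fun w hw => ?_⟩
  simpa using h w hw

/-- The real constant functions. -/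
noncomputable def realConst (X : Type*) [TopologicalSpace X] [EDist X] (c : ℝ) : RatFun X :=
  const X ⟨(c : WithBot ℝ)⟩

theorem realConst_apply (c : ℝ) (x : X) : realConst X c x = c := rfl

theorem eval_realConst (c : ℝ) (x : FinitePoint X) : (realConst X c).eval x = c :=
  eval_eq (realConst_apply c _)

theorem realConst_add (a b : ℝ) : realConst X (a + b) = realConst X a * realConst X b :=
  ext_finite fun x hx => by
    rw [mul_apply _ _ hx, realConst_apply, realConst_apply, realConst_apply, EReal.coe_add]

theorem realConst_zero : realConst X 0 = 1 := rfl

theorem realConst_nsmul (n : ℕ) (a : ℝ) : realConst X (n * a) = realConst X a ^ n := by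
  induction n with
  | zero => simp [realConst_zero]
  | succ n ih => rw [pow_succ, ← ih, ← realConst_add]; congr 1; push_cast; ring

theorem realConst_max (a b : ℝ) : realConst X (max a b) = realConst X a + realConst X b :=
  ext_finite fun x hx => by
    rw [add_apply, realConst_apply, realConst_apply, realConst_apply]
    exact EReal.coe_strictMono.monotone.map_max

variable [TropicalCurve X]

theorem ne_zero_of_eval {f : RatFun X} (h : ∀ x : FinitePoint X, f x ≠ ⊥) : f ≠ 0 :=
  ne_zero_of_apply (h (Classical.arbitrary _))

theorem realConst_ne_zero (c : ℝ) : realConst X c ≠ 0 :=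
  ne_zero_of_eval fun _ => EReal.coe_ne_bot c

theorem realConst_injective : Function.Injective (realConst X) := fun a b h => by
  rw [← eval_realConst a (Classical.arbitrary (FinitePoint X)), h, eval_realConst]

theorem mul_ne_zero' {f g : RatFun X} (hf : f ≠ 0) (hg : g ≠ 0) : f * g ≠ 0 :=
  ne_zero_of_eval fun x => by
    rw [mul_apply _ _ x.2, ← coe_eval hf, ← coe_eval hg, ← EReal.coe_add]
    exact EReal.coe_ne_bot _

theorem one_ne_zero' : (1 : RatFun X) ≠ 0 := realConst_ne_zero 0

theorem eval_pow {f : RatFun X} (hf : f ≠ 0) (n : ℕ) (x : FinitePoint X) :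
    f ^ n ≠ 0 ∧ (f ^ n).eval x = n * f.eval x := by
  induction n with
  | zero => simp [eval_one, one_ne_zero']
  | succ n ih =>
    rw [pow_succ]
    refine ⟨mul_ne_zero' ih.1 hf, ?_⟩
    rw [eval_mul ih.1 hf, ih.2]
    push_cast
    ring

/-- Infinitely divisible rational functions are constant. -/
theorem exists_eq_realConst {f : RatFun X} (hf : f ≠ 0) (h : ∀ n : ℕ, n ≠ 0 → ∃ g, g ^ n = f) :
    ∃ c, f = realConst X c := by
  obtain ⟨M⟩ := TropicalCurve.exists_model (X := X)
  have hedge : ∀ e, ∀ u ∈ M.dom e, ∀ v ∈ M.dom e, u ≤ v →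
      f.eval (M.pt e v) = f.eval (M.pt e u) := by
    intro e u hu v hv huv
    -- A continuous function whose right derivative vanishes everywhere is constant, so it suffices
    -- that all germs to the right have slope zero.
    refine constant_of_has_deriv_right_zero (continuous_eval_pt hf M e).continuousOn
      (fun w hw => ?_) v ⟨huv, le_rfl⟩
    have hdom : ∀ z ∈ Icc 0 (v - w), w + 1 * z ∈ M.dom e := fun z hz =>
      TropicalModel.mem_dom_of_le hv (by linarith [hu.1, hw.1, hz.1]) (by linarith [hz.2])
    have hvw : 0 < v - w := sub_pos.2 hw.2
    obtain ⟨m, ε, hε, -, hm⟩ := exists_germ hf M e (Or.inl rfl) hvw hdom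
    have hm0 : m = 0 := by
      -- With a root of order `|m| + 1` this number divides the slope `m`. It exceeds `|m|`, so `m =
      -- 0`.
      obtain ⟨g, rfl⟩ := h (m.natAbs + 1) (Nat.succ_ne_zero _)
      have hg : g ≠ 0 := by
        rintro rfl
        exact hf (zero_pow (Nat.succ_ne_zero _))
      obtain ⟨k, ε', hε', -, hk⟩ := exists_germ hg M e (Or.inl rfl) hvw hdom
      have hmin : 0 < min ε ε' := lt_min hε hε'
      have h1 := hm (min ε ε') ⟨hmin.le, min_le_left _ _⟩
      have h2 := hk (min ε ε') ⟨hmin.le, min_le_right _ _⟩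
      rw [(eval_pow hg _ _).2, (eval_pow hg _ _).2, h2, mul_add, add_right_inj, ← mul_assoc] at h1
      have h3 := mul_right_cancel₀ hmin.ne' h1
      have h4 : ((m.natAbs + 1 : ℕ) : ℤ) * k = m := by
        apply Int.cast_injective (α := ℝ)
        rw [Int.cast_mul, Int.cast_natCast]
        exact h3
      by_contra hm0
      have hk0 : k ≠ 0 := by rintro rfl; exact hm0 (by simpa using h4.symm)
      have h5 := congrArg Int.natAbs h4
      rw [Int.natAbs_mul, Int.natAbs_natCast] at h5
      have : 0 < k.natAbs := Int.natAbs_pos.2 hk0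
      have := Nat.le_mul_of_pos_right (m.natAbs + 1) this
      omega
    subst hm0
    refine (hasDerivWithinAt_const w (Ici w) (f.eval (M.pt e w))).congr_of_eventuallyEq ?_ rfl
    filter_upwards [Icc_mem_nhdsGE (show w < w + ε by linarith)] with z hz
    have := hm (z - w) ⟨by linarith [hz.1], by linarith [hz.2]⟩
    simpa using this
  have hconst : ∀ x y : FinitePoint X, f.eval x = f.eval y := by
    intro x y
    -- Constancy spreads from the edges to the curve: every multiple of `|f x - f y|` is a
    -- pseudometric that vanishes on edges, so it is bounded by the distance.
    have key : ∀ n : ℕ, n * |f.eval x - f.eval y| ≤ dist x y := fun n =>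
      M.le_dist_of_edge (D := fun x y => n * |f.eval x - f.eval y|) (fun x => by simp)
        (fun x y z => by
          rw [← mul_add]
          exact mul_le_mul_of_nonneg_left (abs_sub_le _ _ _) n.cast_nonneg)
        (fun e u hu v hv => by
          rcases le_total u v with h | h
          · simp [hedge e u hu v hv h]
          · simp [hedge e v hv u hu h]) x y
    by_contra hne
    have hpos : 0 < |f.eval x - f.eval y| := abs_pos.2 (sub_ne_zero.2 hne)
    obtain ⟨n, hn⟩ := exists_nat_gt (dist x y / |f.eval x - f.eval y|)
    rw [div_lt_iff₀ hpos] at hn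
    linarith [key n]
  refine ⟨f.eval (Classical.arbitrary _), ext_eval hf (realConst_ne_zero _) fun x => ?_⟩
  rw [eval_realConst]
  exact hconst _ _

/-- A semiring automorphism scales the constants. -/
theorem exists_scale (ψ : RatFun X ≃+* RatFun X) :
    ∃ r : ℝ, 0 < r ∧ ∀ c, ψ (realConst X c) = realConst X (r * c) := by
  have hne : ∀ f, f ≠ 0 → ψ f ≠ 0 := fun f hf => (map_ne_zero_iff ψ ψ.injective).2 hf
  -- A real constant has roots of every order, and an automorphism preserves this property.
  have h1 : ∀ c, ∃ c', ψ (realConst X c) = realConst X c' := by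
    intro c
    refine exists_eq_realConst (hne _ (realConst_ne_zero c)) fun n hn =>
      ⟨ψ (realConst X (c / n)), ?_⟩
    rw [← map_pow, ← realConst_nsmul]
    have : (n : ℝ) ≠ 0 := Nat.cast_ne_zero.2 hn
    congr 2
    field_simp
  choose ρ hρ using h1
  have hadd : ∀ a b, ρ (a + b) = ρ a + ρ b := fun a b => realConst_injective <| by
    rw [← hρ, realConst_add, map_mul, hρ, hρ, realConst_add]
  -- The order of the constants is visible in the semiring, since `⊕` is the maximum.
  have hmono : Monotone ρ := fun a b hab => by
    have : ρ (max a b) = max (ρ a) (ρ b) := realConst_injective <| by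
      rw [← hρ, realConst_max, map_add, hρ, hρ, realConst_max]
    rw [max_eq_right hab] at this
    exact this ▸ le_max_left _ _
  have hlin := eq_mul_of_monotone_add hadd hmono
  have h0 : ρ 0 = 0 := by simpa using hlin 0
  refine ⟨ρ 1, ?_, fun c => by rw [hρ, hlin c]⟩
  refine lt_of_le_of_ne (h0 ▸ hmono zero_le_one) fun h => ?_
  have h2 : ψ (realConst X 1) = ψ (realConst X 0) := by rw [hρ, hρ, h0, ← h]
  exact zero_ne_one (realConst_injective (ψ.injective h2)).symm

end RatFun

/-! ### Neighbourhoods of a finite point -/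

namespace TropicalModel

variable {X : Type*} [TopologicalSpace X] [EDist X] [TropicalCurve X] (M : TropicalModel X)

/-- Points near `x₀` lie on edges through `x₀`. -/
theorem exists_edge_of_dist_lt (x₀ : FinitePoint X) {ε : ℝ} (hε : 0 < ε) :
    ∃ η, 0 < η ∧ ∀ x, x ≠ x₀ → dist x x₀ < η →
      ∃ e, ∃ u ∈ M.dom e, ∃ s ∈ M.dom e, M.pt e u = x ∧ M.pt e s = x₀ ∧ |u - s| < ε := by
  -- `c` is a radius within which no end of an edge lies, except ends equal to `x₀`. For an
  -- unbounded edge `toReal` turns the length into `0`, so the second clause only repeats the first.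
  obtain ⟨c, hc, hc'⟩ : ∃ c, 0 < c ∧ ∀ e, (M.pt e 0 ≠ x₀ → c ≤ dist (M.pt e 0) x₀) ∧
      (M.pt e (M.G.length e).toReal ≠ x₀ → c ≤ dist (M.pt e (M.G.length e).toReal) x₀) := by
    have h1 : ∀ (g : M.G.graph.edgeSet → FinitePoint X), ∃ c, 0 < c ∧ ∀ e, g e ≠ x₀ →
        c ≤ dist (g e) x₀ := by
      intro g
      rcases isEmpty_or_nonempty M.G.graph.edgeSet with h | h
      · exact ⟨1, one_pos, fun e => h.elim e⟩
      · classical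
        obtain ⟨e₀, he₀⟩ := Finite.exists_min fun e =>
          if g e = x₀ then (1 : ℝ) else min 1 (dist (g e) x₀)
        refine ⟨_, ?_, fun e he => (he₀ e).trans ?_⟩
        · split_ifs with h
          · exact one_pos
          · exact lt_min one_pos (dist_pos.2 h)
        · rw [if_neg he]
          exact min_le_right _ _
    obtain ⟨c₁, hc1, h1'⟩ := h1 fun e => M.pt e 0
    obtain ⟨c₂, h2, h2'⟩ := h1 fun e => M.pt e (M.G.length e).toReal
    exact ⟨min c₁ c₂, lt_min hc1 h2, fun e => ⟨fun h => (min_le_left _ _).trans (h1' e h),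
      fun h => (min_le_right _ _).trans (h2' e h)⟩⟩
  refine ⟨min ε c, lt_min hε hc, fun x hx hd => ?_⟩
  obtain ⟨e, u, hu, rfl⟩ := M.exists_pt_of_ne hx
  have hdε := hd.trans_le (min_le_left _ _)
  have hdc := hd.trans_le (min_le_right _ _)
  rcases M.dist_pt_exit hu x₀ with ⟨s, hs, h1, h2⟩ | h | ⟨he, h⟩
  · exact ⟨e, u, hu, s, hs, rfl, h1, h2.trans_lt hdε⟩
  · have h0 : M.pt e 0 = x₀ := by
      by_contra h0
      linarith [(hc' e).1 h0, hu.1]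
    refine ⟨e, u, hu, 0, M.zero_mem_dom e, rfl, h0, ?_⟩
    rw [sub_zero, abs_of_nonneg hu.1]
    linarith [dist_nonneg (x := M.pt e 0) (y := x₀)]
  · have hle := M.le_length hu he
    have h0 : M.pt e (M.G.length e).toReal = x₀ := by
      by_contra h0
      linarith [(hc' e).2 h0]
    refine ⟨e, u, hu, _, M.length_mem_dom e he, rfl, h0, ?_⟩
    rw [abs_sub_comm, abs_of_nonneg (sub_nonneg.2 hle)]
    linarith [dist_nonneg (x := M.pt e (M.G.length e).toReal) (y := x₀)]

end TropicalModel

/-! ### Semiring automorphisms are homotheties of the finite points -/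

namespace RatFun

variable {X : Type*} [TopologicalSpace X] [EDist X]

theorem map_ne_zero' (ψ : RatFun X ≃+* RatFun X) {f : RatFun X} (hf : f ≠ 0) : ψ f ≠ 0 :=
  (map_ne_zero_iff ψ ψ.injective).2 hf

/-- The reciprocal of a rational function. -/
theorem exists_mul_eq_one {f : RatFun X} (hf : f ≠ 0) :
    ∃ g : RatFun X, f * g = 1 ∧ ∀ x, g x = -f x := by
  have hg : IsRationalFunction fun x => -f x := by
    rcases f.isRational with h | ⟨h1, h2, h3⟩
    · exact absurd (ext_finite fun x _ => congrFun h x) hf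
    · refine Or.inr ⟨continuous_neg.comp h1, fun x hx => ?_, fun M e =>
        (h3 M e).neg fun t _ => rfl⟩
      have := h2 x hx
      simpa [EReal.neg_eq_bot_iff, EReal.neg_eq_top_iff, and_comm] using this
  refine ⟨⟨_, hg⟩, ext_finite fun x hx => ?_, fun x => rfl⟩
  rw [mul_apply _ _ hx, one_apply, ← coe_eval hf ⟨x, hx⟩]
  change (f.eval ⟨x, hx⟩ : EReal) + -(f x) = 0
  rw [← coe_eval hf ⟨x, hx⟩, ← EReal.coe_neg, ← EReal.coe_add, add_neg_cancel, EReal.coe_zero]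

variable [TropicalCurve X]

/-- A rational function with an isolated zero at `x₀` that is positive around `x₀` grows at least
as fast as the distance from `x₀`. -/
theorem dist_le_eval {f : RatFun X} (hf : f ≠ 0) {x₀ : FinitePoint X} (h0 : f.eval x₀ = 0)
    (hpos : ∀ x, x ≠ x₀ → 0 < f.eval x) :
    ∃ η, 0 < η ∧ ∀ x, dist x x₀ < η → dist x x₀ ≤ f.eval x := by
  obtain ⟨M⟩ := TropicalCurve.exists_model (X := X)
  -- In one direction along one edge the function is affine near `x₀`, and positivity makes its
  -- slope positive.
  have hdir : ∀ e, ∀ s ∈ M.dom e, M.pt e s = x₀ → ∀ σ : ℝ, σ = 1 ∨ σ = -1 →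
      ∃ ε, 0 < ε ∧ ∀ w, 0 < w → w < ε → s + σ * w ∈ M.dom e →
        M.pt e (s + σ * w) ≠ x₀ → w ≤ f.eval (M.pt e (s + σ * w)) := by
    rintro e s hs rfl σ hσ
    by_cases hd : ∃ δ, 0 < δ ∧ s + σ * δ ∈ M.dom e
    · obtain ⟨δ, hδ, hd⟩ := hd
      have hdom : ∀ w ∈ Icc 0 δ, s + σ * w ∈ M.dom e := by
        intro w hw
        rcases hσ with rfl | rfl
        · exact TropicalModel.mem_dom_of_le hd (by linarith [hs.1, hw.1]) (by linarith [hw.2])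
        · exact TropicalModel.mem_dom_of_le hs (by linarith [hd.1, hw.2]) (by linarith [hw.1])
      obtain ⟨m, ε, hε, hεδ, h⟩ := exists_germ hf M e hσ hδ hdom
      refine ⟨ε, hε, fun w hw0 hw _ hne => ?_⟩
      have h1 := h w ⟨hw0.le, hw.le⟩
      have h2 := hpos _ hne
      rw [h1, h0, zero_add] at h2 ⊢
      have hm : (0 : ℝ) < m := by
        by_contra! hm
        exact absurd h2 (not_lt.2 (mul_nonpos_of_nonpos_of_nonneg hm hw0.le))
      -- Integrality of the slopes enters here: a positive slope is at least one.
      have hm1 : (1 : ℝ) ≤ m := by exact_mod_cast hm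
      nlinarith
    · push Not at hd
      exact ⟨1, one_pos, fun w hw0 _ hw _ => absurd hw (hd w hw0)⟩
  obtain ⟨ε, hε, hloc⟩ : ∃ ε, 0 < ε ∧ ∀ e, ∀ s ∈ M.dom e, M.pt e s = x₀ → ∀ u ∈ M.dom e,
      |u - s| < ε → M.pt e u ≠ x₀ → |u - s| ≤ f.eval (M.pt e u) := by
    -- A common `ε` exists because there are finitely many edges and `x₀` has finitely many
    -- parameters on each.
    have h1 : ∀ e, ∀ᶠ ε in 𝓝[>] (0 : ℝ), ∀ s ∈ {s ∈ M.dom e | M.pt e s = x₀}, ∀ u ∈ M.dom e,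
        |u - s| < ε → M.pt e u ≠ x₀ → |u - s| ≤ f.eval (M.pt e u) := by
      intro e
      rw [(M.finite_preimage_pt e x₀).eventually_all]
      rintro s ⟨hs, hs'⟩
      obtain ⟨ε₁, hε₁, h1⟩ := hdir e s hs hs' 1 (Or.inl rfl)
      obtain ⟨ε₂, hε₂, h2⟩ := hdir e s hs hs' (-1) (Or.inr rfl)
      filter_upwards [Ioo_mem_nhdsGT (lt_min hε₁ hε₂)] with ε hε u hu hus hne
      have hε' := hus.trans hε.2
      rcases lt_trichotomy u s with h | h | h
      · rw [abs_of_neg (sub_neg.2 h)] at hε' ⊢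
        have := h2 (-(u - s)) (by linarith) (hε'.trans_le (min_le_right _ _))
        rw [show s + -1 * -(u - s) = u by ring] at this
        exact this hu hne
      · exact absurd (h ▸ hs') hne
      · rw [abs_of_pos (sub_pos.2 h)] at hε' ⊢
        have := h1 (u - s) (by linarith) (hε'.trans_le (min_le_left _ _))
        rw [show s + 1 * (u - s) = u by ring] at this
        exact this hu hne
    obtain ⟨ε, hε, hε0⟩ := ((eventually_all.2 h1).and self_mem_nhdsWithin).exists
    exact ⟨ε, hε0, fun e s hs hs' => hε e s ⟨hs, hs'⟩⟩
  obtain ⟨η, hη, h⟩ := M.exists_edge_of_dist_lt x₀ hε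
  refine ⟨η, hη, fun x hx => ?_⟩
  by_cases hne : x = x₀
  · rw [hne, dist_self, h0]
  obtain ⟨e, u, hu, s, hs, rfl, rfl, hus⟩ := h x hne hx
  exact (M.dist_pt_le e u s).trans (hloc e s hs rfl u hu hus hne)

theorem distFrom_ne_zero (z : FinitePoint X) : distFrom z ≠ 0 :=
  ne_zero_of_eval fun x => by rw [distFrom_apply]; exact EReal.coe_ne_bot _

theorem eval_distFrom (z x : FinitePoint X) : (distFrom z).eval x = dist z x :=
  eval_eq (distFrom_apply z x)

/-- The curve is covered by its finitely many vertices and the images of the compact intervals `[0,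
l(e)]`. Compactness includes the points at infinity; the argument in `exists_point` therefore has to
treat them as well. -/
theorem compactSpace : CompactSpace X := by
  obtain ⟨M⟩ := TropicalCurve.exists_model (X := X)
  refine ⟨?_⟩
  have h : (univ : Set X) = M.G.graph.vertexSet ∪ ⋃ e, range (M.edge e) := by
    refine (eq_univ_of_forall fun x => ?_).symm
    by_cases hx : x ∈ M.G.graph.vertexSet
    · exact Or.inl hx
    · obtain ⟨e, t, -, -, rfl⟩ := M.exists_of_notMem x hx
      exact Or.inr (mem_iUnion.2 ⟨e, t, rfl⟩)
  have hI : ∀ e, CompactSpace (Set.Iic (M.G.length e)) := fun e =>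
    isCompact_iff_compactSpace.1 (Set.Icc_bot (a := M.G.length e) ▸ isCompact_Icc)
  rw [h]
  exact M.G.finite_vertexSet.isCompact.union
    (isCompact_iUnion fun e => isCompact_range (M.continuous_edge e))

/-- The pointwise order is expressed by the addition: `f ≤ g` means `f ⊕ g = g`. -/
theorem map_mono (ψ : RatFun X ≃+* RatFun X) {f g : RatFun X} (hf : f ≠ 0) (hg : g ≠ 0)
    (h : ∀ x, f.eval x ≤ g.eval x) (x : FinitePoint X) : (ψ f).eval x ≤ (ψ g).eval x := by
  have hfg : f + g = g := by
    have hne : f + g ≠ 0 := ne_zero_of_eval fun y => by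
      rw [add_apply, ← coe_eval hf, ← coe_eval hg, ← EReal.coe_strictMono.monotone.map_max]
      exact EReal.coe_ne_bot _
    exact ext_eval hne hg fun y => by rw [eval_add hf hg, max_eq_right (h y)]
  rw [← hfg, map_add, eval_add (map_ne_zero' ψ hf) (map_ne_zero' ψ hg)]
  exact le_max_left _ _

/-- A semiring automorphism is, up to scaling, the composition with a map of the curve. -/
theorem exists_point (ψ : RatFun X ≃+* RatFun X) {r : ℝ} (hr : 0 < r)
    (hψ : ∀ c, ψ (realConst X c) = realConst X (r * c)) (x : FinitePoint X) :
    ∃ y : FinitePoint X, ∀ f : RatFun X, f ≠ 0 → (ψ f).eval x = r * f.eval y := by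
  -- If no `y` works, then for every `y` of the curve some `g` is positive at `y` although `ψ g`
  -- vanishes at `x`. Finitely many of these sets of positivity cover the curve. The maximum of the
  -- corresponding functions exceeds a positive constant, while its image vanishes at `x`, against
  -- monotonicity.
  by_contra! hn
  have hinv : ∀ {f g : RatFun X}, f ≠ 0 → f * g = 1 → g ≠ 0 ∧ (ψ g).eval x = -(ψ f).eval x := by
    intro f g hf hfg
    have hg : g ≠ 0 := by
      rintro rfl
      rw [mul_zero] at hfg
      exact one_ne_zero' hfg.symm
    have h1 : (ψ f).eval x + (ψ g).eval x = 0 := by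
      rw [← eval_mul (map_ne_zero' ψ hf) (map_ne_zero' ψ hg), ← map_mul, hfg, map_one, eval_one]
    exact ⟨hg, by linarith⟩
  have key : ∀ y : X, ∃ g : RatFun X, g ≠ 0 ∧ (ψ g).eval x = 0 ∧ g y < 0 := by
    intro y
    -- Any `g` that violates the evaluation formula from below will do: subtracting the constant `(ψ
    -- g)(x) / r` makes the image vanish at `x` and the value at `y` negative.
    suffices h : ∃ g : RatFun X, g ≠ 0 ∧ g y < (((ψ g).eval x / r : ℝ) : EReal) by
      obtain ⟨g, hg, hlt⟩ := h
      have hc := realConst_ne_zero (X := X) (-((ψ g).eval x / r))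
      refine ⟨realConst X (-((ψ g).eval x / r)) * g, mul_ne_zero' hc hg, ?_, ?_⟩
      · rw [map_mul, eval_mul (map_ne_zero' ψ hc) (map_ne_zero' ψ hg), hψ, eval_realConst]
        field_simp
        ring
      · by_cases hy : y ∈ pointsAtInfinity X
        · have hcont := (realConst X (-((ψ g).eval x / r)) * g).continuous_toFun
          -- At a point at infinity the product is defined as a limit. Adding a real constant is
          -- continuous on `EReal`, so the pointwise formula persists there.
          have hcont' : Continuous fun z => (((-((ψ g).eval x / r) : ℝ)) : EReal) + g z := by
            refine continuous_iff_continuousAt.2 fun z => ?_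
            exact ContinuousAt.comp (f := fun z => ((((-((ψ g).eval x / r) : ℝ)) : EReal), g z))
              (EReal.continuousAt_add (p := (((-((ψ g).eval x / r) : ℝ) : EReal), g z))
              (Or.inl (EReal.coe_ne_top _)) (Or.inl (EReal.coe_ne_bot _)))
              (continuousAt_const.prodMk g.continuous_toFun.continuousAt)
          have heq := hcont.ext_on (dense_compl_pointsAtInfinity X) hcont' fun z hz => by
            rw [mul_apply _ _ hz, realConst_apply]
          rw [congrFun heq y]
          have := EReal.add_lt_add_left_coe hlt (-((ψ g).eval x / r))
          rwa [← EReal.coe_add, neg_add_cancel, EReal.coe_zero] at this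
        · rw [mul_apply _ _ hy, realConst_apply]
          have := EReal.add_lt_add_left_coe hlt (-((ψ g).eval x / r))
          rwa [← EReal.coe_add, neg_add_cancel, EReal.coe_zero] at this
    by_cases hy : y ∈ pointsAtInfinity X
    -- At a point at infinity the negative of a distance function is `-∞`, which is below any real
    -- number.
    · have hD := distFrom_ne_zero x
      obtain ⟨g, hg, hgx⟩ := exists_mul_eq_one hD
      refine ⟨g, (hinv hD hg).1, ?_⟩
      rw [hgx, distFrom_apply_top x hy, EReal.neg_top]
      exact EReal.bot_lt_coe _
    · obtain ⟨f, hf, hne⟩ := hn ⟨y, hy⟩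
      rcases lt_or_gt_of_ne hne with h | h
      · obtain ⟨g, hg, hgx⟩ := exists_mul_eq_one hf
        refine ⟨g, (hinv hf hg).1, ?_⟩
        rw [(hinv hf hg).2, hgx, ← coe_eval hf ⟨y, hy⟩, ← EReal.coe_neg, EReal.coe_lt_coe_iff,
          lt_div_iff₀ hr]
        linarith
      · refine ⟨f, hf, ?_⟩
        rw [← coe_eval hf ⟨y, hy⟩, EReal.coe_lt_coe_iff, lt_div_iff₀ hr]
        linarith
  have key' : ∀ y : X, ∃ g : RatFun X, g ≠ 0 ∧ (ψ g).eval x = 0 ∧ 0 < g y := by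
    intro y
    obtain ⟨f, hf, hfx, hfy⟩ := key y
    obtain ⟨g, hg, hgx⟩ := exists_mul_eq_one hf
    refine ⟨g, (hinv hf hg).1, by rw [(hinv hf hg).2, hfx, neg_zero], ?_⟩
    rw [hgx, ← neg_zero]
    exact EReal.neg_lt_neg_iff.2 hfy
  choose g hg hgx hgy using key'
  have := compactSpace (X := X)
  obtain ⟨T, hT⟩ := isCompact_univ.elim_finite_subcover (fun y => {z | 0 < g y z})
    (fun y => isOpen_lt continuous_const (g y).continuous_toFun)
    (fun y _ => mem_iUnion.2 ⟨y, hgy y⟩)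
  have hsum : ∀ T : Finset X, T.Nonempty → ∃ h : RatFun X, h ≠ 0 ∧ (ψ h).eval x = 0 ∧
      ∀ y ∈ T, ∀ z, g y z ≤ h z := by
    intro T hT
    induction hT using Finset.Nonempty.cons_induction with
    | singleton a => exact ⟨g a, hg a, hgx a, fun y hy z => by rw [Finset.mem_singleton.1 hy]⟩
    | cons a s ha _ ih =>
      obtain ⟨h, h0, hx, hle⟩ := ih
      have hne : g a + h ≠ 0 := ne_zero_of_eval fun y => by
        rw [add_apply, ← coe_eval (hg a)]
        exact ne_bot_of_le_ne_bot (EReal.coe_ne_bot _) (le_max_left _ _)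
      refine ⟨g a + h, hne, ?_, fun y hy z => ?_⟩
      · rw [map_add, eval_add (map_ne_zero' ψ (hg a)) (map_ne_zero' ψ h0), hgx, hx, max_self]
      · rw [add_apply]
        rcases Finset.mem_cons.1 hy with rfl | hy
        · exact le_max_left _ _
        · exact (hle y hy z).trans (le_max_right _ _)
  have hTne : T.Nonempty := by
    obtain ⟨y, hy, -⟩ := mem_iUnion₂.1 (hT (mem_univ (x : X)))
    exact ⟨y, hy⟩
  obtain ⟨h, h0, hx, hle⟩ := hsum T hTne
  have hpos : ∀ z, 0 < h z := fun z => by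
    obtain ⟨y, hy, hz⟩ := mem_iUnion₂.1 (hT (mem_univ z))
    exact hz.trans_le (hle y hy z)
  -- By compactness `h` attains a positive minimum, possibly `∞`, and thus dominates a positive real
  -- constant `ε`. Its image at `x` would be at least `r * ε`.
  obtain ⟨z₀, -, hz₀⟩ := isCompact_univ.exists_isMinOn ⟨(x : X), mem_univ _⟩
    h.continuous_toFun.continuousOn
  obtain ⟨ε, hε, hε'⟩ := EReal.lt_iff_exists_real_btwn.1 (hpos z₀)
  have hmono := map_mono ψ (realConst_ne_zero ε) h0 (fun y => by
    rw [eval_realConst, ← EReal.coe_le_coe_iff, coe_eval h0]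
    exact hε'.le.trans (hz₀ (mem_univ _))) x
  rw [hψ, eval_realConst, hx] at hmono
  exact absurd hmono (not_le.2 (mul_pos hr (EReal.coe_pos.1 hε)))

/-- A semiring automorphism is, up to scaling, the composition with a bijection of the finite
points. -/
theorem exists_equiv (ψ : RatFun X ≃+* RatFun X) :
    ∃ r : ℝ, 0 < r ∧ (∀ c, ψ (realConst X c) = realConst X (r * c)) ∧
      ∃ φ : FinitePoint X ≃ FinitePoint X, (∀ f, f ≠ 0 → ∀ x, (ψ f).eval x = r * f.eval (φ x)) ∧
        ∀ f, f ≠ 0 → ∀ x, (ψ.symm f).eval x = r⁻¹ * f.eval (φ.symm x) := by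
  obtain ⟨r, hr, hψ⟩ := exists_scale ψ
  have hψ' : ∀ c, ψ.symm (realConst X c) = realConst X (r⁻¹ * c) := fun c => by
    rw [RingEquiv.symm_apply_eq, hψ, mul_inv_cancel_left₀ hr.ne']
  choose φ hφ using exists_point ψ hr hψ
  choose φ' hφ' using exists_point ψ.symm (inv_pos.2 hr) hψ'
  -- Distance functions separate points: `dist x` vanishes at `x` only, so evaluating it at `φ' (φ
  -- x)` identifies this point.
  have h1 : ∀ x, φ' (φ x) = x := fun x => by
    have h2 := hφ x (ψ.symm (distFrom x)) (map_ne_zero' _ (distFrom_ne_zero x))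
    rw [RingEquiv.apply_symm_apply, hφ' _ _ (distFrom_ne_zero x), eval_distFrom, dist_self,
      eval_distFrom, mul_inv_cancel_left₀ hr.ne'] at h2
    exact (dist_eq_zero.1 h2.symm).symm
  have h2 : ∀ x, φ (φ' x) = x := fun x => by
    have h2 := hφ' x (ψ (distFrom x)) (map_ne_zero' _ (distFrom_ne_zero x))
    rw [RingEquiv.symm_apply_apply, hφ _ _ (distFrom_ne_zero x), eval_distFrom, dist_self,
      eval_distFrom, inv_mul_cancel_left₀ hr.ne'] at h2
    exact (dist_eq_zero.1 h2.symm).symm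
  exact ⟨r, hr, hψ, ⟨φ, φ', h1, h2⟩, fun f hf x => hφ x f hf, fun f hf x => hφ' x f hf⟩

/-- If `f ↦ r f ∘ φ` and its inverse preserve rational functions then `φ` does not expand distances
by more than the factor `r⁻¹`. -/
theorem mul_dist_le (ψ : RatFun X ≃+* RatFun X) {r : ℝ} (hr : 0 < r)
    {φ : FinitePoint X ≃ FinitePoint X} (h : ∀ f, f ≠ 0 → ∀ x, (ψ f).eval x = r * f.eval (φ x))
    (h' : ∀ f, f ≠ 0 → ∀ x, (ψ.symm f).eval x = r⁻¹ * f.eval (φ.symm x)) (x y : FinitePoint X) :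
    r * dist (φ x) (φ y) ≤ dist x y := by
  obtain ⟨M⟩ := TropicalCurve.exists_model (X := X)
  -- The preimage of `dist x` under `ψ` vanishes exactly at `φ x`. By `dist_le_eval` it grows near
  -- this point at least as fast as the distance.
  have hloc : ∀ x : FinitePoint X, ∃ η, 0 < η ∧ ∀ y, dist (φ x) (φ y) < η →
      r * dist (φ x) (φ y) ≤ dist x y := by
    intro x
    have hD := distFrom_ne_zero x
    have heval : ∀ y, (ψ.symm (distFrom x)).eval y = r⁻¹ * dist x (φ.symm y) := fun y => by
      rw [h' _ hD, eval_distFrom]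
    obtain ⟨η, hη, h1⟩ := dist_le_eval (map_ne_zero' ψ.symm hD) (x₀ := φ x)
      (by rw [heval, Equiv.symm_apply_apply, dist_self, mul_zero])
      (fun y hy => by
        rw [heval]
        refine mul_pos (inv_pos.2 hr) (dist_pos.2 fun h => hy ?_)
        rw [h, Equiv.apply_symm_apply])
    refine ⟨η, hη, fun y hy => ?_⟩
    have h2 := h1 (φ y) (by rwa [dist_comm])
    rw [heval, Equiv.symm_apply_apply, dist_comm] at h2
    rw [inv_mul_eq_div, le_div_iff₀ hr] at h2
    linarith
  have hcont : ∀ (z : FinitePoint X) e, Continuous fun u => r * dist (φ z) (φ (M.pt e u)) := by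
    intro z e
    have h1 := continuous_eval_pt (map_ne_zero' ψ (distFrom_ne_zero (φ z))) M e
    simpa only [h _ (distFrom_ne_zero _), eval_distFrom] using h1
  refine M.le_dist_of_edge (D := fun x y => r * dist (φ x) (φ y)) (fun x => by simp)
    (fun x y z => by
      rw [← mul_add]
      exact mul_le_mul_of_nonneg_left (dist_triangle _ _ _) hr.le) (fun e u hu v hv => ?_) x y
  -- Local to global along an edge: the parameters that satisfy the bound form a closed set, and the
  -- local bound together with the triangle inequality extends it to the right of each of them.
  have hseg : ∀ a b, a ≤ b → r * dist (φ (M.pt e a)) (φ (M.pt e b)) ≤ b - a := by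
    intro a b hab
    have hcl : IsClosed {w | r * dist (φ (M.pt e a)) (φ (M.pt e w)) ≤ w - a} :=
      isClosed_le (hcont _ e) (by fun_prop)
    have hsub := (hcl.inter isClosed_Icc).Icc_subset_of_forall_exists_gt (a := a) (b := b)
      (by simp [mem_ofPred_eq]) (fun w hw z hz => ?_)
    · exact hsub ⟨hab, le_rfl⟩
    · obtain ⟨η, hη, h1⟩ := hloc (M.pt e w)
      have h2 : ∀ᶠ z in 𝓝[>] w, r * dist (φ (M.pt e w)) (φ (M.pt e z)) < r * η := by
        refine nhdsWithin_le_nhds ((hcont (M.pt e w) e).continuousAt.eventually_lt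
          continuousAt_const ?_)
        simpa using mul_pos hr hη
      obtain ⟨z', h3, h4⟩ := (h2.and (Ioc_mem_nhdsGT hz)).exists
      refine ⟨z', ?_, h4⟩
      have h5 := h1 _ (lt_of_mul_lt_mul_left h3 hr.le)
      have h6 := M.dist_pt_le e w z'
      rw [abs_sub_comm, abs_of_pos (sub_pos.2 h4.1)] at h6
      have h7 : r * dist (φ (M.pt e a)) (φ (M.pt e w)) ≤ w - a := hw.1
      have h8 := mul_le_mul_of_nonneg_left
        (dist_triangle (φ (M.pt e a)) (φ (M.pt e w)) (φ (M.pt e z'))) hr.le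
      change r * dist (φ (M.pt e a)) (φ (M.pt e z')) ≤ z' - a
      linarith
  rcases le_total u v with huv | huv
  · rw [abs_sub_comm, abs_of_nonneg (sub_nonneg.2 huv)]
    exact hseg u v huv
  · rw [abs_of_nonneg (sub_nonneg.2 huv)]
    change r * dist _ _ ≤ _
    rw [dist_comm]
    exact hseg v u huv

/-- The opposite inequality is `mul_dist_le` for the inverse automorphism, whose factor is `r⁻¹`. -/
theorem mul_dist_eq (ψ : RatFun X ≃+* RatFun X) {r : ℝ} (hr : 0 < r)
    {φ : FinitePoint X ≃ FinitePoint X} (h : ∀ f, f ≠ 0 → ∀ x, (ψ f).eval x = r * f.eval (φ x))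
    (h' : ∀ f, f ≠ 0 → ∀ x, (ψ.symm f).eval x = r⁻¹ * f.eval (φ.symm x)) (x y : FinitePoint X) :
    r * dist (φ x) (φ y) = dist x y := by
  refine le_antisymm (mul_dist_le ψ hr h h' x y) ?_
  have h1 := mul_dist_le ψ.symm (inv_pos.2 hr) (φ := φ.symm) h' (fun f hf x => by
    simpa using h f hf x) (φ x) (φ y)
  rw [Equiv.symm_apply_apply, Equiv.symm_apply_apply, inv_mul_eq_div, div_le_iff₀ hr] at h1
  linarith

/-- If some semiring automorphism moves a constant then the finite points admit a bijection that
multiplies distances by a constant factor greater than one. -/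
theorem exists_expanding (ψ : RatFun X ≃+* RatFun X) {c : ℝ}
    (hc : ψ (realConst X c) ≠ realConst X c) :
    ∃ k : ℝ, 1 < k ∧ ∃ φ : Equiv.Perm (FinitePoint X), ∀ x y, dist (φ x) (φ y) = k * dist x y := by
  obtain ⟨r, hr, hψ, φ, h, h'⟩ := exists_equiv ψ
  have hd := mul_dist_eq ψ hr h h'
  have hr1 : r ≠ 1 := by
    rintro rfl
    exact hc (by rw [hψ, one_mul])
  rcases lt_or_gt_of_ne hr1 with h1 | h1
  · refine ⟨r⁻¹, (one_lt_inv₀ hr).2 h1, φ, fun x y => ?_⟩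
    rw [← hd x y, inv_mul_cancel_left₀ hr.ne']
  · refine ⟨r, h1, φ.symm, fun x y => ?_⟩
    rw [← hd (φ.symm x), Equiv.apply_symm_apply, Equiv.apply_symm_apply]

end RatFun

/-! ### Expanding homotheties and rays -/

/-- A metric space with an expanding homothety that looks like a union of rays far away from the
fixed point is a union of rays. -/
theorem exists_rays_of_expanding {Y I : Type*} [MetricSpace Y] {Φ : Equiv.Perm Y} {k : ℝ}
    (hk : 1 < k) (hΦ : ∀ x y, dist (Φ x) (Φ y) = k * dist x y) {p : Y} (hp : Φ p = p)
    {ray : I → ℝ → Y} {T C : ℝ} (hT : 0 < T) (hCT : C < T)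
    (hsurj : ∀ x, T ≤ dist x p → ∃ i, ray i (dist x p) = x)
    (hray : ∀ i, ∀ u ≥ T, ∀ v ≥ T, dist (ray i u) (ray i v) = |u - v|)
    (hdist : ∀ i, ∀ u ≥ T, dist (ray i u) p = u)
    (hne : ∀ i j, i ≠ j → ∀ u ≥ T, ∀ v ≥ T, u + v ≤ dist (ray i u) (ray j v) + C) :
    ∃ γ : I → ℝ → Y, (∀ i, γ i 0 = p) ∧ (∀ i, ∀ t ≥ 0, dist (γ i t) p = t) ∧
      (∀ i, ∀ s ≥ 0, ∀ t ≥ 0, dist (γ i s) (γ i t) = |s - t|) ∧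
      (∀ i j, i ≠ j → ∀ s ≥ 0, ∀ t ≥ 0, dist (γ i s) (γ j t) = s + t) ∧
      (∀ x, x ≠ p → ∃ i, γ i (dist x p) = x) ∧ ∀ i, ∀ t ≥ T, γ i t = ray i t := by
  have hk0 : 0 < k := by linarith
  have hpow : ∀ (n : ℕ) x y, dist ((Φ ^ n) x) ((Φ ^ n) y) = k ^ n * dist x y := by
    intro n x y
    induction n with
    | zero => simp
    | succ n ih => rw [pow_succ', Equiv.Perm.mul_apply, Equiv.Perm.mul_apply, hΦ, ih]; ring
  have hpp : ∀ n : ℕ, (Φ ^ n) p = p := by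
    intro n
    induction n with
    | zero => simp
    | succ n ih => rw [pow_succ', Equiv.Perm.mul_apply, ih, hp]
  have hpowp : ∀ (n : ℕ) x, dist ((Φ ^ n) x) p = k ^ n * dist x p := fun n x => by
    rw [← hpow, hpp]
  have hlarge : ∀ a : ℝ, 0 < a → ∀ B, ∀ᶠ n : ℕ in atTop, B ≤ k ^ n * a := fun a ha B =>
    ((tendsto_pow_atTop_atTop_of_one_lt hk).atTop_mul_const ha).eventually_ge_atTop B
  -- `x` and `y` lie on a common ray from `p`
  let Rel : Y → Y → Prop := fun x y => dist x y = |dist x p - dist y p|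
  have hRel : ∀ (n : ℕ) x y, Rel ((Φ ^ n) x) ((Φ ^ n) y) ↔ Rel x y := by
    intro n x y
    have hkn : 0 < k ^ n := pow_pos hk0 n
    change dist _ _ = |dist _ _ - dist _ _| ↔ dist _ _ = |dist _ _ - dist _ _|
    rw [hpow, hpowp, hpowp, ← mul_sub, abs_mul, abs_of_pos hkn]
    exact mul_right_inj' hkn.ne'
  have hRel_ray : ∀ i, ∀ u ≥ T, ∀ v ≥ T, Rel (ray i u) (ray i v) := by
    intro i u hu v hv
    change dist _ _ = |dist _ _ - dist _ _|
    rw [hray i u hu v hv, hdist i u hu, hdist i v hv]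
  have heq_of_Rel : ∀ i j, ∀ u ≥ T, ∀ v ≥ T, Rel (ray i u) (ray j v) → i = j := by
    intro i j u hu v hv h
    -- On different rays, `Rel` would give `u + v ≤ |u - v| + C`, so twice the smaller parameter is
    -- at most `C`. But both parameters are at least `T`, which is positive and exceeds `C`.
    by_contra hij
    have h1 := hne i j hij u hu v hv
    change dist _ _ = |dist _ _ - dist _ _| at h
    rw [h, hdist i u hu, hdist j v hv] at h1
    rcases abs_cases (u - v) with h2 | h2 <;> linarith
  have hRel_symm : ∀ x y, Rel x y → Rel y x := by
    intro x y h
    change dist _ _ = |dist _ _ - dist _ _|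
    rw [dist_comm, abs_sub_comm]
    exact h
  have hRel_trans : ∀ x y z, x ≠ p → y ≠ p → z ≠ p → Rel x y → Rel y z → Rel x z := by
    intro x y z hx hy hz hxy hyz
    -- A power of `Φ` moves the three points beyond radius `T`, where `Rel` means lying on the same
    -- given ray. `Rel` is invariant under `Φ`, so nothing is lost.
    obtain ⟨n, ⟨h1, h2⟩, h3⟩ := (((hlarge _ (dist_pos.2 hx) T).and
      (hlarge _ (dist_pos.2 hy) T)).and (hlarge _ (dist_pos.2 hz) T)).exists
    rw [← hpowp] at h1 h2 h3
    obtain ⟨i, hi⟩ := hsurj _ h1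
    obtain ⟨j, hj⟩ := hsurj _ h2
    obtain ⟨l, hl⟩ := hsurj _ h3
    have e1 := (hRel n x y).2 hxy
    have e2 := (hRel n y z).2 hyz
    rw [← hi, ← hj] at e1
    rw [← hj, ← hl] at e2
    obtain rfl := heq_of_Rel _ _ _ h1 _ h2 e1
    obtain rfl := heq_of_Rel _ _ _ h2 _ h3 e2
    rw [← hRel n, ← hi, ← hl]
    exact hRel_ray _ _ h1 _ h3
  have hdich : ∀ x y, x ≠ p → y ≠ p → ¬ Rel x y → dist x y = dist x p + dist y p := by
    intro x y hx hy hxy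
    refine le_antisymm (dist_triangle_right x y p) ?_
    by_contra! hlt
    -- A positive defect in the triangle inequality through `p` is multiplied by `k ^ n` and would
    -- exceed the bounded error `C` allowed between different rays.
    obtain ⟨n, ⟨h1, h2⟩, h3⟩ := (((hlarge _ (dist_pos.2 hx) T).and
      (hlarge _ (dist_pos.2 hy) T)).and (hlarge _ (sub_pos.2 hlt) (C + 1))).exists
    rw [← hpowp] at h1 h2
    obtain ⟨i, hi⟩ := hsurj _ h1
    obtain ⟨j, hj⟩ := hsurj _ h2
    have hij : i ≠ j := by
      rintro rfl
      exact hxy ((hRel n x y).1 (hi ▸ hj ▸ hRel_ray _ _ h1 _ h2))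
    have h4 := hne i j hij _ h1 _ h2
    rw [hi, hj, hpow, hpowp, hpowp] at h4
    linarith
  have hunique : ∀ x y, Rel x y → dist x p = dist y p → x = y := by
    intro x y h1 h2
    change dist _ _ = |dist _ _ - dist _ _| at h1
    rw [h2, sub_self, abs_zero] at h1
    exact dist_eq_zero.1 h1
  have hexists : ∀ x, x ≠ p → ∀ t > 0, ∃ y, dist y p = t ∧ Rel x y := by
    intro x hx t ht
    obtain ⟨n, h1, h2⟩ := ((hlarge _ (dist_pos.2 hx) T).and (hlarge _ ht T)).exists
    rw [← hpowp] at h1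
    obtain ⟨i, hi⟩ := hsurj _ h1
    obtain ⟨y, hy⟩ := (Φ ^ n).surjective (ray i (k ^ n * t))
    refine ⟨y, ?_, ?_⟩
    · have h3 := hpowp n y
      rw [hy, hdist i _ h2] at h3
      exact (mul_left_cancel₀ (pow_pos hk0 n).ne' h3).symm
    · rw [← hRel n, hy, ← hi]
      exact hRel_ray _ _ h1 _ h2
  have hne_p : ∀ x t, 0 < t → dist x p = t → x ≠ p := by
    rintro x t ht h rfl
    rw [dist_self] at h
    exact ht.ne h
  have hray_ne : ∀ i, ∀ u ≥ T, ray i u ≠ p := fun i u hu =>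
    hne_p _ u (hT.trans_le hu) (hdist i u hu)
  -- `γ i t` is the point at distance `t` from `p` in the `Rel`-class of `ray i T`; negative `t`
  -- receive the default value `p`.
  have hγ : ∀ i t, ∃ y, (0 < t → dist y p = t ∧ Rel (ray i T) y) ∧ (t = 0 → y = p) := by
    intro i t
    rcases lt_trichotomy t 0 with h | h | h
    · exact ⟨p, fun h' => absurd h' h.not_gt, fun h' => absurd h' h.ne⟩
    · exact ⟨p, fun h' => absurd h h'.ne', fun _ => rfl⟩
    · obtain ⟨y, hy⟩ := hexists (ray i T) (hray_ne i T le_rfl) t h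
      exact ⟨y, fun _ => hy, fun h' => absurd h' h.ne'⟩
  choose γ hγ hγ0 using hγ
  have hγp : ∀ i, ∀ t ≥ 0, dist (γ i t) p = t := by
    intro i t ht
    rcases ht.eq_or_lt with rfl | ht
    · rw [hγ0 i 0 rfl, dist_self]
    · exact (hγ i t ht).1
  have hγne : ∀ i, ∀ t > 0, γ i t ≠ p := fun i t ht => hne_p _ t ht (hγp i t (le_of_lt ht))
  have hbase : ∀ i, ray i T ≠ p := fun i => hray_ne i T le_rfl
  refine ⟨γ, fun i => hγ0 i 0 rfl, hγp, fun i s hs t ht => ?_, fun i j hij s hs t ht => ?_,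
    fun x hx => ?_, fun i t ht => ?_⟩
  · rcases hs.eq_or_lt with rfl | hs'
    · rw [hγ0 i 0 rfl, dist_comm, hγp i t ht, zero_sub, abs_neg, abs_of_nonneg ht]
    rcases ht.eq_or_lt with rfl | ht'
    · rw [hγ0 i 0 rfl, hγp i s hs, sub_zero, abs_of_nonneg hs]
    have := hRel_trans _ _ _ (hγne i s hs') (hbase i) (hγne i t ht')
      (hRel_symm _ _ (hγ i s hs').2) (hγ i t ht').2
    change dist _ _ = |dist _ _ - dist _ _| at this
    rw [this, hγp i s hs, hγp i t ht]
  · rcases hs.eq_or_lt with rfl | hs'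
    · rw [hγ0 i 0 rfl, dist_comm, hγp j t ht, zero_add]
    rcases ht.eq_or_lt with rfl | ht'
    · rw [hγ0 j 0 rfl, hγp i s hs, add_zero]
    rw [hdich _ _ (hγne i s hs') (hγne j t ht') fun h => hij ?_, hγp i s hs, hγp j t ht]
    refine heq_of_Rel i j T le_rfl T le_rfl ?_
    refine hRel_trans _ _ _ (hbase i) (hγne i s hs') (hbase j) (hγ i s hs').2 ?_
    exact hRel_trans _ _ _ (hγne i s hs') (hγne j t ht') (hbase j) h (hRel_symm _ _ (hγ j t ht').2)
  · obtain ⟨y, hy, hxy⟩ := hexists x hx T hT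
    obtain ⟨i, hi⟩ := hsurj y hy.ge
    rw [hy] at hi
    have hd := dist_pos.2 hx
    refine ⟨i, hunique _ _ ?_ (hγp i _ hd.le)⟩
    refine hRel_trans _ _ _ (hγne i _ hd) (hbase i) hx (hRel_symm _ _ (hγ i _ hd).2) ?_
    rw [hi]
    exact hRel_symm _ _ hxy
  · have ht' : 0 < t := hT.trans_le ht
    refine hunique _ _ ?_ ((hγp i t ht'.le).trans (hdist i t ht).symm)
    exact hRel_trans _ _ _ (hγne i t ht') (hbase i) (hray_ne i t ht)
      (hRel_symm _ _ (hγ i t ht').2) (hRel_ray i T le_rfl t ht)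

/-! ### A tropical curve with an expanding homothety -/

namespace TropicalModel

variable {X : Type*} [TopologicalSpace X] [EDist X] (M : TropicalModel X)

theorem exists_uniform_tail (z : FinitePoint X) :
    ∃ u₀, 0 < u₀ ∧ ∀ e, ∀ s ∈ M.dom e, M.pt e s = z → s ≤ u₀ := by
  choose u hu h using fun e => M.exists_tail e z
  obtain ⟨B, hB⟩ := (finite_range u).bddAbove
  exact ⟨max B 1, lt_max_of_lt_right one_pos, fun e s hs hsz =>
    (h e s hs hsz).trans ((hB (mem_range_self e)).trans (le_max_left _ _))⟩

variable [TropicalCurve X]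

/-- Outside of a compact set all finite points lie on the unbounded edges. -/
theorem exists_isCompact (z : FinitePoint X) (B : ℝ) : ∃ K : Set (FinitePoint X), IsCompact K ∧
    ∀ x ∉ K, ∃ e, M.G.length e = ∞ ∧ ∃ u, B < u ∧ 0 ≤ u ∧ M.pt e u = x := by
  refine ⟨{z} ∪ ⋃ e, M.pt e '' Icc 0 (max B (M.G.length e).toReal), isCompact_singleton.union
    (isCompact_iUnion fun e => isCompact_Icc.image (M.continuous_pt e)), fun x hx => ?_⟩
  rw [mem_union, mem_singleton_iff, not_or] at hx
  obtain ⟨e, u, hu, rfl⟩ := M.exists_pt_of_ne hx.1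
  have h1 : max B (M.G.length e).toReal < u := by
    by_contra! h1
    exact hx.2 (mem_iUnion.2 ⟨e, u, ⟨hu.1, h1⟩, rfl⟩)
  refine ⟨e, ?_, u, (le_max_left _ _).trans_lt h1, hu.1, rfl⟩
  by_contra he
  exact absurd (M.le_length hu he) (not_le.2 ((le_max_right _ _).trans_lt h1))

/-- On an unbounded edge the distance grows with slope one, so a ball contains only a bounded piece
of it. Properness supplies the completeness that Banach's fixed point theorem requires. -/
instance : ProperSpace (FinitePoint X) := by
  obtain ⟨M⟩ := TropicalCurve.exists_model (X := X)
  refine ⟨fun z R => ?_⟩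
  obtain ⟨u₀, h0, h⟩ := M.exists_uniform_tail z
  obtain ⟨K, hK, hK'⟩ := M.exists_isCompact z (u₀ + max R 0)
  refine hK.of_isClosed_subset Metric.isClosed_closedBall fun x hx => ?_
  by_contra hxK
  obtain ⟨e, he, u, hu, -, rfl⟩ := hK' x hxK
  rw [Metric.mem_closedBall, M.dist_tail he h0.le (h e) (by linarith [le_max_right R 0])] at hx
  have := dist_nonneg (x := M.pt e u₀) (y := z)
  linarith [le_max_left R 0]

/-- A tropical curve with an expanding homothety is a union of rays from a point. -/
theorem exists_rays {Φ : Equiv.Perm (FinitePoint X)} {k : ℝ} (hk : 1 < k)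
    (hΦ : ∀ x y, dist (Φ x) (Φ y) = k * dist x y) :
    ∃ (p : FinitePoint X) (γ : {e // M.G.length e = ∞} → ℝ → FinitePoint X)
      (a : {e // M.G.length e = ∞} → ℝ) (T : ℝ), (∀ i, γ i 0 = p) ∧
      (∀ i, ∀ t ≥ 0, dist (γ i t) p = t) ∧
      (∀ i, ∀ s ≥ 0, ∀ t ≥ 0, dist (γ i s) (γ i t) = |s - t|) ∧
      (∀ i j, i ≠ j → ∀ s ≥ 0, ∀ t ≥ 0, dist (γ i s) (γ j t) = s + t) ∧
      (∀ x, x ≠ p → ∃ i, γ i (dist x p) = x) ∧ ∀ i, ∀ t ≥ T, γ i t = M.pt i.1 (t - a i) := by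
  have hk0 : 0 < k := by linarith
  obtain ⟨p, hp⟩ : ∃ p, Φ p = p := by
    -- The inverse of an expansion is a contraction, and both have the same fixed points.
    have hcontr : ContractingWith (Real.toNNReal k⁻¹) Φ.symm := by
      refine ⟨Real.toNNReal_lt_one.2 (inv_lt_one_of_one_lt₀ hk), LipschitzWith.of_dist_le_mul
        fun x y => ?_⟩
      rw [Real.coe_toNNReal _ (inv_nonneg.2 hk0.le), inv_mul_eq_div, le_div_iff₀ hk0, mul_comm,
        ← hΦ, Equiv.apply_symm_apply, Equiv.apply_symm_apply]
    refine ⟨hcontr.fixedPoint, ?_⟩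
    conv_lhs => rw [← hcontr.fixedPoint_isFixedPt]
    exact Equiv.apply_symm_apply _ _
  obtain ⟨u₀, h0, h⟩ := M.exists_uniform_tail p
  let I := {e // M.G.length e = ∞}
  -- The shift between the parameter on an unbounded edge and the distance from `p`, constant beyond
  -- the last occurrence of `p`.
  let a : I → ℝ := fun i => dist (M.pt i.1 u₀) p - u₀
  obtain ⟨A, hA⟩ := (finite_range a).bddAbove
  obtain ⟨C, hC⟩ := (finite_range fun e => dist (M.pt e 0) p).bddAbove
  have hC' : ∀ e, dist (M.pt e 0) p ≤ C := fun e => hC (mem_range_self e)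
  have hA' : ∀ i, a i ≤ A := fun i => hA (mem_range_self i)
  obtain ⟨K, hK, hK'⟩ := M.exists_isCompact p u₀
  obtain ⟨R, hR⟩ := hK.isBounded.subset_closedBall p
  have htail : ∀ i : I, ∀ u ≥ u₀, dist (M.pt i.1 u) p = u + a i := fun i u hu => by
    rw [M.dist_tail i.2 h0.le (h i.1) hu]
    simp only [a]
    ring
  have hsame : ∀ e, M.G.length e = ∞ → ∀ u > 0, ∀ v > 0,
      dist (M.pt e u) (M.pt e v) = |u - v| := by
    intro e he u hu v hv
    wlog huv : v ≤ u generalizing u v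
    · rw [_root_.dist_comm, abs_sub_comm]
      exact this v hv u hu (le_of_not_ge huv)
    rw [M.dist_tail he (le_of_lt hv) (fun s hs hsv => (M.pt_injective_of_top he hv hs hsv).2.le) huv,
      _root_.dist_self, add_zero, abs_of_nonneg (sub_nonneg.2 huv)]
  have hdiff : ∀ e e', M.G.length e = ∞ → M.G.length e' = ∞ → e ≠ e' → ∀ u > 0, ∀ v > 0,
      u + v ≤ dist (M.pt e u) (M.pt e' v) := by
    intro e e' he he' hee u hu v hv
    rw [M.dist_tail he le_rfl (fun s hs hsv =>
      absurd (M.pt_injective_of_top he' hv hs hsv).1 hee) (le_of_lt hu), _root_.dist_comm,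
      M.dist_tail he' le_rfl (fun s hs hsv => ?_) (le_of_lt hv)]
    · have := dist_nonneg (x := M.pt e' 0) (y := M.pt e 0)
      linarith
    · by_contra! hs0
      exact hee (M.pt_injective_of_top he' hs0 (M.zero_mem_dom e) hsv.symm).1
  -- Beyond radius `T` the parameters have passed `u₀`, so distances from `p` are affine there
  -- (`hT1`). The defect `2 * C` between different edges is smaller than `T` (`hT2`), and all points
  -- lie outside the compact set `K` (`hT3`).
  let T : ℝ := max (u₀ + max A 0) (max (2 * max C 0) R) + 1
  have hT1 : ∀ i, u₀ + a i < T := fun i => by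
    have := hA' i
    have h2 := le_max_left A 0
    have h3 := le_max_left (u₀ + max A 0) (max (2 * max C 0) R)
    simp only [T]
    linarith
  have hT2 : 2 * C < T := by
    have := le_max_left C 0
    have h2 := le_max_left (2 * max C 0) R
    have h3 := le_max_right (u₀ + max A 0) (max (2 * max C 0) R)
    simp only [T]
    linarith
  have hT3 : R < T := by
    have h2 := le_max_right (2 * max C 0) R
    have h3 := le_max_right (u₀ + max A 0) (max (2 * max C 0) R)
    simp only [T]
    linarith
  have hT0 : 0 < T := by
    have h2 := le_max_right A 0
    have h3 := le_max_left (u₀ + max A 0) (max (2 * max C 0) R)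
    simp only [T]
    linarith
  have hsurj : ∀ x, T ≤ dist x p → ∃ i : I, M.pt i.1 (dist x p - a i) = x := by
    intro x hx
    obtain ⟨e, he, u, hu, -, rfl⟩ := hK' x fun hxK => by
      have := hR hxK
      rw [Metric.mem_closedBall] at this
      linarith
    refine ⟨⟨e, he⟩, ?_⟩
    rw [htail ⟨e, he⟩ u hu.le, add_sub_cancel_right]
  have hray : ∀ i : I, ∀ u ≥ T, ∀ v ≥ T,
      dist (M.pt i.1 (u - a i)) (M.pt i.1 (v - a i)) = |u - v| := by
    intro i u hu v hv
    have hi := hT1 i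
    rw [hsame i.1 i.2 _ (by linarith) _ (by linarith)]
    congr 1
    ring
  have hdist : ∀ i : I, ∀ u ≥ T, dist (M.pt i.1 (u - a i)) p = u := by
    intro i u hu
    have hi := hT1 i
    rw [htail i _ (by linarith), sub_add_cancel]
  have hne : ∀ i j : I, i ≠ j → ∀ u ≥ T, ∀ v ≥ T,
      u + v ≤ dist (M.pt i.1 (u - a i)) (M.pt j.1 (v - a j)) + 2 * C := by
    intro i j hij u hu v hv
    have hi := hT1 i
    have hj := hT1 j
    have h7 := hdiff i.1 j.1 i.2 j.2 (fun h => hij (Subtype.ext h)) (u - a i) (by linarith)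
      (v - a j) (by linarith)
    -- The shift is at most the distance from `p` to the lower end of the edge. The two shifts
    -- together cost at most `2 * C`.
    have hle : ∀ i : I, a i ≤ C := fun i => by
      have h8 := htail i u₀ le_rfl
      have h9 := dist_triangle (M.pt i.1 u₀) (M.pt i.1 0) p
      have h10 := M.dist_pt_le i.1 u₀ 0
      rw [sub_zero, abs_of_pos h0] at h10
      linarith [hC' i.1]
    have := hle i
    have := hle j
    linarith
  obtain ⟨γ, h1, h2, h3, h4, h5, h6⟩ := exists_rays_of_expanding hk hΦ hp
    (ray := fun (i : I) t => M.pt i.1 (t - a i)) hT0 hT2 hsurj hray hdist hne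
  exact ⟨p, γ, a, T, h1, h2, h3, h4, h5, h6⟩

end TropicalModel

/-! ### The infinite star as a model -/

/-- The star with centre `p` and one edge from `p` to each `top i`. -/
def starGraph {X I : Type*} (p : X) (top : I → X) : Graph X I where
  vertexSet := {p} ∪ range top
  IsLink i x y := (x = p ∧ y = top i) ∨ (x = top i ∧ y = p)
  isLink_symm _ _ := ⟨fun _ _ h => h.symm.imp And.symm And.symm⟩
  eq_or_eq_of_isLink_of_isLink := by
    rintro i x y v w (⟨rfl, rfl⟩ | ⟨rfl, rfl⟩) (⟨rfl, rfl⟩ | ⟨rfl, rfl⟩) <;> simp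
  left_mem_of_isLink := by
    rintro i x y (⟨rfl, rfl⟩ | ⟨rfl, rfl⟩)
    · exact Or.inl rfl
    · exact Or.inr ⟨i, rfl⟩

theorem starGraph_valence {X I : Type*} {p : X} {top : I → X} (htop : Function.Injective top)
    (hp : ∀ i, top i ≠ p) (i : I) : (starGraph p top).valence (top i) = 1 := by
  have h1 : {e | (starGraph p top).Inc e (top i)} = {i} := by
    ext e
    simp only [mem_ofPred_eq, mem_singleton_iff]
    constructor
    · rintro ⟨y, ⟨h, -⟩ | ⟨h, -⟩⟩
      · exact absurd h (hp i)
      · exact htop h.symm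
    · rintro rfl
      exact ⟨p, Or.inr ⟨rfl, rfl⟩⟩
  have h2 : {e | (starGraph p top).IsLoopAt e (top i)} = ∅ := by
    ext e
    simp only [mem_ofPred_eq, mem_empty_iff_false, iff_false]
    rintro (⟨h, -⟩ | ⟨-, h⟩)
    · exact hp i h
    · exact hp i h
  rw [Graph.valence, h1, h2, ncard_singleton, ncard_empty]

/-- A star all of whose edges have infinite length. -/
noncomputable def infiniteStar {X I : Type*} [Finite I] (p : X) (top : I → X)
    (htop : Function.Injective top) (hp : ∀ i, top i ≠ p) : EdgeWeightedGraph X I where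
  graph := starGraph p top
  finite_vertexSet := (finite_singleton p).union (finite_range top)
  finite_edgeSet := Set.toFinite _
  nonempty_vertexSet := ⟨p, Or.inl rfl⟩
  connected := by
    have h1 : ∀ v ∈ (starGraph p top).vertexSet,
        Relation.ReflTransGen (starGraph p top).Adj p v ∧
        Relation.ReflTransGen (starGraph p top).Adj v p := by
      rintro v (rfl | ⟨i, rfl⟩)
      · exact ⟨.refl, .refl⟩
      · exact ⟨.single ⟨i, Or.inl ⟨rfl, rfl⟩⟩, .single ⟨i, Or.inr ⟨rfl, rfl⟩⟩⟩
    exact fun v hv w hw => (h1 v hv).2.trans (h1 w hw).1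
  length _ := ∞
  length_pos _ := ENNReal.zero_lt_top
  leaf_of_length_eq_top e _ :=
    ⟨top e, ⟨p, Or.inr ⟨rfl, rfl⟩⟩, starGraph_valence htop hp e⟩

/-- The map from `[0, ∞]` given by a ray and its end. -/
noncomputable def rayWithEnd {X : Type*} (γ : ℝ → X) (top : X) (t : Set.Iic (∞ : ℝ≥0∞)) : X :=
  open scoped Classical in if (t : ℝ≥0∞) = ∞ then top else γ (t : ℝ≥0∞).toReal

theorem rayWithEnd_top {X : Type*} (γ : ℝ → X) (top : X) : rayWithEnd γ top ⊤ = top :=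
  if_pos rfl

theorem rayWithEnd_of_ne {X : Type*} (γ : ℝ → X) (top : X) {t : Set.Iic (∞ : ℝ≥0∞)}
    (ht : (t : ℝ≥0∞) ≠ ∞) : rayWithEnd γ top t = γ (t : ℝ≥0∞).toReal :=
  if_neg ht

theorem rayWithEnd_ofReal {X : Type*} (γ : ℝ → X) (top : X) {t : ℝ} (ht : 0 ≤ t) :
    rayWithEnd γ top ⟨ENNReal.ofReal t, mem_Iic.2 le_top⟩ = γ t := by
  rw [rayWithEnd_of_ne _ _ ENNReal.ofReal_ne_top, ENNReal.toReal_ofReal ht]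

/-- The presentation of a space as an infinite star with given rays. -/
noncomputable def starPresentation {X : Type*} [TopologicalSpace X] {I : Type} [Finite I] (p : X)
    (top : I → X) (htop : Function.Injective top) (hp : ∀ i, top i ≠ p) (γ : I → ℝ → X)
    (hγ0 : ∀ i, γ i 0 = p) (hγp : ∀ i, ∀ t > 0, γ i t ≠ p) (hγtop : ∀ i j, ∀ t > 0, γ i t ≠ top j)
    (hinj : ∀ i j, ∀ s > 0, ∀ t > 0, γ i s = γ j t → i = j ∧ s = t)
    (hsurj : ∀ x, x ≠ p → x ∉ range top → ∃ i, ∃ t > 0, γ i t = x)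
    (hopen : ∀ U : Set X, IsOpen U ↔ ∀ i, IsOpen (rayWithEnd (γ i) (top i) ⁻¹' U)) :
    GraphPresentation X where
  E := I
  G := infiniteStar p top htop hp
  edge e := rayWithEnd (γ e) (top e)
  isLink e := by
    refine Or.inl ⟨?_, rayWithEnd_top _ _⟩
    exact (rayWithEnd_of_ne (γ e) (top e) (t := ⊥) ENNReal.zero_ne_top).trans (hγ0 e)
  valence_edge_top e _ := by
    change (starGraph p top).valence (rayWithEnd (γ e) (top e) ⊤) = 1
    rw [rayWithEnd_top]
    exact starGraph_valence htop hp e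
  interior_notMem e t h0 h1 := by
    have h1' : (t : ℝ≥0∞) ≠ ∞ := fun h => h1 (Subtype.ext h)
    have hpos : 0 < (t : ℝ≥0∞).toReal := ENNReal.toReal_pos (fun h => h0 (Subtype.ext h)) h1'
    rw [rayWithEnd_of_ne _ _ h1']
    rintro (h | ⟨j, h⟩)
    · exact hγp _ _ hpos h
    · exact hγtop _ j _ hpos h.symm
  interior_injective e s e' s' h0 h1 h0' h1' h := by
    have h2 : (s : ℝ≥0∞) ≠ ∞ := fun h => h1 (Subtype.ext h)
    have hpos : 0 < (s : ℝ≥0∞).toReal := ENNReal.toReal_pos (fun h => h0 (Subtype.ext h)) h2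
    have h2' : (s' : ℝ≥0∞) ≠ ∞ := fun h => h1' (Subtype.ext h)
    have hpos' : 0 < (s' : ℝ≥0∞).toReal := ENNReal.toReal_pos (fun h => h0' (Subtype.ext h)) h2'
    rw [rayWithEnd_of_ne _ _ h2, rayWithEnd_of_ne _ _ h2'] at h
    obtain ⟨h3, h4⟩ := hinj _ _ _ hpos _ hpos' h
    obtain rfl : e = e' := Subtype.ext h3
    obtain rfl : s = s' := Subtype.ext ((ENNReal.toReal_eq_toReal_iff' h2 h2').1 h4)
    rfl
  exists_of_notMem x hx := by
    obtain ⟨i, t, ht, rfl⟩ := hsurj x (fun h => hx (Or.inl h)) (fun h => hx (Or.inr h))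
    refine ⟨⟨i, p, top i, Or.inl ⟨rfl, rfl⟩⟩, ⟨ENNReal.ofReal t, mem_Iic.2 le_top⟩, ?_, ?_, ?_⟩
    · intro h
      exact (ENNReal.ofReal_pos.2 ht).ne' (congrArg Subtype.val h)
    · intro h
      exact ENNReal.ofReal_ne_top (congrArg Subtype.val h)
    · exact rayWithEnd_ofReal (γ i) (top i) (le_of_lt ht)
  isOpen_iff U := by
    rw [hopen]
    exact ⟨fun h e => h e, fun h i => h ⟨i, p, top i, Or.inl ⟨rfl, rfl⟩⟩⟩

/-- Neighbourhoods in `[0, ∞]` are balls at finite parameters and tails at `∞`. In this form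
openness can be compared with the metric of the finite points; `of_rayWithEnd_preimage_isOpen` is
the converse. -/
theorem rayWithEnd_preimage_isOpen {X : Type*} {γ : ℝ → X} {top : X} {U : Set X}
    (h1 : ∀ t ≥ 0, γ t ∈ U → ∃ ε > 0, ∀ s ≥ 0, |s - t| < ε → γ s ∈ U)
    (h2 : top ∈ U → ∃ B, ∀ t ≥ B, γ t ∈ U) : IsOpen (rayWithEnd γ top ⁻¹' U) := by
  refine isOpen_iff_mem_nhds.2 fun t ht => ?_
  by_cases htop : (t : ℝ≥0∞) = ∞
  · obtain rfl : t = ⊤ := Subtype.ext htop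
    rw [mem_preimage, rayWithEnd_top] at ht
    obtain ⟨B, hB⟩ := h2 ht
    have hopen : ∀ᶠ t : Set.Iic (∞ : ℝ≥0∞) in 𝓝 ⊤, ENNReal.ofReal B < (t : ℝ≥0∞) :=
      continuous_subtype_val.continuousAt.eventually (lt_mem_nhds ENNReal.ofReal_lt_top)
    filter_upwards [hopen] with s hs
    by_cases hs' : (s : ℝ≥0∞) = ∞
    · obtain rfl : s = ⊤ := Subtype.ext hs'
      rwa [mem_preimage, rayWithEnd_top]
    · rw [mem_preimage, rayWithEnd_of_ne _ _ hs']
      exact hB _ ((ENNReal.ofReal_le_iff_le_toReal hs').1 hs.le)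
  · rw [mem_preimage, rayWithEnd_of_ne _ _ htop] at ht
    obtain ⟨ε, hε, h⟩ := h1 _ ENNReal.toReal_nonneg ht
    have hc : ContinuousAt (fun t : Set.Iic (∞ : ℝ≥0∞) => (t : ℝ≥0∞).toReal) t :=
      (ENNReal.continuousAt_toReal htop).comp continuous_subtype_val.continuousAt
    have hopen : ∀ᶠ s : Set.Iic (∞ : ℝ≥0∞) in 𝓝 t, (s : ℝ≥0∞) ≠ ∞ :=
      continuous_subtype_val.continuousAt.eventually (isOpen_ne.mem_nhds htop)
    filter_upwards [hopen, hc.eventually (Metric.ball_mem_nhds _ hε)] with s hs hs'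
    rw [mem_preimage, rayWithEnd_of_ne _ _ hs]
    exact h _ ENNReal.toReal_nonneg hs'

theorem of_rayWithEnd_preimage_isOpen {X : Type*} {γ : ℝ → X} {top : X} {U : Set X}
    (h : IsOpen (rayWithEnd γ top ⁻¹' U)) :
    (∀ t ≥ 0, γ t ∈ U → ∃ ε > 0, ∀ s ≥ 0, |s - t| < ε → γ s ∈ U) ∧
      (top ∈ U → ∃ B, ∀ t ≥ B, γ t ∈ U) := by
  let q : ℝ → Set.Iic (∞ : ℝ≥0∞) := fun t => ⟨ENNReal.ofReal t, mem_Iic.2 le_top⟩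
  have hq : Continuous q := ENNReal.continuous_ofReal.subtype_mk _
  have hqγ : ∀ t ≥ 0, rayWithEnd γ top (q t) = γ t := fun t ht =>
    rayWithEnd_ofReal γ top ht
  constructor
  · intro t ht hU
    have h1 : q ⁻¹' (rayWithEnd γ top ⁻¹' U) ∈ 𝓝 t :=
      (h.preimage hq).mem_nhds (by rwa [mem_preimage, mem_preimage, hqγ t ht])
    obtain ⟨ε, hε, hsub⟩ := Metric.mem_nhds_iff.1 h1
    refine ⟨ε, hε, fun s hs hst => ?_⟩
    have := hsub (show s ∈ Metric.ball t ε from hst)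
    rwa [mem_preimage, mem_preimage, hqγ s hs] at this
  · intro hU
    have hlim : Tendsto q atTop (𝓝 ⊤) := by
      rw [tendsto_subtype_rng]
      exact ENNReal.tendsto_ofReal_atTop
    have h1 := hlim.eventually (h.mem_nhds (by rwa [mem_preimage, rayWithEnd_top]))
    obtain ⟨B, hB⟩ := eventually_atTop.1 h1
    refine ⟨max B 0, fun t ht => ?_⟩
    have := hB t ((le_max_left _ _).trans ht)
    rwa [hqγ t ((le_max_right _ _).trans ht)] at this

namespace TropicalModel

variable {X : Type*} [TopologicalSpace X] [EDist X] (M : TropicalModel X)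

theorem exists_tail_mem {e : M.G.graph.edgeSet} (he : M.G.length e = ∞) {U : Set X} (hU : IsOpen U)
    (htop : M.edge e ⊤ ∈ U) : ∃ B, ∀ u ≥ B, (M.pt e u : X) ∈ U := by
  have hlim : Tendsto (fun u => (M.pt e u : X)) atTop (𝓝 (M.edge e ⊤)) := by
    refine ((M.continuous_edge e).tendsto ⊤).comp (tendsto_subtype_rng.2 ?_)
    change Tendsto (fun u => min (ENNReal.ofReal u) (M.G.length e)) atTop (𝓝 (M.G.length e))
    simpa [he] using ENNReal.tendsto_ofReal_atTop
  exact eventually_atTop.1 (hlim.eventually (hU.mem_nhds htop))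

variable [TropicalCurve X]

/-- A point close to `x` lies on an edge through `x` with a parameter close to one of the finitely
many parameters of `x`. -/
theorem continuous_val : Continuous (FinitePoint.val : FinitePoint X → X) := by
  obtain ⟨M⟩ := TropicalCurve.exists_model (X := X)
  refine continuous_iff_continuousAt.2 fun x U hU => ?_
  obtain ⟨ε, hε, hloc⟩ : ∃ ε, 0 < ε ∧ ∀ e, ∀ s ∈ M.dom e, M.pt e s = x → ∀ u,
      |u - s| < ε → (M.pt e u : X) ∈ U := by
    have h1 : ∀ e, ∀ᶠ ε in 𝓝[>] (0 : ℝ), ∀ s ∈ {s ∈ M.dom e | M.pt e s = x}, ∀ u,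
        |u - s| < ε → (M.pt e u : X) ∈ U := by
      intro e
      rw [(M.finite_preimage_pt e x).eventually_all]
      rintro s ⟨hs, rfl⟩
      obtain ⟨δ, hδ, h⟩ := Metric.mem_nhds_iff.1 ((M.continuous_coe_pt e).continuousAt hU)
      filter_upwards [Ioo_mem_nhdsGT hδ] with ε hε u hu
      exact h (hu.trans hε.2)
    obtain ⟨ε, hε, hε0⟩ := ((eventually_all.2 h1).and self_mem_nhdsWithin).exists
    exact ⟨ε, hε0, fun e s hs hs' => hε e s ⟨hs, hs'⟩⟩
  obtain ⟨η, hη, h⟩ := M.exists_edge_of_dist_lt x hε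
  refine Metric.mem_nhds_iff.2 ⟨η, hη, fun y hy => ?_⟩
  by_cases hyx : y = x
  · rw [hyx]
    exact mem_preimage.2 (mem_of_mem_nhds hU)
  · obtain ⟨e, u, hu, s, hs, rfl, hsx, hus⟩ := h y hyx hy
    exact hloc e s hs hsx u hus

/-- The topology is determined by the metric of the finite points and by the tails of the unbounded
edges. A criterion of this kind makes it independent of how the bounded part is cut into edges. -/
theorem isOpen_of_tails {U : Set X} (h1 : IsOpen {x : FinitePoint X | (x : X) ∈ U})
    (h2 : ∀ e, M.G.length e = ∞ → M.edge e ⊤ ∈ U → ∃ B, ∀ u ≥ B, (M.pt e u : X) ∈ U) :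
    IsOpen U := by
  refine (M.isOpen_iff U).2 fun e => isOpen_iff_mem_nhds.2 fun t ht => ?_
  by_cases htop : (t : ℝ≥0∞) = ∞
  · have he : M.G.length e = ∞ := top_le_iff.1 (htop ▸ t.2)
    obtain rfl : t = ⊤ := Subtype.ext (htop.trans he.symm)
    obtain ⟨B, hB⟩ := h2 e he ht
    have hopen : ∀ᶠ t : Set.Iic (M.G.length e) in 𝓝 ⊤, ENNReal.ofReal B < (t : ℝ≥0∞) :=
      continuous_subtype_val.continuousAt.eventually (lt_mem_nhds (htop ▸ ENNReal.ofReal_lt_top))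
    filter_upwards [hopen] with s hs
    by_cases hs' : (s : ℝ≥0∞) = ∞
    · obtain rfl : s = ⊤ := Subtype.ext (hs'.trans he.symm)
      exact ht
    · rw [mem_preimage, M.edge_eq_pt e s hs']
      exact hB _ ((ENNReal.ofReal_le_iff_le_toReal hs').1 hs.le)
  · rw [mem_preimage, M.edge_eq_pt e t htop] at ht
    have hc : ContinuousAt (fun t : Set.Iic (M.G.length e) => (t : ℝ≥0∞).toReal) t :=
      (ENNReal.continuousAt_toReal htop).comp continuous_subtype_val.continuousAt
    have hopen : ∀ᶠ s : Set.Iic (M.G.length e) in 𝓝 t, (s : ℝ≥0∞) ≠ ∞ :=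
      continuous_subtype_val.continuousAt.eventually (isOpen_ne.mem_nhds htop)
    have hc' := ((M.continuous_pt e).continuousAt.comp hc).eventually (h1.mem_nhds ht)
    filter_upwards [hopen, hc'] with s hs hs'
    rw [mem_preimage, M.edge_eq_pt e s hs]
    exact hs'

/-- A tropical curve that is a union of rays from a point has a model whose edges are the rays. -/
theorem exists_star_model {p : FinitePoint X} {γ : {e // M.G.length e = ∞} → ℝ → FinitePoint X}
    {a : {e // M.G.length e = ∞} → ℝ} {T : ℝ} (hγ0 : ∀ i, γ i 0 = p)
    (hγp : ∀ i, ∀ t ≥ 0, dist (γ i t) p = t)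
    (hsame : ∀ i, ∀ s ≥ 0, ∀ t ≥ 0, dist (γ i s) (γ i t) = |s - t|)
    (hdiff : ∀ i j, i ≠ j → ∀ s ≥ 0, ∀ t ≥ 0, dist (γ i s) (γ j t) = s + t)
    (hsurj : ∀ x, x ≠ p → ∃ i, γ i (dist x p) = x)
    (htail : ∀ i, ∀ t ≥ T, γ i t = M.pt i.1 (t - a i)) :
    ∃ N : TropicalModel X, ∀ e : N.G.graph.edgeSet, N.G.length e = ∞ := by
  let top : {e // M.G.length e = ∞} → X := fun i => M.edge i.1 ⊤
  have htopP : ∀ i, top i ∈ pointsAtInfinity X := fun i => M.edge_top_mem_pointsAtInfinity i.2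
  have htop : Function.Injective top := fun i j h => Subtype.ext (M.edge_top_eq j.2 h)
  have hne : ∀ (x : FinitePoint X) i, (x : X) ≠ top i := fun x i h => x.2 (h ▸ htopP i)
  have hpos : ∀ i, ∀ t > 0, γ i t ≠ p := fun i t ht h => by
    have := hγp i t (le_of_lt ht)
    rw [h, dist_self] at this
    exact ht.ne this
  -- The rays and the edges of `M` define the same topology: they share their tails up to a shift,
  -- and on finite points both are governed by the metric.
  have hopen : ∀ U : Set X, IsOpen U ↔
      ∀ i, IsOpen (rayWithEnd (fun t => (γ i t : X)) (top i) ⁻¹' U) := by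
    intro U
    constructor
    · intro hU i
      refine rayWithEnd_preimage_isOpen (fun t ht hmem => ?_) fun hmem => ?_
      · obtain ⟨ε, hε, h⟩ := Metric.isOpen_iff.1 (hU.preimage continuous_val) (γ i t) hmem
        exact ⟨ε, hε, fun s hs hst => h (show dist _ _ < ε by rwa [hsame i s hs t ht])⟩
      · obtain ⟨B, hB⟩ := M.exists_tail_mem i.2 hU hmem
        refine ⟨max T (B + a i), fun t ht => ?_⟩
        rw [htail i t ((le_max_left _ _).trans ht)]
        exact hB _ (by linarith [(le_max_right T (B + a i)).trans ht])
    · intro h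
      refine M.isOpen_of_tails (Metric.isOpen_iff.2 fun x hx => ?_) fun e he hmem => ?_
      · have h1 : ∀ i, ∀ᶠ ε in 𝓝[>] (0 : ℝ), ∀ t ≥ 0, dist (γ i t) x < ε → (γ i t : X) ∈ U := by
          intro i
          by_cases hxi : ∃ d ≥ 0, γ i d = x
          · obtain ⟨d, hd, rfl⟩ := hxi
            obtain ⟨δ, hδ, h1⟩ := (of_rayWithEnd_preimage_isOpen (h i)).1 d hd hx
            filter_upwards [Ioo_mem_nhdsGT hδ] with ε hε t ht hdist
            rw [hsame i t ht d hd] at hdist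
            exact h1 t ht (hdist.trans hε.2)
          -- The point `x` is not on ray `i`, so every point of that ray is at distance at least
          -- `dist x p` from it.
          · have hxp : x ≠ p := fun h => hxi ⟨0, le_rfl, (hγ0 i).trans h.symm⟩
            obtain ⟨j, hj⟩ := hsurj x hxp
            have hij : i ≠ j := by
              rintro rfl
              exact hxi ⟨_, dist_nonneg, hj⟩
            filter_upwards [Ioo_mem_nhdsGT (dist_pos.2 hxp)] with ε hε t ht hdist
            rw [← hj, hdiff i j hij t ht _ dist_nonneg] at hdist
            linarith [hε.2, show (0 : ℝ) ≤ t from ht]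
        obtain ⟨ε, hε, hε0⟩ := ((eventually_all.2 h1).and self_mem_nhdsWithin).exists
        refine ⟨ε, hε0, fun y hy => ?_⟩
        -- The centre lies on a ray only if there is one, and a one-point curve has none. For `x ≠
        -- p` the ray through `x` serves.
        by_cases hyp : y = p
        · by_cases hxp : x = p
          · rw [hyp, ← hxp]
            exact hx
          · obtain ⟨j, hj⟩ := hsurj x hxp
            have h2 := hε j 0 le_rfl
            rw [hγ0, ← hyp] at h2
            exact h2 hy
        · obtain ⟨j, hj⟩ := hsurj y hyp
          have h2 := hε j (dist y p) dist_nonneg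
          rw [hj] at h2
          exact h2 hy
      · obtain ⟨B, hB⟩ := (of_rayWithEnd_preimage_isOpen (h ⟨e, he⟩)).2 hmem
        refine ⟨max T B - a ⟨e, he⟩, fun u hu => ?_⟩
        have h2 : max T B ≤ u + a ⟨e, he⟩ := by
          have : max T B - a ⟨e, he⟩ ≤ u := hu
          linarith
        have h3 := htail ⟨e, he⟩ (u + a ⟨e, he⟩) ((le_max_left _ _).trans h2)
        rw [add_sub_cancel_right] at h3
        rw [← h3]
        exact hB _ ((le_max_right _ _).trans h2)
  let N : GraphPresentation X := starPresentation (p : X) top htop (fun i => (hne p i).symm)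
    (fun i t => (γ i t : X)) (fun i => congrArg _ (hγ0 i))
    (fun i t ht h => hpos i t ht (FinitePoint.ext h)) (fun i j t _ => hne _ j)
    (fun i j s hs t ht h => by
      have h' := FinitePoint.ext h
      by_cases hij : i = j
      · subst hij
        have := hsame i s (le_of_lt hs) t (le_of_lt ht)
        rw [h', dist_self] at this
        exact ⟨rfl, sub_eq_zero.1 (abs_eq_zero.1 this.symm)⟩
      · have := hdiff i j hij s (le_of_lt hs) t (le_of_lt ht)
        rw [h', dist_self] at this
        have h1 : 0 < s := hs
        have h2 : 0 < t := ht
        linarith)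
    (fun x hxp hx => by
      have hxP : x ∉ pointsAtInfinity X := fun h => by
        obtain ⟨e, he, rfl⟩ := M.exists_edge_top h
        exact hx ⟨⟨e, he⟩, rfl⟩
      have hxp' : (⟨x, hxP⟩ : FinitePoint X) ≠ p := fun h => hxp (congrArg FinitePoint.val h)
      obtain ⟨i, hi⟩ := hsurj _ hxp'
      exact ⟨i, _, dist_pos.2 hxp', congrArg FinitePoint.val hi⟩) hopen
  have hedge : ∀ i, ∀ t ≥ 0, (γ i t : X) = rayWithEnd (fun t => (γ i t : X)) (top i)
      ⟨ENNReal.ofReal t, mem_Iic.2 le_top⟩ := fun i t ht =>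
    (rayWithEnd_ofReal (fun t => (γ i t : X)) (top i) ht).symm
  have hN : ∀ i, ∀ s ≥ 0, ∀ t ≥ 0, N.dist (γ i s) (γ i t) ≤ ENNReal.ofReal |s - t| := by
    intro i s hs t ht
    rw [hedge i s hs, hedge i t ht, ← ofReal_edist hs ht]
    exact N.dist_edge_le ⟨i, (p : X), top i, Or.inl ⟨rfl, rfl⟩⟩ ⟨ENNReal.ofReal s, mem_Iic.2 le_top⟩
      ⟨ENNReal.ofReal t, mem_Iic.2 le_top⟩
  have hstep : ∀ i (s t : Set.Iic (∞ : ℝ≥0∞)),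
      edist (rayWithEnd (fun t => (γ i t : X)) (top i) s)
        (rayWithEnd (fun t => (γ i t : X)) (top i) t) ≤ edist (s : ℝ≥0∞) (t : ℝ≥0∞) := by
    intro i s t
    by_cases hst : edist (s : ℝ≥0∞) (t : ℝ≥0∞) = ∞
    · rw [hst]
      exact le_top
    rw [ENNReal.edist_eq_top_iff, not_and_or, not_not, not_or] at hst
    by_cases heq : (s : ℝ≥0∞) = t
    · obtain rfl : s = t := Subtype.ext heq
      rw [M.edist_self]
      exact bot_le
    · obtain ⟨hs, ht⟩ := hst.resolve_left heq
      rw [rayWithEnd_of_ne _ _ hs, rayWithEnd_of_ne _ _ ht, FinitePoint.edist_coe,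
        hsame _ _ ENNReal.toReal_nonneg _ ENNReal.toReal_nonneg,
        ← ofReal_edist ENNReal.toReal_nonneg ENNReal.toReal_nonneg, ENNReal.ofReal_toReal hs,
        ENNReal.ofReal_toReal ht]
  -- No step of a path in the star is shorter than the given distance between its ends, so the
  -- distance of the star is not smaller than the given one.
  have hle : ∀ x y L, N.PathLength x y L → edist x y ≤ L := by
    intro x y L h
    induction h with
    | refl x => rw [M.edist_self]
    | step e s t h ih =>
      exact (M.edist_triangle _ (N.edge e t) _).trans (add_le_add (hstep e.1 s t) ih)
  have hNp : ∀ x : FinitePoint X, N.dist x p ≤ edist (x : X) (p : X) := by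
    intro x
    by_cases hx : x = p
    · rw [hx, N.dist_self]
      exact bot_le
    · obtain ⟨i, hi⟩ := hsurj x hx
      have h1 := hN i (dist x p) dist_nonneg 0 le_rfl
      rwa [hi, hγ0, sub_zero, abs_of_nonneg dist_nonneg, ← FinitePoint.edist_coe] at h1
  refine ⟨⟨N, fun x y => le_antisymm (le_sInf fun L hL => hle x y L hL) ?_⟩, fun e => rfl⟩
  -- Conversely, two finite points are joined in the star along a common ray or through `p`, and
  -- both routes have exactly the given length.
  by_cases hxy : x = y
  · rw [hxy, N.dist_self]
    exact bot_le
  by_cases hx : x ∈ pointsAtInfinity X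
  · rw [M.edist_eq_top hx (Ne.symm hxy)]
    exact le_top
  by_cases hy : y ∈ pointsAtInfinity X
  · rw [M.edist_comm, M.edist_eq_top hy hxy]
    exact le_top
  obtain ⟨x, rfl⟩ : ∃ z : FinitePoint X, (z : X) = x := ⟨⟨x, hx⟩, rfl⟩
  obtain ⟨y, rfl⟩ : ∃ z : FinitePoint X, (z : X) = y := ⟨⟨y, hy⟩, rfl⟩
  by_cases hyp : y = p
  · rw [hyp]
    exact hNp x
  by_cases hxp : x = p
  · rw [hxp, N.dist_comm, M.edist_comm]
    exact hNp y
  obtain ⟨i, hi⟩ := hsurj x hxp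
  obtain ⟨j, hj⟩ := hsurj y hyp
  by_cases hij : i = j
  · subst hij
    have h1 := hN i (dist x p) dist_nonneg (dist y p) dist_nonneg
    have h2 := hsame i (dist x p) dist_nonneg (dist y p) dist_nonneg
    rw [hi, hj] at h1 h2
    rwa [← h2, ← FinitePoint.edist_coe] at h1
  · refine (N.dist_triangle _ (p : X) _).trans ?_
    have h2 := hdiff i j hij (dist x p) dist_nonneg (dist y p) dist_nonneg
    rw [hi, hj] at h2
    rw [FinitePoint.edist_coe, h2, ENNReal.ofReal_add dist_nonneg dist_nonneg,
      ← FinitePoint.edist_coe, ← FinitePoint.edist_coe, N.dist_comm (p : X)]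
    exact add_le_add (hNp x) (hNp y)

end TropicalModel

/-! ### From automorphisms to the star -/

namespace RatFun

variable {X : Type*} [TopologicalSpace X] [EDist X]

/-- Only real constants have to be tested: the remaining scalar `-∞` is the zero of the semiring and
is fixed anyway. -/
theorem mem_algebraAutSubgroup_iff (ψ : RatFun X ≃+* RatFun X) :
    ψ ∈ algebraAutSubgroup TropicalSemifield (RatFun X) ↔
      ∀ c, ψ (realConst X c) = realConst X c := by
  constructor
  · rintro ⟨φ, rfl⟩ c
    exact φ.commutes ⟨(c : WithBot ℝ)⟩
  · intro h
    refine ⟨AlgEquiv.ofRingEquiv (f := ψ) fun a => ?_, rfl⟩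
    rcases a.eq_zero_or_coe with rfl | ⟨c, rfl⟩
    · rw [map_zero, map_zero]
    · exact h c

variable [TropicalCurve X]

theorem exists_model_of_lt_top (h : algebraAutSubgroup TropicalSemifield (RatFun X) < ⊤) :
    ∃ M : TropicalModel X, ∀ e : M.G.graph.edgeSet, M.G.length e = ∞ := by
  obtain ⟨ψ, -, hψ⟩ := SetLike.exists_of_lt h
  rw [mem_algebraAutSubgroup_iff] at hψ
  push Not at hψ
  obtain ⟨c, hc⟩ := hψ
  obtain ⟨k, hk, Φ, hΦ⟩ := exists_expanding ψ hc
  obtain ⟨M⟩ := TropicalCurve.exists_model (X := X)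
  obtain ⟨p, γ, a, T, h1, h2, h3, h4, h5, h6⟩ := M.exists_rays hk hΦ
  exact M.exists_star_model h1 h2 h3 h4 h5 h6

end RatFun

/-! ### Pulling back models along homotheties -/

/-- Multiplication by `c` as an isomorphism from `[0, c⁻¹ l]` to `[0, l]`. -/
noncomputable def ENNReal.iicMulLeft {c : ℝ≥0∞} (h0 : c ≠ 0) (ht : c ≠ ∞) (l : ℝ≥0∞) :
    Set.Iic (c⁻¹ * l) ≃o Set.Iic l where
  toFun t := ⟨c * t, (mul_le_mul_right t.2 c).trans_eq (ENNReal.mul_inv_cancel_left h0 ht)⟩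
  invFun s := ⟨c⁻¹ * s, mem_Iic.2 (mul_le_mul_right s.2 _)⟩
  left_inv t := Subtype.ext (ENNReal.inv_mul_cancel_left h0 ht)
  right_inv s := Subtype.ext (ENNReal.mul_inv_cancel_left h0 ht)
  map_rel_iff' {a b} := by
    change c * (a : ℝ≥0∞) ≤ c * (b : ℝ≥0∞) ↔ (a : ℝ≥0∞) ≤ b
    exact ENNReal.mul_le_mul_iff_right h0 ht

theorem ENNReal.iicMulLeft_ne_bot {c : ℝ≥0∞} {h0 : c ≠ 0} {ht : c ≠ ∞} {l : ℝ≥0∞}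
    {t : Set.Iic (c⁻¹ * l)} (h : t ≠ ⊥) : ENNReal.iicMulLeft h0 ht l t ≠ ⊥ := fun hb =>
  h ((ENNReal.iicMulLeft h0 ht l).injective (hb.trans (OrderIso.map_bot _).symm))

theorem ENNReal.iicMulLeft_ne_top {c : ℝ≥0∞} {h0 : c ≠ 0} {ht : c ≠ ∞} {l : ℝ≥0∞}
    {t : Set.Iic (c⁻¹ * l)} (h : t ≠ ⊤) : ENNReal.iicMulLeft h0 ht l t ≠ ⊤ := fun hb =>
  h ((ENNReal.iicMulLeft h0 ht l).injective (hb.trans (OrderIso.map_top _).symm))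

theorem ENNReal.edist_mul_left {c : ℝ≥0∞} (ht : c ≠ ∞) (a b : ℝ≥0∞) :
    edist (c * a) (c * b) = c * edist a b := by
  rw [edist_eq_sub_add_sub, edist_eq_sub_add_sub, mul_add, ENNReal.mul_sub fun _ _ => ht,
    ENNReal.mul_sub fun _ _ => ht]

namespace EdgeWeightedGraph

variable {V E : Type*}

/-- The preimage of a graph under a bijection of the vertices. -/
def comapGraph (G : Graph V E) (h : V ≃ V) : Graph V E where
  vertexSet := h ⁻¹' G.vertexSet
  edgeSet := G.edgeSet
  IsLink e x y := G.IsLink e (h x) (h y)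
  isLink_symm _ he := ⟨fun _ _ hl => (G.isLink_symm he).symm _ _ hl⟩
  eq_or_eq_of_isLink_of_isLink _ _ _ _ _ h1 h2 :=
    (G.eq_or_eq_of_isLink_of_isLink h1 h2).imp (fun h' => h.injective h') fun h' => h.injective h'
  edge_mem_iff_exists_isLink e := by
    rw [G.edge_mem_iff_exists_isLink]
    constructor
    · rintro ⟨x, y, hl⟩
      exact ⟨h.symm x, h.symm y, by simpa using hl⟩
    · rintro ⟨x, y, hl⟩
      exact ⟨_, _, hl⟩
  left_mem_of_isLink _ _ _ hl := G.left_mem_of_isLink hl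

theorem comapGraph_valence (G : Graph V E) (h : V ≃ V) (v : V) :
    (comapGraph G h).valence v = G.valence (h v) := by
  have h1 : {e | (comapGraph G h).Inc e v} = {e | G.Inc e (h v)} := by
    ext e
    exact ⟨fun ⟨y, hy⟩ => ⟨_, hy⟩, fun ⟨y, hy⟩ => ⟨h.symm y, by
      change G.IsLink e (h v) (h (h.symm y))
      rwa [h.apply_symm_apply]⟩⟩
  rw [Graph.valence, Graph.valence, h1]
  rfl

/-- The preimage of an edge-weighted graph under a bijection of the vertices, with all lengths
divided by `c`. -/
noncomputable def comap (G : EdgeWeightedGraph V E) (h : V ≃ V) {c : ℝ≥0∞} (h0 : c ≠ 0)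
    (ht : c ≠ ∞) : EdgeWeightedGraph V E where
  graph := comapGraph G.graph h
  finite_vertexSet := G.finite_vertexSet.preimage h.injective.injOn
  finite_edgeSet := G.finite_edgeSet
  nonempty_vertexSet := G.nonempty_vertexSet.preimage h.surjective
  connected v hv w hw := by
    have h1 := (G.connected _ hv _ hw).lift (p := (comapGraph G.graph h).Adj) h.symm ?_
    · change Relation.ReflTransGen _ (h.symm (h v)) (h.symm (h w)) at h1
      rwa [h.symm_apply_apply, h.symm_apply_apply] at h1
    · rintro a b ⟨e, he⟩
      refine ⟨e, ?_⟩
      change G.graph.IsLink e (h (h.symm a)) (h (h.symm b))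
      rwa [h.apply_symm_apply, h.apply_symm_apply]
  length e := c⁻¹ * G.length e
  length_pos e := ENNReal.mul_pos (ENNReal.inv_ne_zero.2 ht) (G.length_pos e).ne'
  leaf_of_length_eq_top e he := by
    have he' : G.length e = ∞ := by
      rcases ENNReal.mul_eq_top.1 he with h1 | h1
      · exact h1.2
      · exact absurd h1.1 (ENNReal.inv_ne_top.2 h0)
    obtain ⟨v, ⟨y, hy⟩, hv⟩ := G.leaf_of_length_eq_top e he'
    refine ⟨h.symm v, ⟨h.symm y, ?_⟩, ?_⟩
    · change G.graph.IsLink e (h (h.symm v)) (h (h.symm y))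
      rwa [h.apply_symm_apply, h.apply_symm_apply]
    · rw [comapGraph_valence, h.apply_symm_apply, hv]

end EdgeWeightedGraph

namespace GraphPresentation

variable {X : Type*} [TopologicalSpace X]

/-- The preimage of a presentation under a homeomorphism, with all lengths divided by `c`. -/
noncomputable def comap (N : GraphPresentation X) (h : X ≃ₜ X) {c : ℝ≥0∞} (h0 : c ≠ 0)
    (ht : c ≠ ∞) : GraphPresentation X where
  E := N.E
  G := N.G.comap h.toEquiv h0 ht
  edge e t := h.symm (N.edge e (ENNReal.iicMulLeft h0 ht _ t))
  isLink e := by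
    change N.G.graph.IsLink e (h (h.symm (N.edge e (ENNReal.iicMulLeft h0 ht _ ⊥))))
      (h (h.symm (N.edge e (ENNReal.iicMulLeft h0 ht _ ⊤))))
    rw [h.apply_symm_apply, h.apply_symm_apply, OrderIso.map_bot, OrderIso.map_top]
    exact N.isLink e
  valence_edge_top e he := by
    have he' : N.G.length e = ∞ := by
      rcases ENNReal.mul_eq_top.1 he with h1 | h1
      · exact h1.2
      · exact absurd h1.1 (ENNReal.inv_ne_top.2 h0)
    refine (EdgeWeightedGraph.comapGraph_valence _ _ _).trans ?_
    change N.G.graph.valence (h (h.symm (N.edge e (ENNReal.iicMulLeft h0 ht _ ⊤)))) = 1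
    rw [h.apply_symm_apply, OrderIso.map_top]
    exact N.valence_edge_top e he'
  interior_notMem e t hb hT := by
    change h (h.symm _) ∉ N.G.graph.vertexSet
    rw [h.apply_symm_apply]
    exact N.interior_notMem e _ (ENNReal.iicMulLeft_ne_bot hb) (ENNReal.iicMulLeft_ne_top hT)
  interior_injective e s e' s' h1 h2 h3 h4 heq := by
    have := N.interior_injective e (ENNReal.iicMulLeft h0 ht _ s) e'
      (ENNReal.iicMulLeft h0 ht _ s') (ENNReal.iicMulLeft_ne_bot h1) (ENNReal.iicMulLeft_ne_top h2)
      (ENNReal.iicMulLeft_ne_bot h3) (ENNReal.iicMulLeft_ne_top h4) (h.symm.injective heq)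
    obtain rfl : e = e' := congrArg Sigma.fst this
    rw [(ENNReal.iicMulLeft h0 ht (N.G.length e)).injective (eq_of_heq (Sigma.mk.inj this).2)]
  exists_of_notMem x hx := by
    obtain ⟨e, t, h1, h2, h3⟩ := N.exists_of_notMem (h x) hx
    refine ⟨e, (ENNReal.iicMulLeft h0 ht _).symm t, ?_, ?_, ?_⟩
    · exact fun hb => h1 (((ENNReal.iicMulLeft h0 ht _).symm_apply_eq.1 hb).trans (map_bot _))
    · exact fun hT => h2 (((ENNReal.iicMulLeft h0 ht _).symm_apply_eq.1 hT).trans (map_top _))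
    · rw [OrderIso.apply_symm_apply, h3, h.symm_apply_apply]
  isOpen_iff U := by
    rw [← h.symm.isOpen_preimage, N.isOpen_iff]
    refine forall_congr' fun e => ?_
    exact ((ENNReal.iicMulLeft h0 ht (N.G.length e)).toHomeomorph.isOpen_preimage).symm

variable {N : GraphPresentation X} {h : X ≃ₜ X} {c : ℝ≥0∞} {h0 : c ≠ 0} {ht : c ≠ ∞}

theorem PathLength.of_comap {x y : X} {L : ℝ≥0∞} (hL : (N.comap h h0 ht).PathLength x y L) :
    N.PathLength (h x) (h y) (c * L) := by
  induction hL with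
  | refl x => rw [mul_zero]; exact .refl _
  | step e s t _ ih =>
    have h1 : ∀ u, h ((N.comap h h0 ht).edge e u) = N.edge e (ENNReal.iicMulLeft h0 ht _ u) :=
      fun u => h.apply_symm_apply _
    rw [h1] at ih ⊢
    rw [mul_add, ← ENNReal.edist_mul_left ht]
    exact .step (M := N) e (ENNReal.iicMulLeft h0 ht _ s) (ENNReal.iicMulLeft h0 ht _ t) ih

theorem PathLength.comap (h : X ≃ₜ X) (h0 : c ≠ 0) (ht : c ≠ ∞) {x y : X} {L : ℝ≥0∞}
    (hL : N.PathLength x y L) :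
    (N.comap h h0 ht).PathLength (h.symm x) (h.symm y) (c⁻¹ * L) := by
  induction hL with
  | refl x => rw [mul_zero]; exact .refl _
  | step e s t _ ih =>
    have h1 : ∀ u, h.symm (N.edge e u) =
        (N.comap h h0 ht).edge e ((ENNReal.iicMulLeft h0 ht _).symm u) :=
      fun u => by
        change _ = h.symm (N.edge e (ENNReal.iicMulLeft h0 ht _ _))
        rw [OrderIso.apply_symm_apply]
    rw [h1] at ih ⊢
    rw [mul_add, ← ENNReal.edist_mul_left (ENNReal.inv_ne_top.2 h0)]
    exact .step (M := N.comap h h0 ht) e ((ENNReal.iicMulLeft h0 ht _).symm s)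
      ((ENNReal.iicMulLeft h0 ht _).symm t) ih

theorem dist_comap (x y : X) : c * (N.comap h h0 ht).dist x y = N.dist (h x) (h y) := by
  refine le_antisymm (le_sInf fun L hL => ?_) ?_
  · have h1 := (N.comap h h0 ht).dist_le_of_pathLength (PathLength.comap h h0 ht hL)
    rw [h.symm_apply_apply, h.symm_apply_apply] at h1
    calc c * _ ≤ c * (c⁻¹ * L) := mul_le_mul_right h1 c
      _ = L := ENNReal.mul_inv_cancel_left h0 ht
  · have h1 : c⁻¹ * N.dist (h x) (h y) ≤ (N.comap h h0 ht).dist x y := le_sInf fun L hL => by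
      calc c⁻¹ * _ ≤ c⁻¹ * (c * L) :=
            mul_le_mul_right (N.dist_le_of_pathLength (PathLength.of_comap hL)) _
        _ = L := ENNReal.inv_mul_cancel_left h0 ht
    calc N.dist (h x) (h y) = c * (c⁻¹ * _) := (ENNReal.mul_inv_cancel_left h0 ht).symm
      _ ≤ _ := mul_le_mul_right h1 c

end GraphPresentation

namespace TropicalModel

variable {X : Type*} [TopologicalSpace X] [EDist X]

/-- The preimage of a model under a homeomorphism that multiplies distances by `c`. -/
noncomputable def comap (N : TropicalModel X) (h : X ≃ₜ X) {c : ℝ≥0∞} (h0 : c ≠ 0)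
    (ht : c ≠ ∞) (hh : ∀ x y : X, edist (h x) (h y) = c * edist x y) : TropicalModel X where
  toGraphPresentation := N.toGraphPresentation.comap h h0 ht
  edist_eq x y := by
    have h1 := hh x y
    rw [N.edist_eq, ← GraphPresentation.dist_comap (h0 := h0) (ht := ht)] at h1
    rw [← ENNReal.inv_mul_cancel_left h0 ht (b := edist x y), ← h1,
      ENNReal.inv_mul_cancel_left h0 ht]

end TropicalModel

/-- Points at infinity are defined through arbitrary models, and the pullback of a model along `h`
is a model in which the preimage of an infinite end is an infinite end. -/
theorem symm_mem_pointsAtInfinity {X : Type*} [TopologicalSpace X] [EDist X] {h : X ≃ₜ X}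
    {c : ℝ≥0∞} (h0 : c ≠ 0) (ht : c ≠ ∞) (hh : ∀ x y : X, edist (h x) (h y) = c * edist x y) {x : X}
    (hx : x ∈ pointsAtInfinity X) : h.symm x ∈ pointsAtInfinity X := by
  obtain ⟨N, e, he, rfl⟩ := hx
  refine ⟨N.comap h h0 ht hh, e, ?_, ?_⟩
  · change c⁻¹ * N.G.length e = ∞
    rw [he, ENNReal.mul_top (ENNReal.inv_ne_zero.2 ht)]
  · change h.symm (N.edge e (ENNReal.iicMulLeft h0 ht _ ⊤)) = _
    rw [OrderIso.map_top]

theorem edist_symm_eq {X : Type*} [TopologicalSpace X] [EDist X] {h : X ≃ₜ X}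
    {c : ℝ≥0∞} (h0 : c ≠ 0) (ht : c ≠ ∞) (hh : ∀ x y : X, edist (h x) (h y) = c * edist x y)
    (x y : X) : edist (h.symm x) (h.symm y) = c⁻¹ * edist x y := by
  have := hh (h.symm x) (h.symm y)
  rw [h.apply_symm_apply, h.apply_symm_apply] at this
  rw [this, ENNReal.inv_mul_cancel_left h0 ht]

theorem symm_mem_pointsAtInfinity_iff {X : Type*} [TopologicalSpace X] [EDist X] {h : X ≃ₜ X}
    {c : ℝ≥0∞} (h0 : c ≠ 0) (ht : c ≠ ∞) (hh : ∀ x y : X, edist (h x) (h y) = c * edist x y) {x : X} :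
    h.symm x ∈ pointsAtInfinity X ↔ x ∈ pointsAtInfinity X := by
  refine ⟨fun hx => ?_, symm_mem_pointsAtInfinity h0 ht hh⟩
  have := symm_mem_pointsAtInfinity (h := h.symm) (ENNReal.inv_ne_zero.2 ht)
    (ENNReal.inv_ne_top.2 h0) (edist_symm_eq h0 ht hh) hx
  rwa [Homeomorph.symm_symm, h.apply_symm_apply] at this

/-- If `u` is piecewise affine on `[0, l]`, then `k u(k⁻¹ t)` is piecewise affine on `[0, k l]`. -/
theorem IsPiecewiseAffine.scale {L L' : ℝ≥0∞} {u : Set.Iic L → EReal} (hu : IsPiecewiseAffine u)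
    {k : ℝ} (hk : 0 < k) {σ : Set.Iic L' → Set.Iic L} {w : Set.Iic L' → EReal}
    (hσ : ∀ t : Set.Iic L', ENNReal.ofReal k * (σ t : ℝ≥0∞) = t)
    (hw : ∀ t, w t = (k : EReal) * u (σ t)) : IsPiecewiseAffine w := by
  obtain ⟨ι, _, I, m, c, h1, h2, h3⟩ := hu
  have h4 : ∀ t : Set.Iic L', (t : ℝ≥0∞) ≠ ∞ →
      (σ t : ℝ≥0∞) ≠ ∞ ∧ (t : ℝ≥0∞).toReal = k * (σ t : ℝ≥0∞).toReal := by
    intro t ht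
    refine ⟨fun h => ht ?_, ?_⟩
    · rw [← hσ t, h, ENNReal.mul_top (ENNReal.ofReal_pos.2 hk).ne']
    · rw [← hσ t, ENNReal.toReal_mul, ENNReal.toReal_ofReal hk.le]
  have h5 : ∀ a : ℝ, k⁻¹ * (k * a) = a := fun a => by field_simp
  refine ⟨ι, inferInstance, fun i => {x | k⁻¹ * x ∈ I i}, m, fun i => k * c i, fun i => ?_,
    fun t ht => ?_, fun i t ht hi => ?_⟩
  · exact (h1 i).preimage_mono fun a b hab => mul_le_mul_of_nonneg_left hab (inv_nonneg.2 hk.le)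
  · obtain ⟨i, hi⟩ := h2 (σ t) (h4 t ht).1
    refine ⟨i, ?_⟩
    rw [mem_ofPred_eq, (h4 t ht).2, h5]
    exact hi
  · rw [mem_ofPred_eq, (h4 t ht).2, h5] at hi
    rw [hw, h3 i _ (h4 t ht).1 hi, (h4 t ht).2, ← EReal.coe_mul]
    congr 1
    ring

theorem EReal.continuous_coe_mul {k : ℝ} : Continuous fun y : EReal => (k : EReal) * y :=
  continuous_iff_continuousAt.2 fun _ => EReal.Tendsto.const_mul tendsto_id
    (Or.inl (EReal.coe_ne_bot k)) (Or.inl (EReal.coe_ne_top k))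

/-! ### The automorphism induced by a homothety -/

section Rescaling

variable {X : Type*} [TopologicalSpace X] [EDist X] {h : X ≃ₜ X} {k : ℝ}

/-- Composition with `h⁻¹` divides slopes by `k`, and the factor `k` in front restores them, so they
remain the same integers. Piecewise affinity on a model `M` comes from that of `f` on the pullback
of `M`, which is why it was required for all models. -/
theorem IsRationalFunction.rescale (hk : 0 < k)
    (hh : ∀ x y : X, edist (h x) (h y) = ENNReal.ofReal k * edist x y) {f : X → EReal}
    (hf : IsRationalFunction f) : IsRationalFunction fun x => (k : EReal) * f (h.symm x) := by
  have h0 : ENNReal.ofReal k ≠ 0 := (ENNReal.ofReal_pos.2 hk).ne'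
  have ht : ENNReal.ofReal k ≠ ∞ := ENNReal.ofReal_ne_top
  rcases hf with rfl | ⟨h1, h2, h3⟩
  · exact Or.inl (funext fun _ => EReal.coe_mul_bot_of_pos hk)
  · refine Or.inr ⟨EReal.continuous_coe_mul.comp (h1.comp h.symm.continuous), fun x hx => ?_,
      fun M e => ?_⟩
    · have h4 := h2 (h.symm x) (mt (symm_mem_pointsAtInfinity_iff h0 ht hh).1 hx)
      lift f (h.symm x) to ℝ using ⟨h4.2, h4.1⟩ with r
      rw [← EReal.coe_mul]
      exact ⟨EReal.coe_ne_bot _, EReal.coe_ne_top _⟩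
    · refine (h3 (M.comap h h0 ht hh) e).scale hk
        (σ := (ENNReal.iicMulLeft h0 ht (M.G.length e)).symm) (fun t => ?_) fun t => ?_
      · exact ENNReal.mul_inv_cancel_left (b := (t : ℝ≥0∞)) h0 ht
      · change _ = (k : EReal) * f (h.symm (M.edge e (ENNReal.iicMulLeft h0 ht _ _)))
        rw [OrderIso.apply_symm_apply]
        rfl

namespace RatFun

/-- The automorphism of the semiring of rational functions that is induced by a homeomorphism
that multiplies distances by `k`. -/
noncomputable def rescale (hk : 0 < k)
    (hh : ∀ x y : X, edist (h x) (h y) = ENNReal.ofReal k * edist x y) : RatFun X ≃+* RatFun X where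
  toFun f := ⟨fun x => (k : EReal) * f (h.symm x), f.isRational.rescale hk hh⟩
  invFun f := ⟨fun x => ((k⁻¹ : ℝ) : EReal) * f (h x), f.isRational.rescale (h := h.symm)
    (inv_pos.2 hk) fun x y => by
      rw [edist_symm_eq (ENNReal.ofReal_pos.2 hk).ne' ENNReal.ofReal_ne_top hh,
        ENNReal.ofReal_inv_of_pos hk]⟩
  left_inv f := ext_finite fun x _ => by
    change ((k⁻¹ : ℝ) : EReal) * ((k : EReal) * f (h.symm (h x))) = f x
    rw [h.symm_apply_apply, ← mul_assoc, ← EReal.coe_mul, inv_mul_cancel₀ hk.ne', EReal.coe_one,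
      one_mul]
  right_inv f := ext_finite fun x _ => by
    change (k : EReal) * (((k⁻¹ : ℝ) : EReal) * f (h (h.symm x))) = f x
    rw [h.apply_symm_apply, ← mul_assoc, ← EReal.coe_mul, mul_inv_cancel₀ hk.ne', EReal.coe_one,
      one_mul]
  map_mul' f g := ext_finite fun x hx => by
    have hx' := mt (symm_mem_pointsAtInfinity_iff (ENNReal.ofReal_pos.2 hk).ne'
      ENNReal.ofReal_ne_top hh).1 hx
    rw [mul_apply _ _ hx]
    change (k : EReal) * (f * g) (h.symm x) = k * f (h.symm x) + k * g (h.symm x)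
    rw [mul_apply _ _ hx']
    exact EReal.left_distrib_of_nonneg_of_ne_top (EReal.coe_nonneg.2 hk.le) (EReal.coe_ne_top k) _ _
  map_add' f g := ext_finite fun x _ =>
    (show Monotone fun y : EReal => (k : EReal) * y from fun a b hab =>
      mul_le_mul_of_nonneg_left hab (EReal.coe_nonneg.2 hk.le)).map_max

theorem rescale_realConst (hk : 0 < k)
    (hh : ∀ x y : X, edist (h x) (h y) = ENNReal.ofReal k * edist x y) (c : ℝ) :
    rescale hk hh (realConst X c) = realConst X (k * c) :=
  ext_finite fun _ _ => (EReal.coe_mul k c).symm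

theorem algebraAutSubgroup_lt_top [TropicalCurve X] (hk : 0 < k) (hk1 : k ≠ 1)
    (hh : ∀ x y : X, edist (h x) (h y) = ENNReal.ofReal k * edist x y) :
    algebraAutSubgroup TropicalSemifield (RatFun X) < ⊤ := by
  refine lt_top_iff_ne_top.2 fun htop => hk1 ?_
  have h1 : rescale hk hh ∈ algebraAutSubgroup TropicalSemifield (RatFun X) :=
    htop ▸ Subgroup.mem_top _
  have h2 := (mem_algebraAutSubgroup_iff _).1 h1 1
  rw [rescale_realConst, mul_one] at h2
  exact realConst_injective h2

end RatFun

end Rescaling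

/-! ### Dilations of the infinite star -/

namespace TropicalModel

variable {X : Type*} [TopologicalSpace X] [EDist X] (M : TropicalModel X)

/-- If all edges have infinite length, then the graph is a star. -/
theorem exists_center (hM : ∀ e, M.G.length e = ∞) :
    ∃ p, (∀ e, M.edge e ⊥ = p) ∧ ∀ x, x = p ∨ ∃ e t, t ≠ ⊥ ∧ M.edge e t = x := by
  obtain ⟨p, hp, hfin⟩ := M.exists_finite_vertex
  have hptop : ∀ e, M.edge e ⊤ ≠ p := fun e h =>
    hfin (h ▸ M.edge_top_mem_pointsAtInfinity (hM e))
  -- Every upper end is a leaf at infinity and belongs to a single edge. A walk from the finite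
  -- vertex `p` can therefore only go out to such a leaf and come back to `p`.
  have hreach : ∀ v, Relation.ReflTransGen M.G.graph.Adj p v →
      v = p ∨ ∃ e, M.edge e ⊥ = p ∧ M.edge e ⊤ = v := by
    intro v hv
    induction hv with
    | refl => exact Or.inl rfl
    | @tail v v' _ hadj ih =>
      obtain ⟨e', he'⟩ := hadj
      obtain ⟨e, rfl⟩ : ∃ e : M.G.graph.edgeSet, (e : M.E) = e' := ⟨⟨e', he'.edge_mem⟩, rfl⟩
      rcases (M.isLink e).eq_and_eq_or_eq_and_eq he' with ⟨rfl, rfl⟩ | ⟨rfl, rfl⟩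
      · rcases ih with h | ⟨e₂, -, h⟩
        · exact Or.inr ⟨e, h, rfl⟩
        · exact absurd h.symm (M.edge_bot_ne_top (hM e₂))
      · rcases ih with h | ⟨e₂, h2, h⟩
        · exact absurd h (hptop e)
        · obtain rfl := M.edge_top_eq (hM e) h
          exact Or.inl h2
  refine ⟨p, fun e => ?_, fun x => ?_⟩
  · rcases hreach _ (M.G.connected p hp _ (M.edge_bot_mem e)) with h | ⟨e₂, -, h⟩
    · exact h
    · exact absurd h.symm (M.edge_bot_ne_top (hM e₂))
  · by_cases hx : x ∈ M.G.graph.vertexSet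
    · exact (hreach x (M.G.connected p hp x hx)).imp_right fun ⟨e, _, h⟩ =>
        ⟨e, ⊤, (M.bot_ne_top e).symm, h⟩
    · obtain ⟨e, t, h0, -, h⟩ := M.exists_of_notMem x hx
      exact Or.inr ⟨e, t, h0, h⟩

variable {M}

/-- Multiplication by `c` on an edge of infinite length. -/
noncomputable def mulEdge (hM : ∀ e, M.G.length e = ∞) (c : ℝ≥0∞) {e : M.G.graph.edgeSet}
    (t : Set.Iic (M.G.length e)) : Set.Iic (M.G.length e) :=
  ⟨c * t, le_top.trans_eq (hM e).symm⟩

variable {hM : ∀ e, M.G.length e = ∞} {p : X}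

/-- Only the centre has more than one parameter. All its parameters are `0`, and multiplication by
`c` fixes `0`, so the dilation is well defined. -/
theorem exists_dilation (hp : ∀ e, M.edge e ⊥ = p)
    (hsurj : ∀ x, x = p ∨ ∃ e t, t ≠ ⊥ ∧ M.edge e t = x) (c : ℝ≥0∞) :
    ∃ f : X → X, f p = p ∧ ∀ e t, f (M.edge e t) = M.edge e (mulEdge hM c t) := by
  have key : ∀ x, ∃ y, (x = p → y = p) ∧ ∀ e t, M.edge e t = x → M.edge e (mulEdge hM c t) = y := by
    have h0 : ∀ e t, t ≠ ⊥ → M.edge e t ≠ p := by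
      intro e t ht h
      have := M.edge_eq_of_ne_bot (hM e) ht ((hp e).trans h.symm)
      exact ht (eq_of_heq (Sigma.mk.inj this).2).symm
    intro x
    by_cases hx : x = p
    · refine ⟨p, fun _ => rfl, fun e t ht => ?_⟩
      have : t = ⊥ := by
        by_contra h
        exact h0 e t h (ht.trans hx)
      rw [this, ← hp e]
      exact congrArg _ (Subtype.ext (mul_zero c))
    · obtain ⟨e, t, ht, rfl⟩ := (hsurj x).resolve_left hx
      refine ⟨M.edge e (mulEdge hM c t), fun h => absurd h hx, fun e' t' h => ?_⟩
      have := M.edge_eq_of_ne_bot (hM e) ht h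
      obtain rfl : e' = e := congrArg Sigma.fst this
      rw [eq_of_heq (Sigma.mk.inj this).2]
  choose f hf hf' using key
  exact ⟨f, hf p rfl, fun e t => (hf' _ e t rfl).symm⟩

theorem continuous_dilation {c : ℝ≥0∞} (hc : c ≠ ∞) {f : X → X}
    (hf : ∀ e t, f (M.edge e t) = M.edge e (mulEdge hM c t)) : Continuous f := by
  refine continuous_def.2 fun U hU => (M.isOpen_iff _).2 fun e => ?_
  have h1 : M.edge e ⁻¹' (f ⁻¹' U) = mulEdge hM c ⁻¹' (M.edge e ⁻¹' U) := by
    ext t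
    rw [mem_preimage, mem_preimage, hf]
    rfl
  rw [h1]
  refine (hU.preimage (M.continuous_edge e)).preimage ?_
  exact ((ENNReal.continuous_const_mul hc).comp continuous_subtype_val).subtype_mk _

/-- The dilation takes a path to a path step by step and multiplies its length by `c`. Equality
follows later from the same bound for the inverse dilation. -/
theorem edist_dilation_le {c : ℝ≥0∞} (h0 : c ≠ 0) (hc : c ≠ ∞) {f : X → X}
    (hf : ∀ e t, f (M.edge e t) = M.edge e (mulEdge hM c t)) (x y : X) :
    edist (f x) (f y) ≤ c * edist x y := by
  have h1 : ∀ x y L, M.PathLength x y L → M.PathLength (f x) (f y) (c * L) := by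
    intro x y L h
    induction h with
    | refl x => rw [mul_zero]; exact .refl _
    | step e s t _ ih =>
      rw [hf] at ih ⊢
      rw [mul_add, ← ENNReal.edist_mul_left hc]
      exact .step e (mulEdge hM c s) (mulEdge hM c t) ih
  have h2 : c⁻¹ * edist (f x) (f y) ≤ edist x y := by
    rw [M.edist_eq, M.edist_eq]
    refine le_sInf fun L hL => ?_
    calc c⁻¹ * _ ≤ c⁻¹ * (c * L) := mul_le_mul_right (M.dist_le_of_pathLength (h1 x y L hL)) _
      _ = L := ENNReal.inv_mul_cancel_left h0 hc
  calc edist (f x) (f y) = c * (c⁻¹ * _) := (ENNReal.mul_inv_cancel_left h0 hc).symm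
    _ ≤ _ := mul_le_mul_right h2 c

/-- The dilation of a star whose edges all have infinite length. -/
theorem exists_homeomorph_edist_eq (hM : ∀ e, M.G.length e = ∞) {c : ℝ≥0∞} (h0 : c ≠ 0)
    (hc : c ≠ ∞) : ∃ h : X ≃ₜ X, ∀ x y, edist (h x) (h y) = c * edist x y := by
  obtain ⟨p, hp, hsurj⟩ := M.exists_center hM
  obtain ⟨f, hfp, hf⟩ := exists_dilation (hM := hM) hp hsurj c
  obtain ⟨g, hgp, hg⟩ := exists_dilation (hM := hM) hp hsurj c⁻¹
  have hgf : ∀ x, g (f x) = x := by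
    intro x
    rcases hsurj x with rfl | ⟨e, t, -, rfl⟩
    · rw [hfp, hgp]
    · rw [hf, hg]
      exact congrArg _ (Subtype.ext (ENNReal.inv_mul_cancel_left h0 hc))
  have hfg : ∀ x, f (g x) = x := by
    intro x
    rcases hsurj x with rfl | ⟨e, t, -, rfl⟩
    · rw [hgp, hfp]
    · rw [hg, hf]
      exact congrArg _ (Subtype.ext (ENNReal.mul_inv_cancel_left h0 hc))
  have h0' := ENNReal.inv_ne_zero.2 hc
  have hc' := ENNReal.inv_ne_top.2 h0
  refine ⟨⟨⟨f, g, hgf, hfg⟩, continuous_dilation hc hf, continuous_dilation hc' hg⟩, fun x y => ?_⟩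
  refine le_antisymm (edist_dilation_le h0 hc hf x y) ?_
  have h1 := edist_dilation_le h0' hc' hg (f x) (f y)
  rw [hgf, hgf] at h1
  calc c * edist x y ≤ c * (c⁻¹ * edist (f x) (f y)) := mul_le_mul_right h1 c
    _ = _ := ENNReal.mul_inv_cancel_left h0 hc

end TropicalModel

theorem corollary6 (Γ : Type*) [TopologicalSpace Γ] [EDist Γ] [TropicalCurve Γ] :
    (∃ M : TropicalModel Γ, ∀ e : M.G.graph.edgeSet, M.G.length e = ∞) ↔
      algebraAutSubgroup TropicalSemifield (RatFun Γ) < ⊤ := by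
  refine ⟨fun ⟨M, hM⟩ => ?_, RatFun.exists_model_of_lt_top⟩
  -- Any positive factor other than one would do.
  obtain ⟨h, hh⟩ := M.exists_homeomorph_edist_eq hM (c := ENNReal.ofReal 2) (by simp) (by simp)
  exact RatFun.algebraAutSubgroup_lt_top two_pos (by norm_num) hh
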